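/- **Setting.** Let $k\ge1$, $\Omega=[0,2\pi]$, $T>0$, and let $u$ be a solution of $u_t=u_{xx}$ on $[0,2\pi]\times(0,T]$, continuous up to $t=0$, with $q=u_x$. Two choices of alternating fluxes are considered: (A) $\hat u_h=u_h^-,\ \hat q_h=q_h^+$ and (B) $\hat u_h=u_h^+,\ \hat q_h=q_h^-$. The boundary conditions are either periodic ($u(0,t)=u(2\pi,t)$, $u_x(0,t)=u_x(2\pi,t)$), with (A) or (B); or mixed: $u(0,t)=g_0(t),\ u_x(2\pi,t)=g_1(t)$ with (A), and $u_x(0,t)=g_0(t),\ u(2\pi,t)=g_1(t)$ with (B). Let $0=x_{1/2}<x_{3/2}<\dots<x_{N+1/2}=2\pi$, $\tau_j=(x_{j-1/2},x_{j+1/2})$, $h_j=x_{j+1/2}-x_{j-1/2}$, $\bar h_j=h_j/2$, $h=\max_j h_j$, with $h\le c\,h_j$ for all $j$. Let $V_h$ be the space of functions that are polynomials of degree at most $k$ on each $\tau_j$, and $(v,w)_j=\int_{\tau_j}vw\,dx$. The LDG solution is a pair $u_h(\cdot,t),q_h(\cdot,t)\in V_h$, $0\le t\le T$, with $u_h$ differentiable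 in $t$, such that for all $j$ and all $v,w\in V_h$ $$(u_{ht},v)_j=-(q_h,v_x)_j+\hat q_hv^-|_{j+\frac12}-\hat q_hv^+|_{j-\frac12},\qquad (q_h,w)_j=-(u_h,w_x)_j+\hat u_hw^-|_{j+\frac12}-\hat u_hw^+|_{j-\frac12}.$$ At an end point of $\Omega$ where the one-sided limit required by a flux lies outside $\Omega$, it is the limit at the other end point (periodic case) or the boundary value $g_0(t)$ or $g_1(t)$ (mixed case). **The special initial value.** On $\tau_j$ let $P_h^\mp v$ be the polynomial of degree at most $k$ with $(P_h^\mp v,w)_j=(v,w)_j$ for all polynomials $w$ of degree less than $k$ that equals $v$ at the right end point ($P_h^-$), respectively at the left end point ($P_h^+$); let $D_s^{-1}v(x)=\bar h_j^{-1}\int_{x_{j-1/2}}^xv$; and let $L_{j,m}$ be the Legendre polynomial of degree $m$ on $\tau_j$ with value $1$ at $x_{j+1/2}$. Put $$F_{1,1}=P_h^+D_s^{-1}L_{j,k},\quad F_{1,i}=(P_h^+D_s^{-1}P_h^-D_s^{-1})^{i-1}F_{1,1},\quad F_{2,1}=P_h^-D_s^{-1}L_{j,k},\quad F_{2,i}=(P_h^-D_s^{-1}P_h^+D_s^{-1})^{i-1}F_{2,1},$$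 $$\bar F_{1,i}=P_h^-D_s^{-1}F_{1,i},\qquad \bar F_{2,i}=P_h^+D_s^{-1}F_{2,i}.$$ Let $\bar v_{j,k}$ and $\tilde v_{j,k}$ be the coefficients of $L_{j,k}$ in the Legendre expansions on $\tau_j$ of $v-P_h^-v$ and of $v-P_h^+v$. For (A) let $G_i(t)=\partial_t^i\bar u_{j,k}(t)$, $Q_i(t)=\partial_t^i\tilde q_{j,k}(t)$ and $$u_I^k=P_h^-u-\sum_{i=1}^{\lfloor k/2\rfloor}\bar h_j^{2i}G_i\bar F_{1,i}-\sum_{i=1}^{\lceil k/2\rceil}\bar h_j^{2i-1}Q_{i-1}F_{2,i};$$ for (B) let $G_i(t)=\partial_t^i\tilde u_{j,k}(t)$, $Q_i(t)=\partial_t^i\bar q_{j,k}(t)$ and $$u_I^k=P_h^+u-\sum_{i=1}^{\lceil k/2\rceil}\bar h_j^{2i-1}Q_{i-1}F_{1,i}-\sum_{i=1}^{\lfloor k/2\rfloor}\bar h_j^{2i}G_i\bar F_{2,i}.$$ **Theorem.** Let $\|u\|_{2k+2,\infty}(t)=\sup_{0\le s\le t}\|u(\cdot,s)\|_{W^{2k+2,\infty}(0,2\pi)}$,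 assume $\|u\|_{2k+2,\infty}(T)<\infty$, and let $(u_h,q_h)$ be an LDG solution with $u_h(\cdot,0)=u_I^k(\cdot,0)$. Let $$e_{u,n}=\max_{1\le j\le N+1}|(u-\hat u_h)(x_{j-\frac12},t)|,\qquad \|e_u\|_*=\Big(\frac1{N+1}\sum_{j=1}^{N+1}(u-\hat u_h)^2(x_{j-\frac12},t)\Big)^{1/2},$$ and define $e_{q,n}$, $\|e_q\|_*$ in the same way with $q-\hat q_h$. Then there is a constant $K$, depending only on $k$ and $c$, such that in all the above cases, for all $t\in[0,T]$, $$e_{u,n}\le K(1+t)\,h^{2k+\frac12}\|u\|_{2k+2,\infty}(t),\qquad e_{q,n}\le K(1+t^{\frac12})\,h^{2k+\frac12}\|u\|_{2k+2,\infty}(t),$$ $$\|e_u\|_*\le K(1+t)\,h^{2k+1}\|u\|_{2k+2,\infty}(t),\qquad \|e_q\|_*\le K(1+t^{\frac12})\,h^{2k+1}\|u\|_{2k+2,\infty}(t).$$ -/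

import Mathlib

open MeasureTheory Set Polynomial
open scoped ENNReal

noncomputable section

namespace LDG

/-! ### Sobolev spaces `W^{m,∞}` on an interval -/

/-- `g` is a weak derivative of `f` on the open interval `(a, b)`. -/
def IsWeakDeriv (a b : ℝ) (f g : ℝ → ℝ) : Prop :=
  ∀ φ : ℝ → ℝ, ContDiff ℝ (⊤ : ℕ∞) φ → HasCompactSupport φ → tsupport φ ⊆ Ioo a b →
    ∫ x in a..b, f x * deriv φ x = -∫ x in a..b, g x * φ x

/-- `d 0, …, d m` are `f` and its weak derivatives of orders `0, …, m` on `(a, b)`,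
all of them essentially bounded. -/
structure IsWeakDerivSeq (a b : ℝ) (m : ℕ) (f : ℝ → ℝ) (d : ℕ → ℝ → ℝ) : Prop where
  zero : d 0 = f
  memLp : ∀ i ≤ m, MemLp (d i) ∞ (volume.restrict (Ioo a b))
  weakDeriv : ∀ i < m, IsWeakDeriv a b (d i) (d (i + 1))

/-- The norm of `f` in `W^{m,∞}(a, b)`: the largest of the essential suprema of the weak
derivatives of order at most `m`, and `∞` if `f ∉ W^{m,∞}(a, b)`. (Weak derivatives are unique
almost everywhere, so all sequences `d` in the infimum give the same value.) -/
def sobolevNorm (a b : ℝ) (m : ℕ) (f : ℝ → ℝ) : ℝ≥0∞ :=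
  ⨅ (d : ℕ → ℝ → ℝ) (_ : IsWeakDerivSeq a b m f d),
    ⨆ (i : ℕ) (_ : i ≤ m), eLpNorm (d i) ∞ (volume.restrict (Ioo a b))

/-- For `u = u(x, s)` on `[0, 2π]`, the supremum over `0 ≤ s ≤ t` of the norm of `u(·, s)` in
`W^{m,∞}(0, 2π)`. -/
def supNorm (m : ℕ) (u : ℝ → ℝ → ℝ) (t : ℝ) : ℝ≥0∞ :=
  ⨆ s ∈ Icc (0 : ℝ) t, sobolevNorm 0 (2 * Real.pi) m (fun x => u x s)

/-! ### The heat equation -/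

/-- The spatial derivative `u_x(x, t)`, one-sided at the end points of `[0, 2π]`. -/
def dx (u : ℝ → ℝ → ℝ) (x t : ℝ) : ℝ :=
  derivWithin (fun y => u y t) (Icc 0 (2 * Real.pi)) x

/-- `u` is a classical solution of `u_t = u_xx` on `[0, 2π] × (0, T]`, continuous up to `t = 0`;
derivatives at the boundary are one-sided. -/
structure IsHeatSolution (T : ℝ) (u : ℝ → ℝ → ℝ) : Prop where
  continuousOn : ContinuousOn (fun p : ℝ × ℝ => u p.1 p.2) (Icc 0 (2 * Real.pi) ×ˢ Icc 0 T)
  contDiffOn : ∀ t ∈ Ioc 0 T, ContDiffOn ℝ 2 (fun x => u x t) (Icc 0 (2 * Real.pi))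
  heat : ∀ t ∈ Ioc 0 T, ∀ x ∈ Icc 0 (2 * Real.pi),
    HasDerivWithinAt (fun s => u x s)
      (iteratedDerivWithin 2 (fun y => u y t) (Icc 0 (2 * Real.pi)) x) (Icc 0 T) t

/-- The two choices of alternating fluxes: `left` is `û = u⁻, q̂ = q⁺`,
`right` is `û = u⁺, q̂ = q⁻`. -/
inductive Flux
  | left
  | right

/-- Periodic boundary conditions, or mixed ones with data `g₀` (at `x = 0`)
and `g₁` (at `x = 2π`). -/
inductive Boundary
  | periodic
  | mixed (g₀ g₁ : ℝ → ℝ)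

/-- The boundary conditions for the exact solution. The mixed condition is
`u(0,t) = g₀(t), u_x(2π,t) = g₁(t)` if the fluxes are `û = u⁻, q̂ = q⁺`, and
`u_x(0,t) = g₀(t), u(2π,t) = g₁(t)` if the fluxes are `û = u⁺, q̂ = q⁻`. -/
def SatisfiesBoundary (T : ℝ) (u : ℝ → ℝ → ℝ) : Flux → Boundary → Prop
  | _, .periodic => ∀ t ∈ Icc 0 T,
      u 0 t = u (2 * Real.pi) t ∧ dx u 0 t = dx u (2 * Real.pi) t
  | .left, .mixed g₀ g₁ => ∀ t ∈ Icc 0 T, u 0 t = g₀ t ∧ dx u (2 * Real.pi) t = g₁ t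
  | .right, .mixed g₀ g₁ => ∀ t ∈ Icc 0 T, dx u 0 t = g₀ t ∧ u (2 * Real.pi) t = g₁ t

/-! ### Meshes and broken polynomials -/

/-- A mesh `0 = x_{1/2} < x_{3/2} < … < x_{N+1/2} = 2π` with `N` cells; `node i` is `x_{i+1/2}`,
`i = 0, …, N`, and the cell with index `j = 0, …, N-1` is `(node j, node (j+1))`. -/
structure Mesh (N : ℕ) where
  node : Fin (N + 1) → ℝ
  strictMono : StrictMono node
  first : node 0 = 0
  last : node (Fin.last N) = 2 * Real.pi

namespace Mesh

variable {N : ℕ}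

/-- Left end point of a cell. -/
def lo (M : Mesh N) (j : Fin N) : ℝ := M.node j.castSucc

/-- Right end point of a cell. -/
def hi (M : Mesh N) (j : Fin N) : ℝ := M.node j.succ

/-- Length of a cell. -/
def width (M : Mesh N) (j : Fin N) : ℝ := M.hi j - M.lo j

/-- The mesh size `h`, the largest length of a cell. -/
def size (M : Mesh N) : ℝ := ⨆ j, M.width j

/-- Quasi-uniformity with constant `c`. -/
def QuasiUniform (M : Mesh N) (c : ℝ) : Prop := ∀ j, M.size ≤ c * M.width j

/-- The left limits `v⁻` of a broken polynomial `v` at the nodes; at the first node, where there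
is no cell to the left, the value `g` is prescribed. -/
def traceMinus (M : Mesh N) (g : ℝ) (v : Fin N → ℝ[X]) : Fin (N + 1) → ℝ :=
  Fin.cases g fun j => (v j).eval (M.hi j)

/-- The right limits `v⁺` of a broken polynomial `v` at the nodes; at the last node, where there
is no cell to the right, the value `g` is prescribed. -/
def tracePlus (M : Mesh N) (g : ℝ) (v : Fin N → ℝ[X]) : Fin (N + 1) → ℝ :=
  Fin.lastCases g fun j => (v j).eval (M.lo j)

end Mesh

/-! ### The LDG scheme -/

/-- Values at the nodes of the numerical flux `û_h` of `u_h = v` at time `t`. In the periodic case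
the missing one-sided limit at one end of `[0, 2π]` is the limit at the other end; in the mixed
case it is the boundary value of `u`. -/
def fluxU {N : ℕ} (M : Mesh N) (t : ℝ) (v : Fin N → ℝ[X]) :
    Flux → Boundary → Fin (N + 1) → ℝ
  | .left, .periodic => M.traceMinus (M.traceMinus 0 v (Fin.last N)) v
  | .left, .mixed g₀ _ => M.traceMinus (g₀ t) v
  | .right, .periodic => M.tracePlus (M.tracePlus 0 v 0) v
  | .right, .mixed _ g₁ => M.tracePlus (g₁ t) v

/-- Values at the nodes of the numerical flux `q̂_h` of `q_h = v` at time `t`, with the missing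
one-sided limit given by periodicity or by the boundary value of `u_x`. -/
def fluxQ {N : ℕ} (M : Mesh N) (t : ℝ) (v : Fin N → ℝ[X]) :
    Flux → Boundary → Fin (N + 1) → ℝ
  | .left, .periodic => M.tracePlus (M.tracePlus 0 v 0) v
  | .left, .mixed _ g₁ => M.tracePlus (g₁ t) v
  | .right, .periodic => M.traceMinus (M.traceMinus 0 v (Fin.last N)) v
  | .right, .mixed g₀ _ => M.traceMinus (g₀ t) v

/-- `(u_h, q_h)` solves the semi-discrete LDG scheme with polynomials of degree at most `k` on the
time interval `[0, T]`; `uh t j` is the polynomial (in `x`) equal to `u_h(·, t)` on the cell `j`. -/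
structure IsLDGSolution {N : ℕ} (k : ℕ) (M : Mesh N) (T : ℝ) (fl : Flux) (bc : Boundary)
    (uh qh : ℝ → Fin N → ℝ[X]) : Prop where
  degree_u : ∀ t ∈ Icc 0 T, ∀ j, (uh t j).natDegree ≤ k
  degree_q : ∀ t ∈ Icc 0 T, ∀ j, (qh t j).natDegree ≤ k
  differentiable : ∀ j i, DifferentiableOn ℝ (fun t => (uh t j).coeff i) (Icc 0 T)
  scheme_u : ∀ t ∈ Icc 0 T, ∀ j, ∀ v : ℝ[X], v.natDegree ≤ k →
    ∫ x in M.lo j..M.hi j, derivWithin (fun s => (uh s j).eval x) (Icc 0 T) t * v.eval x =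
      -(∫ x in M.lo j..M.hi j, (qh t j).eval x * v.derivative.eval x)
        + fluxQ M t (qh t) fl bc j.succ * v.eval (M.hi j)
        - fluxQ M t (qh t) fl bc j.castSucc * v.eval (M.lo j)
  scheme_q : ∀ t ∈ Icc 0 T, ∀ j, ∀ w : ℝ[X], w.natDegree ≤ k →
    ∫ x in M.lo j..M.hi j, (qh t j).eval x * w.eval x =
      -(∫ x in M.lo j..M.hi j, (uh t j).eval x * w.derivative.eval x)
        + fluxU M t (uh t) fl bc j.succ * w.eval (M.hi j)
        - fluxU M t (uh t) fl bc j.castSucc * w.eval (M.lo j)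

/-! ### Gauss–Radau projections and the corrected interpolant -/

/-- `p` is the Gauss–Radau projection of degree `k` of `v` on `(a, b)` that interpolates at `e`. -/
structure IsGaussRadau (k : ℕ) (a b e : ℝ) (v : ℝ → ℝ) (p : ℝ[X]) : Prop where
  natDegree_le : p.natDegree ≤ k
  moments : ∀ w : ℝ[X], w.degree < k →
    ∫ x in a..b, p.eval x * w.eval x = ∫ x in a..b, v x * w.eval x
  interp : p.eval e = v e

theorem IsGaussRadau.eq_zero {k : ℕ} {a b e : ℝ} (hab : a < b) (he : e = a ∨ e = b)
    {p : ℝ[X]} (hp : p.natDegree ≤ k)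
    (hm : ∀ w : ℝ[X], w.degree < k → ∫ x in a..b, p.eval x * w.eval x = 0)
    (h0 : p.eval e = 0) : p = 0 := by
  obtain ⟨r, rfl⟩ := dvd_iff_isRoot.mpr h0
  by_contra hne
  have hr : r ≠ 0 := fun h => hne (by simp [h])
  have hdeg : r.degree < k := by
    rw [natDegree_mul (X_sub_C_ne_zero e) hr, natDegree_X_sub_C] at hp
    rw [degree_eq_natDegree hr]
    exact_mod_cast (by omega : r.natDegree < k)
  have hz := hm r hdeg
  set s : ℝ := if e = a then 1 else -1 with hs
  have hpos : ∀ x ∈ Ioo a b, 0 < s * (x - e) := by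
    intro x hx
    rw [hs]
    split_ifs with h
    · subst h; linarith [hx.1]
    · rcases he with h' | h'
      · exact absurd h' h
      · subst h'; linarith [hx.2]
  have hcont : Continuous fun x => s * (((X - C e) * r).eval x * r.eval x) := by fun_prop
  have hroot : {x | r.eval x = 0}.Finite := by
    have : {x | r.eval x = 0} = r.rootSet ℝ := by
      ext x; simp [Polynomial.mem_rootSet, hr]
    rw [this]; exact r.rootSet_finite ℝ
  obtain ⟨x, hx, hxr⟩ : ∃ x ∈ Ioo a b, r.eval x ≠ 0 := by
    by_contra! hcon
    exact (Ioo_infinite hab) (hroot.subset fun x hx => hcon x hx)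
  have : 0 < ∫ x in a..b, s * (((X - C e) * r).eval x * r.eval x) := by
    refine intervalIntegral.integral_pos hab hcont.continuousOn ?_ ⟨x, Ioo_subset_Icc_self hx, ?_⟩
    · intro y hy
      rcases eq_or_lt_of_le hy.2 with h | h
      · have h2 : 0 ≤ s * (y - e) := by
          rw [hs]; split_ifs with h'
          · subst h'; linarith [hy.1]
          · rcases he with h'' | h''
            · exact absurd h'' h'
            · subst h''; linarith
        have := mul_nonneg h2 (mul_self_nonneg (r.eval y))
        simp only [eval_mul, eval_sub, eval_X, eval_C]
        linarith
      · have := mul_nonneg (hpos y ⟨hy.1, h⟩).le (mul_self_nonneg (r.eval y))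
        simp only [eval_mul, eval_sub, eval_X, eval_C]
        linarith
    · have := mul_pos (hpos x hx) (mul_self_pos.mpr hxr)
      simp only [eval_mul, eval_sub, eval_X, eval_C]
      linarith
  rw [intervalIntegral.integral_const_mul, hz, mul_zero] at this
  exact lt_irrefl _ this

/-- Uniqueness of the Gauss–Radau projections (`e` is one of the end points). -/
theorem IsGaussRadau.unique {k : ℕ} {a b e : ℝ} (hab : a < b) (he : e = a ∨ e = b)
    {v : ℝ → ℝ} {p q : ℝ[X]} (hp : IsGaussRadau k a b e v p) (hq : IsGaussRadau k a b e v q) :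
    p = q := by
  refine sub_eq_zero.mp (IsGaussRadau.eq_zero (k := k) hab he
    ((natDegree_sub_le p q).trans (max_le hp.1 hq.1)) (fun w hw => ?_)
    (by rw [eval_sub, hp.3, hq.3, sub_self]))
  have h1 : IntervalIntegrable (fun x => p.eval x * w.eval x) volume a b :=
    (by fun_prop : Continuous fun x => p.eval x * w.eval x).intervalIntegrable a b
  have h2 : IntervalIntegrable (fun x => q.eval x * w.eval x) volume a b :=
    (by fun_prop : Continuous fun x => q.eval x * w.eval x).intervalIntegrable a b
  simp only [eval_sub, sub_mul]
  rw [intervalIntegral.integral_sub h1 h2, hp.2 w hw, hq.2 w hw, sub_self]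

/-- Existence of the Gauss–Radau projections (`e` is one of the end points). -/
theorem exists_isGaussRadau (k : ℕ) {a b e : ℝ} (hab : a < b) (he : e = a ∨ e = b)
    {v : ℝ → ℝ} (hv : IntervalIntegrable v volume a b) :
    ∃ p, IsGaussRadau k a b e v p := by
  have hint : ∀ p q : ℝ[X], IntervalIntegrable (fun x => p.eval x * q.eval x) volume a b :=
    fun p q => (by fun_prop : Continuous fun x => p.eval x * q.eval x).intervalIntegrable a b
  let B : degreeLT ℝ (k + 1) →ₗ[ℝ] Module.Dual ℝ (degreeLT ℝ k) × ℝ :=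
    { toFun := fun p =>
        ({ toFun := fun w => ∫ x in a..b, p.1.eval x * w.1.eval x
           map_add' := fun w w' => by
             simp only [Submodule.coe_add, eval_add, mul_add]
             exact intervalIntegral.integral_add (hint _ _) (hint _ _)
           map_smul' := fun r w => by
             simp only [Submodule.coe_smul, eval_smul, smul_eq_mul, RingHom.id_apply]
             rw [← intervalIntegral.integral_const_mul]
             congr 1; ext x; ring }, p.1.eval e)
      map_add' := fun p p' => by
        refine Prod.ext (LinearMap.ext fun w => ?_) (by simp)
        simp only [Submodule.coe_add, eval_add, add_mul, LinearMap.coe_mk, AddHom.coe_mk,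
          Prod.fst_add, LinearMap.add_apply]
        exact intervalIntegral.integral_add (hint _ _) (hint _ _)
      map_smul' := fun r p => by
        refine Prod.ext (LinearMap.ext fun w => ?_) (by simp)
        simp only [Submodule.coe_smul, eval_smul, smul_eq_mul, RingHom.id_apply, LinearMap.coe_mk,
          AddHom.coe_mk, Prod.smul_fst, LinearMap.smul_apply]
        rw [← intervalIntegral.integral_const_mul]
        congr 1; ext x; ring }
  have hfin : Module.finrank ℝ (degreeLT ℝ (k + 1)) =
      Module.finrank ℝ (Module.Dual ℝ (degreeLT ℝ k) × ℝ) := by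
    rw [Module.finrank_prod, Subspace.dual_finrank_eq, Module.finrank_self,
      (degreeLTEquiv ℝ k).finrank_eq, (degreeLTEquiv ℝ (k + 1)).finrank_eq,
      Module.finrank_fin_fun, Module.finrank_fin_fun]
  have hnd : ∀ p : degreeLT ℝ (k + 1), p.1.natDegree ≤ k := by
    intro p
    rcases eq_or_ne p.1 0 with h | h
    · simp [h]
    · have := mem_degreeLT.mp p.2
      rw [degree_eq_natDegree h] at this
      exact Nat.lt_succ_iff.mp (by exact_mod_cast this)
  have hinj : Function.Injective B := by
    rw [← LinearMap.ker_eq_bot, LinearMap.ker_eq_bot']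
    intro p hp
    refine Subtype.ext (IsGaussRadau.eq_zero (k := k) hab he (hnd p) (fun w hw => ?_) ?_)
    · exact LinearMap.congr_fun (congrArg Prod.fst hp) ⟨w, mem_degreeLT.mpr hw⟩
    · exact congrArg Prod.snd hp
  have hvi : ∀ q : ℝ[X], IntervalIntegrable (fun x => v x * q.eval x) volume a b :=
    fun q => hv.mul_continuousOn (by fun_prop)
  let ℓ : Module.Dual ℝ (degreeLT ℝ k) :=
    { toFun := fun w => ∫ x in a..b, v x * w.1.eval x
      map_add' := fun w w' => by
        simp only [Submodule.coe_add, eval_add, mul_add]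
        exact intervalIntegral.integral_add (hvi _) (hvi _)
      map_smul' := fun r w => by
        simp only [Submodule.coe_smul, eval_smul, smul_eq_mul, RingHom.id_apply]
        rw [← intervalIntegral.integral_const_mul]
        congr 1; ext x; ring }
  obtain ⟨p, hp⟩ := (LinearMap.injective_iff_surjective_of_finrank_eq_finrank hfin).mp hinj
    (ℓ, v e)
  exact ⟨p.1, hnd p, fun w hw => LinearMap.congr_fun (congrArg Prod.fst hp)
    ⟨w, mem_degreeLT.mpr hw⟩, congrArg Prod.snd hp⟩

open Classical in
/-- The Gauss–Radau projection of `v` on `(a, b)` interpolating at the end point `e`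
(it exists and is unique if `v` is integrable). -/
def gaussRadau (k : ℕ) (a b e : ℝ) (v : ℝ → ℝ) : ℝ[X] :=
  if h : ∃ p, IsGaussRadau k a b e v p then h.choose else 0

/-- The projection `P_h^-` on the cell `(a, b)`, interpolating at the right end point. -/
def projMinus (k : ℕ) (a b : ℝ) (v : ℝ → ℝ) : ℝ[X] := gaussRadau k a b b v

/-- The projection `P_h^+` on the cell `(a, b)`, interpolating at the left end point. -/
def projPlus (k : ℕ) (a b : ℝ) (v : ℝ → ℝ) : ℝ[X] := gaussRadau k a b a v

/-- The integral operator `D_s^{-1}` on the cell `(a, b)`, whose half length is `(b - a) / 2`. -/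
def intOp (a b : ℝ) (v : ℝ → ℝ) (x : ℝ) : ℝ := ((b - a) / 2)⁻¹ * ∫ y in a..x, v y

/-- The Legendre polynomial of degree `m` on `[-1, 1]` with value `1` at `1`
(formula of Rodrigues). -/
def legendre (m : ℕ) : ℝ[X] :=
  C ((2 ^ m * (m.factorial : ℝ))⁻¹) * derivative^[m] ((X ^ 2 - 1) ^ m)

/-- The Legendre polynomial of degree `m` transported to the cell `(a, b)`. -/
def cellLegendre (a b : ℝ) (m : ℕ) (x : ℝ) : ℝ :=
  (legendre m).eval ((x - (a + b) / 2) / ((b - a) / 2))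

/-- The functions `F_{1,i}` on the cell `(a, b)`:
`F_{1,1} = P⁺ D⁻¹ L_k` and `F_{1,i} = (P⁺ D⁻¹ P⁻ D⁻¹)^{i-1} F_{1,1}`. -/
def F₁ (k : ℕ) (a b : ℝ) (i : ℕ) : ℝ[X] :=
  (fun p : ℝ[X] => projPlus k a b (intOp a b fun y =>
    (projMinus k a b (intOp a b fun z => p.eval z)).eval y))^[i - 1]
      (projPlus k a b (intOp a b (cellLegendre a b k)))

/-- The functions `F_{2,i}` on the cell `(a, b)`:
`F_{2,1} = P⁻ D⁻¹ L_k` and `F_{2,i} = (P⁻ D⁻¹ P⁺ D⁻¹)^{i-1} F_{2,1}`. -/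
def F₂ (k : ℕ) (a b : ℝ) (i : ℕ) : ℝ[X] :=
  (fun p : ℝ[X] => projMinus k a b (intOp a b fun y =>
    (projPlus k a b (intOp a b fun z => p.eval z)).eval y))^[i - 1]
      (projMinus k a b (intOp a b (cellLegendre a b k)))

/-- `F̄_{1,i} = P⁻ D⁻¹ F_{1,i}`. -/
def barF₁ (k : ℕ) (a b : ℝ) (i : ℕ) : ℝ[X] :=
  projMinus k a b (intOp a b fun y => (F₁ k a b i).eval y)

/-- `F̄_{2,i} = P⁺ D⁻¹ F_{2,i}`. -/
def barF₂ (k : ℕ) (a b : ℝ) (i : ℕ) : ℝ[X] :=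
  projPlus k a b (intOp a b fun y => (F₂ k a b i).eval y)

/-- The coefficient of `L_k` in the Legendre expansion of `v - P⁻ v` on the cell `(a, b)`. -/
def coeffMinus (k : ℕ) (a b : ℝ) (v : ℝ → ℝ) : ℝ :=
  -v b + (b - a)⁻¹ * ∫ x in a..b,
    v x * ∑ m ∈ Finset.range (k + 1), (2 * (m : ℝ) + 1) * cellLegendre a b m x

/-- The coefficient of `L_k` in the Legendre expansion of `v - P⁺ v` on the cell `(a, b)`. -/
def coeffPlus (k : ℕ) (a b : ℝ) (v : ℝ → ℝ) : ℝ :=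
  (-1) ^ (k + 1) * v a + (b - a)⁻¹ * ∫ x in a..b,
    v x * ∑ m ∈ Finset.range (k + 1), (-1) ^ (k + m) * (2 * (m : ℝ) + 1) * cellLegendre a b m x

/-- `G_i(t)`: the `i`-th time derivative of the coefficient belonging to `u`, whose projection is
`P⁻ u` for the fluxes `û = u⁻, q̂ = q⁺` and `P⁺ u` for the fluxes `û = u⁺, q̂ = q⁻`. -/
def G (k : ℕ) (a b T : ℝ) (u : ℝ → ℝ → ℝ) : Flux → ℕ → ℝ → ℝ
  | .left, i, t => iteratedDerivWithin i (fun s => coeffMinus k a b fun x => u x s) (Icc 0 T) t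
  | .right, i, t => iteratedDerivWithin i (fun s => coeffPlus k a b fun x => u x s) (Icc 0 T) t

/-- `Q_i(t)`: the `i`-th time derivative of the coefficient belonging to `q = u_x`, whose
projection is `P⁺ q` for the fluxes `û = u⁻, q̂ = q⁺` and `P⁻ q` for the fluxes
`û = u⁺, q̂ = q⁻`. -/
def Q (k : ℕ) (a b T : ℝ) (u : ℝ → ℝ → ℝ) : Flux → ℕ → ℝ → ℝ
  | .left, i, t => iteratedDerivWithin i (fun s => coeffPlus k a b fun x => dx u x s) (Icc 0 T) t
  | .right, i, t => iteratedDerivWithin i (fun s => coeffMinus k a b fun x => dx u x s) (Icc 0 T) t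

/-- The correction function `W_2^l(·, t)` on the cell `(a, b)`; here `l / 2 = ⌊l/2⌋` and
`(l + 1) / 2 = ⌈l/2⌉`. -/
def W₂ (k l : ℕ) (a b T : ℝ) (u : ℝ → ℝ → ℝ) (t : ℝ) : Flux → ℝ[X]
  | .left =>
      ∑ i ∈ Finset.Icc 1 (l / 2),
        C (((b - a) / 2) ^ (2 * i) * G k a b T u .left i t) * barF₁ k a b i
      + ∑ i ∈ Finset.Icc 1 ((l + 1) / 2),
        C (((b - a) / 2) ^ (2 * i - 1) * Q k a b T u .left (i - 1) t) * F₂ k a b i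
  | .right =>
      ∑ i ∈ Finset.Icc 1 ((l + 1) / 2),
        C (((b - a) / 2) ^ (2 * i - 1) * Q k a b T u .right (i - 1) t) * F₁ k a b i
      + ∑ i ∈ Finset.Icc 1 (l / 2),
        C (((b - a) / 2) ^ (2 * i) * G k a b T u .right i t) * barF₂ k a b i

/-- The special interpolant `u_I^l(·, t)` on the cell `(a, b)`: `P⁻ u - W_2^l` for the fluxes
`û = u⁻, q̂ = q⁺` and `P⁺ u - W_2^l` for the fluxes `û = u⁺, q̂ = q⁻`. -/
def interpolant (k l : ℕ) (a b T : ℝ) (u : ℝ → ℝ → ℝ) (t : ℝ) : Flux → ℝ[X]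
  | .left => projMinus k a b (fun x => u x t) - W₂ k l a b T u t .left
  | .right => projPlus k a b (fun x => u x t) - W₂ k l a b T u t .right

/-! ### Nodal errors -/

/-- The largest absolute value over the nodes. -/
def nodalMax {N : ℕ} (e : Fin (N + 1) → ℝ) : ℝ := ⨆ i, |e i|

/-- The discrete root mean square over the nodes. -/
def nodalRMS {N : ℕ} (e : Fin (N + 1) → ℝ) : ℝ :=
  Real.sqrt (1 / ((N : ℝ) + 1) * ∑ i, e i ^ 2)

/-- The errors `u - û_h` at the nodes, at time `t`. -/
def errU {N : ℕ} (M : Mesh N) (fl : Flux) (bc : Boundary) (u : ℝ → ℝ → ℝ)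
    (uh : ℝ → Fin N → ℝ[X]) (t : ℝ) (i : Fin (N + 1)) : ℝ :=
  u (M.node i) t - fluxU M t (uh t) fl bc i

/-- The errors `q - q̂_h` at the nodes, at time `t`, where `q = u_x`. -/
def errQ {N : ℕ} (M : Mesh N) (fl : Flux) (bc : Boundary) (u : ℝ → ℝ → ℝ)
    (qh : ℝ → Fin N → ℝ[X]) (t : ℝ) (i : Fin (N + 1)) : ℝ :=
  dx u (M.node i) t - fluxQ M t (qh t) fl bc i

end LDG

end

/-!
The interpolants `u_I` of `u` and `q_I` of `u_x` built from the correction functions are exact at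
the nodes, so the nodal errors are the fluxes of `ξ = u_I - u_h` and `η = q_I - q_h` for zero
boundary data (`errU_eq`, `errQ_eq`). By a trace inequality and quasi-uniformity
(`exists_nodal_le`), it suffices that `ξ` and `η` are of order `2k + 1` in `L²(0, 2π)`, which is
`exists_supercloseness`.

Each correction function is a projected antiderivative of the preceding one; after integration by
parts, the residuals of consecutive orders cancel, and only the last correction remains
(`integral_corrected_add`). It carries a factor `h^k` and a Gauss–Radau coefficient of
a `k`-th or `(k+1)`-st derivative of `u`; that coefficient annihilates polynomials of degree `k`
and yields another `h^(k+1)` (`exists_sq_norm_remainder_le`). For alternating fluxes the discrete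
derivatives `B` of `u_h` and of `q_h` are adjoint up to the sign (`sum_fluxForm_add`), so the
errors satisfy the dissipative system `η = -(B ξ + r)`, `ξ' = -B*(B ξ + r) - σ'`, where `r` and `σ`
are the last corrections (`coord_err_q`, `hasDerivWithinAt_coord_err_u`), and `ξ = 0` at `t = 0` by
the choice of the initial value.

With only `2k + 2` bounded derivatives of `u`, `r` and `σ` are of order `2k + 1` but `σ'` is not,
and an energy estimate does not suffice. Instead, `ξ` and `η` are tested with the solution of the
backward semidiscrete heat equation. Its smoothing bounds `‖S exp (-τ S)‖ ≤ 1 / τ` and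
`‖S² exp (-τ S)‖ ≤ 4 / τ²` allow to move the time derivative away from `σ`, so that only bounds and
time moduli of `r` and `σ` enter (`norm_le_of_dissipative`, `norm_flux_le_of_dissipative`). For `η`
the singularity at `τ = 0` is borderline, and moduli with an additional small power of
`(t - s) / t` are needed. These come from the `L²` moduli in time of the two highest derivatives
of `u` (`exists_time_modulus`). The sine coefficients of the highest derivative satisfy
a linear differential equation whose inhomogeneity consists of boundary values; these are Lipschitz
continuous in time, as an order `2k` derivative of `u` (`abs_sineCoeff_sub_exp_le`), and Parseval's
identity sums up the coefficients. No information on the boundary values beyond the regularity of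
`u` is used.

For these arguments Sobolev functions are replaced by classical representatives
(`exists_isClassicalRep`), and the heat equation is extended to the space derivatives of `u`
(`hasDerivWithinAt_time`), which identifies the time derivatives in the interpolant with space
derivatives (`corrCoeff_eq`). As the Sobolev norm is an infimum, the representatives are bounded by
the norm only up to a margin `δ`, which finally tends to zero.
-/


noncomputable section

namespace LDG

/-! ### Smoothing for a dissipative linear system -/

section Parabolic

variable {E : Type*} [NormedAddCommGroup E] [InnerProductSpace ℝ E]

local notation "⟪" x ", " y "⟫" => inner ℝ x y

/-- A mean value estimate with derivatives in the open interval only: `G` may have an infinite slope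
at the end points, as `√(t - s)` has at `s = t`. -/
theorem abs_sub_le_of_hasDerivAt {F f G g : ℝ → ℝ} {a b : ℝ} (hab : a ≤ b)
    (hF : ContinuousOn F (Icc a b)) (hG : ContinuousOn G (Icc a b))
    (hF' : ∀ s ∈ Ioo a b, HasDerivAt F (f s) s) (hG' : ∀ s ∈ Ioo a b, HasDerivAt G (g s) s)
    (h : ∀ s ∈ Ioo a b, |f s| ≤ g s) : |F b - F a| ≤ G b - G a := by
  have h1 : MonotoneOn (fun s => G s - F s) (Icc a b) := by
    refine monotoneOn_of_hasDerivWithinAt_nonneg (f' := fun s => g s - f s) (convex_Icc a b)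
      (hG.sub hF) (fun s hs => ?_) (fun s hs => ?_)
    · rw [interior_Icc] at hs
      exact ((hG' s hs).sub (hF' s hs)).hasDerivWithinAt
    · rw [interior_Icc] at hs
      have := (abs_le.1 (h s hs)).2
      linarith
  have h2 : MonotoneOn (fun s => G s + F s) (Icc a b) := by
    refine monotoneOn_of_hasDerivWithinAt_nonneg (f' := fun s => g s + f s) (convex_Icc a b)
      (hG.add hF) (fun s hs => ?_) (fun s hs => ?_)
    · rw [interior_Icc] at hs
      exact ((hG' s hs).add (hF' s hs)).hasDerivWithinAt
    · rw [interior_Icc] at hs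
      have := (abs_le.1 (h s hs)).1
      linarith
  have h3 := h1 (left_mem_Icc.2 hab) (right_mem_Icc.2 hab) hab
  have h4 := h2 (left_mem_Icc.2 hab) (right_mem_Icc.2 hab) hab
  simp only at h3 h4
  rw [abs_le]
  constructor <;> linarith

theorem norm_sum_smul_le {ι : Type*} [Fintype ι] (b : OrthonormalBasis ι ℝ E) (c : ι → ℝ)
    {m : ℝ} (hm : ∀ i, |c i| ≤ m) (hm0 : 0 ≤ m) (φ : E) :
    ‖∑ i, (c i * ⟪b i, φ⟫) • b i‖ ≤ m * ‖φ‖ := by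
  have h1 : ‖∑ i, (c i * ⟪b i, φ⟫) • b i‖ ^ 2 ≤ (m * ‖φ‖) ^ 2 := by
    rw [← real_inner_self_eq_norm_sq, b.orthonormal.inner_sum]
    rw [mul_pow, ← b.sum_sq_inner_right φ, Finset.mul_sum]
    refine Finset.sum_le_sum fun i _ => ?_
    simp only [conj_trivial]
    have : c i ^ 2 ≤ m ^ 2 := sq_le_sq' (by linarith [(abs_le.1 (hm i)).1]) (abs_le.1 (hm i)).2
    nlinarith [sq_nonneg ⟪b i, φ⟫]
  exact (abs_le_of_sq_le_sq' h1 (by positivity)).2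

theorem norm_le_of_inner_le {x : E} {m : ℝ} (hm : 0 ≤ m) (h : ∀ φ, |⟪x, φ⟫| ≤ m * ‖φ‖) :
    ‖x‖ ≤ m := by
  rcases eq_or_ne x 0 with rfl | hx
  · simpa using hm
  · have h1 := h x
    rw [real_inner_self_eq_norm_sq, abs_of_nonneg (sq_nonneg _), sq] at h1
    exact le_of_mul_le_mul_right h1 (norm_pos_iff.2 hx)

/-- `‖B x‖² = ⟪x, B* B x⟫`, in the form of an estimate. -/
theorem norm_sq_apply_le {B B' : E →ₗ[ℝ] E} (hadj : ∀ x y, ⟪B x, y⟫ = ⟪x, B' y⟫) (x : E) :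
    ‖B x‖ ^ 2 ≤ ‖x‖ * ‖B' (B x)‖ := by
  rw [← real_inner_self_eq_norm_sq, hadj]
  exact real_inner_le_norm _ _

theorem adjoint_swap {B B' : E →ₗ[ℝ] E} (hadj : ∀ x y, ⟪B x, y⟫ = ⟪x, B' y⟫) (x y : E) :
    ⟪B' x, y⟫ = ⟪x, B y⟫ := by
  rw [real_inner_comm, ← hadj, real_inner_comm]

variable [FiniteDimensional ℝ E]

/-- The semigroup `exp (-τ S)` of a symmetric nonnegative operator `S`, applied to a vector,
together with its smoothing estimates `‖S exp (-τ S)‖ ≤ 1 / τ` and `‖S² exp (-τ S)‖ ≤ 4 / τ²`. -/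
theorem exists_heat_flow (S : E →ₗ[ℝ] E) (hS : S.IsSymmetric) (hpos : ∀ x, 0 ≤ ⟪S x, x⟫) (φ : E) :
    ∃ χ : ℝ → E, χ 0 = φ ∧ (∀ τ, HasDerivAt χ (-(S (χ τ))) τ) ∧
      ∀ τ, 0 ≤ τ → ‖χ τ‖ ≤ ‖φ‖ ∧ τ * ‖S (χ τ)‖ ≤ ‖φ‖ ∧ τ ^ 2 * ‖S (S (χ τ))‖ ≤ 4 * ‖φ‖ := by
  set b := hS.eigenvectorBasis rfl with hb
  set μ := hS.eigenvalues rfl with hμ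
  have hSb : ∀ i, S (b i) = μ i • b i := fun i => hS.apply_eigenvectorBasis rfl i
  have hμ0 : ∀ i, 0 ≤ μ i := by
    intro i
    have := hpos (b i)
    rw [hSb, real_inner_smul_left, real_inner_self_eq_norm_sq, b.norm_eq_one] at this
    simpa using this
  let χ : ℝ → E := fun τ => ∑ i, (Real.exp (-(μ i * τ)) * ⟪b i, φ⟫) • b i
  have hSχ : ∀ τ, S (χ τ) = ∑ i, ((μ i * Real.exp (-(μ i * τ))) * ⟪b i, φ⟫) • b i := by
    intro τ
    simp only [χ, map_sum, map_smul, hSb, smul_smul]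
    refine Finset.sum_congr rfl fun i _ => ?_
    congr 1; ring
  have hSSχ : ∀ τ, S (S (χ τ)) = ∑ i, ((μ i ^ 2 * Real.exp (-(μ i * τ))) * ⟪b i, φ⟫) • b i := by
    intro τ
    rw [hSχ]
    simp only [map_sum, map_smul, hSb, smul_smul]
    refine Finset.sum_congr rfl fun i _ => ?_
    congr 1; ring
  have hx1 : ∀ x : ℝ, 0 ≤ x → x * Real.exp (-x) ≤ 1 := by
    intro x hx
    rw [Real.exp_neg, ← div_eq_mul_inv, div_le_one (Real.exp_pos x)]
    linarith [Real.add_one_le_exp x]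
  have hx2 : ∀ x : ℝ, 0 ≤ x → x ^ 2 * Real.exp (-x) ≤ 4 := by
    intro x hx
    have h := hx1 (x / 2) (by linarith)
    have h' : Real.exp (-x) = Real.exp (-(x / 2)) ^ 2 := by
      rw [← Real.exp_nat_mul]; congr 1; push_cast; ring
    have h0 : 0 ≤ x / 2 * Real.exp (-(x / 2)) := by positivity
    rw [h']
    nlinarith
  refine ⟨χ, ?_, fun τ => ?_, fun τ hτ => ⟨?_, ?_, ?_⟩⟩
  · simp only [χ, mul_zero, neg_zero, Real.exp_zero, one_mul]
    exact b.sum_repr' φ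
  · have h : ∀ i, HasDerivAt (fun τ => (Real.exp (-(μ i * τ)) * ⟪b i, φ⟫) • b i)
        ((Real.exp (-(μ i * τ)) * (-(μ i * 1)) * ⟪b i, φ⟫) • b i) τ := fun i =>
      ((((hasDerivAt_id τ).const_mul (μ i)).neg.exp).mul_const _).smul_const _
    have := HasDerivAt.fun_sum (u := Finset.univ) fun i _ => h i
    refine this.congr_deriv ?_
    rw [hSχ, ← Finset.sum_neg_distrib]
    refine Finset.sum_congr rfl fun i _ => ?_
    rw [← neg_smul]; congr 1; ring
  · have := norm_sum_smul_le b (fun i => Real.exp (-(μ i * τ))) (m := 1) (fun i => ?_) zero_le_one φ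
    · simpa using this
    · rw [abs_of_pos (Real.exp_pos _), Real.exp_le_one_iff]
      have := mul_nonneg (hμ0 i) hτ
      linarith
  · have := norm_sum_smul_le b (fun i => τ * (μ i * Real.exp (-(μ i * τ)))) (m := 1) (fun i => ?_)
      zero_le_one φ
    · have h2 : τ • S (χ τ) = ∑ i, ((τ * (μ i * Real.exp (-(μ i * τ)))) * ⟪b i, φ⟫) • b i := by
        rw [hSχ, Finset.smul_sum]
        refine Finset.sum_congr rfl fun i _ => ?_
        rw [smul_smul]; congr 1; ring
      rw [← h2, norm_smul, Real.norm_of_nonneg hτ] at this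
      linarith
    · have h0 := mul_nonneg (hμ0 i) hτ
      rw [abs_of_nonneg (by have := hμ0 i; positivity)]
      have := hx1 _ h0
      linarith
  · have := norm_sum_smul_le b (fun i => τ ^ 2 * (μ i ^ 2 * Real.exp (-(μ i * τ)))) (m := 4)
      (fun i => ?_) (by norm_num) φ
    · have h2 : τ ^ 2 • S (S (χ τ)) =
          ∑ i, ((τ ^ 2 * (μ i ^ 2 * Real.exp (-(μ i * τ)))) * ⟪b i, φ⟫) • b i := by
        rw [hSSχ, Finset.smul_sum]
        refine Finset.sum_congr rfl fun i _ => ?_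
        rw [smul_smul]; congr 1; ring
      rw [← h2, norm_smul, Real.norm_of_nonneg (by positivity)] at this
      linarith
    · have h0 := mul_nonneg (hμ0 i) hτ
      rw [abs_of_nonneg (by positivity)]
      have := hx2 _ h0
      linarith

/-- Estimate of the solution of `ξ' = -B*(B ξ + r) - σ'`. The residual `σ'` enters only through the
modulus of continuity of `σ`: pairing with the backward flow `exp (-(t - s) B* B) φ`, the time
derivative is moved from `σ` to the flow, where it costs a factor `1 / (t - s)`. -/
theorem norm_le_of_dissipative {B B' : E →ₗ[ℝ] E} (hadj : ∀ x y, ⟪B x, y⟫ = ⟪x, B' y⟫)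
    {ξ r σ σ' : ℝ → E} {t e l : ℝ} (ht : 0 < t) (he : 0 ≤ e) (hl : 0 ≤ l) (hξ0 : ξ 0 = 0)
    (hξ : ∀ s ∈ Icc 0 t, HasDerivWithinAt ξ (-(B' (B (ξ s) + r s)) - σ' s) (Icc 0 t) s)
    (hσ : ∀ s ∈ Icc 0 t, HasDerivWithinAt σ (σ' s) (Icc 0 t) s)
    (hr : ∀ s ∈ Icc 0 t, ‖r s‖ ≤ e)
    (hσm : ∀ s ∈ Ico 0 t, ‖σ t - σ s‖ ≤ e * l * √(t - s)) :
    ‖ξ t‖ ≤ e * (2 + 3 * l) * √t := by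
  refine norm_le_of_inner_le (by positivity) fun φ => ?_
  obtain ⟨χ, hχ0, hχ', hχb⟩ := exists_heat_flow (B' ∘ₗ B)
    (fun x y => by
      simp only [LinearMap.comp_apply]
      rw [adjoint_swap hadj, hadj])
    (fun x => by
      simp only [LinearMap.comp_apply]
      rw [adjoint_swap hadj]; exact real_inner_self_nonneg) φ
  simp only [LinearMap.comp_apply] at hχ' hχb
  -- subtracting `σ t` makes the bracket vanish where `B* B exp (-(t - s) B* B)` is singular
  let F : ℝ → ℝ := fun s => ⟪ξ s + (σ s - σ t), χ (t - s)⟫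
  have hχs : ∀ s, HasDerivAt (fun s => χ (t - s)) (B' (B (χ (t - s)))) s := by
    intro s
    have h1 : HasDerivAt (fun s => t - s) (-1 : ℝ) s := by
      simpa using (hasDerivAt_id s).const_sub t
    exact (HasDerivAt.scomp s (hχ' (t - s)) h1).congr_deriv (by simp)
  have hF' : ∀ s ∈ Icc 0 t, HasDerivWithinAt F
      (-⟪r s, B (χ (t - s))⟫ + ⟪σ s - σ t, B' (B (χ (t - s)))⟫) (Icc 0 t) s := by
    intro s hs
    have h1 := ((hξ s hs).add ((hσ s hs).sub_const (σ t)))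
    have h2 := h1.inner ℝ (hχs s).hasDerivWithinAt
    refine h2.congr_deriv ?_
    rw [Pi.add_apply, inner_add_left]
    have e1 : -(B' (B (ξ s) + r s)) - σ' s + σ' s = -(B' (B (ξ s) + r s)) := by abel
    rw [e1, inner_neg_left, adjoint_swap hadj, inner_add_left, hadj]
    ring
  have hbd : ∀ s ∈ Ioo 0 t, |(-⟪r s, B (χ (t - s))⟫ + ⟪σ s - σ t, B' (B (χ (t - s)))⟫)| ≤
      e * (1 + l) * ‖φ‖ * (1 / √(t - s)) := by
    intro s hs
    have hτ : 0 < t - s := by linarith [hs.2]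
    obtain ⟨h1, h2, -⟩ := hχb (t - s) hτ.le
    have hq : 0 < √(t - s) := Real.sqrt_pos.2 hτ
    have hqq : √(t - s) * √(t - s) = t - s := Real.mul_self_sqrt hτ.le
    have h3 : ‖B (χ (t - s))‖ ≤ ‖φ‖ * (1 / √(t - s)) := by
      refine abs_le_of_sq_le_sq' ?_ (by positivity) |>.2
      refine (norm_sq_apply_le hadj _).trans ?_
      rw [mul_pow, div_pow, one_pow, sq (√(t - s)), hqq, sq, mul_assoc]
      gcongr
      rw [mul_one_div, le_div_iff₀ hτ]
      linarith
    have h4 : ‖B' (B (χ (t - s)))‖ ≤ ‖φ‖ * (1 / (t - s)) := by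
      rw [mul_one_div, le_div_iff₀ hτ]
      linarith
    have hs' : s ∈ Ico 0 t := ⟨hs.1.le, hs.2⟩
    have h5 := hσm s hs'
    rw [norm_sub_rev] at h5
    calc |(-⟪r s, B (χ (t - s))⟫ + ⟪σ s - σ t, B' (B (χ (t - s)))⟫)|
        ≤ |⟪r s, B (χ (t - s))⟫| + |⟪σ s - σ t, B' (B (χ (t - s)))⟫| := by
          refine (abs_add_le _ _).trans ?_
          rw [abs_neg]
      _ ≤ e * (‖φ‖ * (1 / √(t - s))) + (e * l * √(t - s)) * (‖φ‖ * (1 / (t - s))) := by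
          refine add_le_add ?_ ?_
          · refine (abs_real_inner_le_norm _ _).trans ?_
            exact mul_le_mul (hr s ⟨hs.1.le, hs.2.le⟩) h3 (norm_nonneg _) he
          · refine (abs_real_inner_le_norm _ _).trans ?_
            exact mul_le_mul h5 h4 (norm_nonneg _) (by positivity)
      _ = e * (1 + l) * ‖φ‖ * (1 / √(t - s)) := by
          have h6 : 1 / (t - s) = 1 / √(t - s) * (1 / √(t - s)) := by
            rw [one_div_mul_one_div, hqq]
          rw [h6]
          field_simp
  have hG' : ∀ s ∈ Ioo 0 t, HasDerivAt (fun s => -(2 * (e * (1 + l) * ‖φ‖) * √(t - s)))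
      (e * (1 + l) * ‖φ‖ * (1 / √(t - s))) s := by
    intro s hs
    have hτ : t - s ≠ 0 := by linarith [hs.2]
    have h1 : HasDerivAt (fun s => t - s) (-1 : ℝ) s := by
      simpa using (hasDerivAt_id s).const_sub t
    refine ((h1.sqrt hτ).const_mul (2 * (e * (1 + l) * ‖φ‖))).neg.congr_deriv ?_
    field_simp
  have hmain := abs_sub_le_of_hasDerivAt (F := F) ht.le
    (fun s hs => (hF' s hs).continuousWithinAt) (by fun_prop)
    (fun s hs => (hF' s ⟨hs.1.le, hs.2.le⟩).hasDerivAt (Icc_mem_nhds hs.1 hs.2)) hG' hbd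
  have hFt : F t = ⟪ξ t, φ⟫ := by simp [F, hχ0]
  have hF0 : |F 0| ≤ e * l * √t * ‖φ‖ := by
    simp only [F, hξ0, zero_add, sub_zero]
    refine (abs_real_inner_le_norm _ _).trans ?_
    have h5 := hσm 0 ⟨le_rfl, ht⟩
    rw [norm_sub_rev, sub_zero] at h5
    exact mul_le_mul h5 (hχb t ht.le).1 (norm_nonneg _) (by positivity)
  rw [← hFt]
  have h7 := abs_add_le (F t - F 0) (F 0)
  simp only [sub_self, Real.sqrt_zero, mul_zero, neg_zero, sub_zero] at hmain
  rw [sub_add_cancel] at h7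
  nlinarith

/-- Estimate of `B ξ + r` for the solution of `ξ' = -B*(B ξ + r) - σ'`. Bounded `r` and
`σ ∈ C^{1/2}` would be borderline (a logarithm); the extra factor `((t - s) / t) ^ p` makes
the time integral finite. -/
theorem norm_flux_le_of_dissipative {B B' : E →ₗ[ℝ] E} (hadj : ∀ x y, ⟪B x, y⟫ = ⟪x, B' y⟫)
    {ξ r σ σ' : ℝ → E} {t e l p : ℝ} (ht : 0 < t) (he : 0 ≤ e) (hl : 0 ≤ l) (hp : 0 < p)
    (hξ0 : ξ 0 = 0)
    (hξ : ∀ s ∈ Icc 0 t, HasDerivWithinAt ξ (-(B' (B (ξ s) + r s)) - σ' s) (Icc 0 t) s)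
    (hσ : ∀ s ∈ Icc 0 t, HasDerivWithinAt σ (σ' s) (Icc 0 t) s)
    (hr : ‖r t‖ ≤ e)
    (hrm : ∀ s ∈ Ico 0 t, ‖r t - r s‖ ≤ e * l * ((t - s) / t) ^ p)
    (hσm : ∀ s ∈ Ico 0 t, ‖σ t - σ s‖ ≤ e * l * √(t - s) * ((t - s) / t) ^ p) :
    ‖B (ξ t) + r t‖ ≤ e * (1 + l + 3 * l / p) := by
  refine norm_le_of_inner_le (by positivity) fun φ => ?_
  obtain ⟨χ, hχ0, hχ', hχb⟩ := exists_heat_flow (B ∘ₗ B')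
    (fun x y => by
      simp only [LinearMap.comp_apply]
      rw [hadj, adjoint_swap hadj])
    (fun x => by
      simp only [LinearMap.comp_apply]
      rw [hadj]; exact real_inner_self_nonneg) φ
  simp only [LinearMap.comp_apply] at hχ' hχb
  let B'L : E →L[ℝ] E := LinearMap.toContinuousLinearMap B'
  have hB'L : ∀ x, B'L x = B' x := fun x => rfl
  let F : ℝ → ℝ := fun s => ⟪ξ s + (σ s - σ t), B' (χ (t - s))⟫ + ⟪r t, χ (t - s)⟫
  have hχs : ∀ s, HasDerivAt (fun s => χ (t - s)) (B (B' (χ (t - s)))) s := by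
    intro s
    have h1 : HasDerivAt (fun s => t - s) (-1 : ℝ) s := by
      simpa using (hasDerivAt_id s).const_sub t
    exact (HasDerivAt.scomp s (hχ' (t - s)) h1).congr_deriv (by simp)
  have hχs2 : ∀ s, HasDerivAt (fun s => B' (χ (t - s))) (B' (B (B' (χ (t - s))))) s := by
    intro s
    exact B'L.hasFDerivAt.comp_hasDerivAt s (hχs s)
  have hF' : ∀ s ∈ Icc 0 t, HasDerivWithinAt F
      (⟪r t - r s, B (B' (χ (t - s)))⟫ + ⟪σ s - σ t, B' (B (B' (χ (t - s))))⟫) (Icc 0 t) s := by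
    intro s hs
    have h1 := ((hξ s hs).add ((hσ s hs).sub_const (σ t)))
    have h2 := h1.inner ℝ (hχs2 s).hasDerivWithinAt
    have h3 := (hasDerivWithinAt_const s (Icc 0 t) (r t)).inner ℝ (hχs s).hasDerivWithinAt
    refine (h2.add h3).congr_deriv ?_
    rw [Pi.add_apply, inner_add_left]
    have e1 : -(B' (B (ξ s) + r s)) - σ' s + σ' s = -(B' (B (ξ s) + r s)) := by abel
    rw [e1, inner_neg_left, adjoint_swap hadj, inner_add_left, hadj, inner_sub_left (r t),
      inner_zero_left]
    ring
  have hbd : ∀ s ∈ Ioo 0 t,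
      |(⟪r t - r s, B (B' (χ (t - s)))⟫ + ⟪σ s - σ t, B' (B (B' (χ (t - s))))⟫)| ≤
      3 * (e * l * ‖φ‖) * (((t - s) / t) ^ p * (1 / (t - s))) := by
    intro s hs
    have hτ : 0 < t - s := by linarith [hs.2]
    obtain ⟨h1, h2, h2'⟩ := hχb (t - s) hτ.le
    have hq : 0 < √(t - s) := Real.sqrt_pos.2 hτ
    have hqq : √(t - s) ^ 2 = t - s := Real.sq_sqrt hτ.le
    have hw : 0 ≤ ((t - s) / t) ^ p := by positivity
    have h4 : ‖B (B' (χ (t - s)))‖ ≤ ‖φ‖ * (1 / (t - s)) := by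
      rw [mul_one_div, le_div_iff₀ hτ]
      linarith
    have h4' : ‖B (B' (B (B' (χ (t - s)))))‖ ≤ 4 * ‖φ‖ * (1 / (t - s) ^ 2) := by
      rw [mul_one_div, le_div_iff₀ (by positivity)]
      linarith
    have h3 : ‖B' (B (B' (χ (t - s))))‖ ≤ 2 * ‖φ‖ * (1 / ((t - s) * √(t - s))) := by
      refine abs_le_of_sq_le_sq' ?_ (by positivity) |>.2
      refine (norm_sq_apply_le (adjoint_swap hadj) _).trans ?_
      calc _ ≤ ‖φ‖ * (1 / (t - s)) * (4 * ‖φ‖ * (1 / (t - s) ^ 2)) := by gcongr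
        _ = _ := by
          rw [mul_pow, div_pow, mul_pow, mul_pow, hqq]
          field_simp
          norm_num
    have hs' : s ∈ Ico 0 t := ⟨hs.1.le, hs.2⟩
    have h5 := hσm s hs'
    rw [norm_sub_rev] at h5
    calc |(⟪r t - r s, B (B' (χ (t - s)))⟫ + ⟪σ s - σ t, B' (B (B' (χ (t - s))))⟫)|
        ≤ |⟪r t - r s, B (B' (χ (t - s)))⟫| + |⟪σ s - σ t, B' (B (B' (χ (t - s))))⟫| :=
          abs_add_le _ _
      _ ≤ (e * l * ((t - s) / t) ^ p) * (‖φ‖ * (1 / (t - s))) +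
          (e * l * √(t - s) * ((t - s) / t) ^ p) * (2 * ‖φ‖ * (1 / ((t - s) * √(t - s)))) := by
          refine add_le_add ?_ ?_
          · refine (abs_real_inner_le_norm _ _).trans ?_
            exact mul_le_mul (hrm s hs') h4 (norm_nonneg _) (by positivity)
          · refine (abs_real_inner_le_norm _ _).trans ?_
            exact mul_le_mul h5 h3 (norm_nonneg _) (by positivity)
      _ = _ := by
          field_simp
          ring
  have hG' : ∀ s ∈ Ioo 0 t, HasDerivAt (fun s => -(3 * (e * l * ‖φ‖) / p * ((t - s) / t) ^ p))
      (3 * (e * l * ‖φ‖) * (((t - s) / t) ^ p * (1 / (t - s)))) s := by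
    intro s hs
    have hτ : 0 < t - s := by linarith [hs.2]
    have h1 : HasDerivAt (fun s => (t - s) / t) (-1 / t : ℝ) s := by
      simpa using ((hasDerivAt_id s).const_sub t).div_const t
    have h2 := h1.rpow_const (p := p) (Or.inl (by positivity))
    refine (h2.const_mul (3 * (e * l * ‖φ‖) / p)).neg.congr_deriv ?_
    rw [Real.rpow_sub_one (by positivity)]
    field_simp
  have hmain := abs_sub_le_of_hasDerivAt (F := F)
    (G := fun s => -(3 * (e * l * ‖φ‖) / p * ((t - s) / t) ^ p)) ht.le
    (fun s hs => (hF' s hs).continuousWithinAt)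
    (ContinuousOn.neg (continuousOn_const.mul
      (Continuous.continuousOn (Continuous.rpow_const (by fun_prop) fun _ => Or.inr hp.le))))
    (fun s hs => (hF' s ⟨hs.1.le, hs.2.le⟩).hasDerivAt (Icc_mem_nhds hs.1 hs.2)) hG' hbd
  have hFt : F t = ⟪B (ξ t) + r t, φ⟫ := by
    simp only [F, sub_self, add_zero, hχ0]
    rw [inner_add_left, hadj]
  have hF0 : |F 0| ≤ e * l * ‖φ‖ + e * ‖φ‖ := by
    simp only [F, hξ0, zero_add, sub_zero]
    refine (abs_add_le _ _).trans (add_le_add ?_ ?_)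
    · refine (abs_real_inner_le_norm _ _).trans ?_
      have h5 := hσm 0 ⟨le_rfl, ht⟩
      rw [norm_sub_rev, sub_zero, div_self ht.ne', Real.one_rpow, mul_one] at h5
      have hq : 0 < √t := Real.sqrt_pos.2 ht
      have hqq : √t * √t = t := Real.mul_self_sqrt ht.le
      have h3 : ‖B' (χ t)‖ ≤ ‖φ‖ * (1 / √t) := by
        refine abs_le_of_sq_le_sq' ?_ (by positivity) |>.2
        refine (norm_sq_apply_le (adjoint_swap hadj) _).trans ?_
        rw [mul_pow, div_pow, one_pow, sq (√t), hqq, sq, mul_assoc]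
        obtain ⟨h1, h2, -⟩ := hχb t ht.le
        gcongr
        rw [mul_one_div, le_div_iff₀ ht]
        linarith
      calc _ ≤ (e * l * √t) * (‖φ‖ * (1 / √t)) :=
            mul_le_mul h5 h3 (norm_nonneg _) (by positivity)
        _ = _ := by field_simp
    · refine (abs_real_inner_le_norm _ _).trans ?_
      exact mul_le_mul hr (hχb t ht.le).1 (norm_nonneg _) he
  rw [← hFt]
  have h7 := abs_add_le (F t - F 0) (F 0)
  simp only [sub_self, zero_div, Real.zero_rpow hp.ne', mul_zero, neg_zero, sub_zero,
    div_self ht.ne', Real.one_rpow, mul_one, sub_neg_eq_add, zero_add] at hmain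
  rw [sub_add_cancel] at h7
  have h8 : e * (1 + l + 3 * l / p) * ‖φ‖ = 3 * (e * l * ‖φ‖) / p + (e * l * ‖φ‖ + e * ‖φ‖) := by
    ring
  rw [h8]
  linarith

end Parabolic

/-! ### Legendre polynomials -/

theorem intervalIntegrable_eval (p : ℝ[X]) (a b : ℝ) :
    IntervalIntegrable (fun x => p.eval x) volume a b :=
  p.continuous.intervalIntegrable a b

theorem intervalIntegrable_mul_eval {v : ℝ → ℝ} {a b : ℝ} (hv : IntervalIntegrable v volume a b)
    (p : ℝ[X]) : IntervalIntegrable (fun x => v x * p.eval x) volume a b :=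
  hv.mul_continuousOn (by fun_prop)

theorem integral_eval_derivative_mul (p q : ℝ[X]) (a b : ℝ) :
    ∫ x in a..b, p.derivative.eval x * q.eval x =
      p.eval b * q.eval b - p.eval a * q.eval a - ∫ x in a..b, p.eval x * q.derivative.eval x := by
  rw [eq_sub_iff_add_eq, ← intervalIntegral.integral_add]
  · refine intervalIntegral.integral_eq_sub_of_hasDerivAt (f := fun x => p.eval x * q.eval x)
      (fun x _ => (p.hasDerivAt x).mul (q.hasDerivAt x)) ?_
    exact Continuous.intervalIntegrable (by fun_prop) _ _
  · exact Continuous.intervalIntegrable (by fun_prop) _ _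
  · exact Continuous.intervalIntegrable (by fun_prop) _ _

theorem iterate_derivative_eval_eq (p : ℝ[X]) (n : ℕ) (r : ℝ) :
    (derivative^[n] p).eval r = n.factorial * (taylor r p).coeff n := by
  rw [taylor_coeff, ← factorial_smul_hasseDeriv, LinearMap.smul_apply, eval_smul, nsmul_eq_mul]

theorem taylor_one_sq_sub_one_pow (m : ℕ) :
    taylor (1 : ℝ) ((X ^ 2 - 1) ^ m) = X ^ m * (X + C 2) ^ m := by
  rw [← mul_pow]
  simp only [taylor_apply, pow_comp, sub_comp, X_comp, one_comp]
  congr 1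
  rw [show (C 2 : ℝ[X]) = 2 from rfl, map_one]; ring

theorem taylor_neg_one_sq_sub_one_pow (m : ℕ) :
    taylor (-1 : ℝ) ((X ^ 2 - 1) ^ m) = X ^ m * (X + C (-2)) ^ m := by
  rw [← mul_pow]
  simp only [taylor_apply, pow_comp, sub_comp, X_comp, one_comp]
  congr 1
  rw [map_neg, map_neg, show (C 2 : ℝ[X]) = 2 from rfl, map_one]; ring

theorem legendre_eval_one (m : ℕ) : (legendre m).eval 1 = 1 := by
  rw [legendre, eval_mul, eval_C, iterate_derivative_eval_eq, taylor_one_sq_sub_one_pow]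
  have : (X ^ m * (X + C 2) ^ m : ℝ[X]).coeff m = 2 ^ m := by
    have := coeff_X_pow_mul ((X + C 2 : ℝ[X]) ^ m) m 0
    rw [zero_add] at this
    rw [this, coeff_zero_eq_eval_zero]; simp
  rw [this]
  have := Nat.factorial_ne_zero m
  field_simp

theorem legendre_eval_neg_one (m : ℕ) : (legendre m).eval (-1) = (-1) ^ m := by
  rw [legendre, eval_mul, eval_C, iterate_derivative_eval_eq, taylor_neg_one_sq_sub_one_pow]
  have : (X ^ m * (X + C (-2)) ^ m : ℝ[X]).coeff m = (-2) ^ m := by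
    have := coeff_X_pow_mul ((X + C (-2) : ℝ[X]) ^ m) m 0
    rw [zero_add] at this
    rw [this, coeff_zero_eq_eval_zero]; simp
  rw [this, neg_pow (2 : ℝ)]
  have := Nat.factorial_ne_zero m
  field_simp

theorem natDegree_legendre_le (m : ℕ) : (legendre m).natDegree ≤ m := by
  rw [legendre]
  refine (natDegree_C_mul_le _ _).trans ((natDegree_iterate_derivative _ _).trans ?_)
  have : ((X ^ 2 - 1 : ℝ[X]) ^ m).natDegree ≤ m * 2 := by
    refine natDegree_pow_le_of_le _ ?_
    rw [← C_1, natDegree_X_pow_sub_C]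
  omega

theorem iterate_derivative_sq_sub_one_eval {m i : ℕ} (hi : i < m) :
    (derivative^[i] ((X ^ 2 - 1 : ℝ[X]) ^ m)).eval 1 = 0 ∧
      (derivative^[i] ((X ^ 2 - 1 : ℝ[X]) ^ m)).eval (-1) = 0 := by
  rw [iterate_derivative_eval_eq, iterate_derivative_eval_eq, taylor_one_sq_sub_one_pow,
    taylor_neg_one_sq_sub_one_pow, coeff_X_pow_mul', coeff_X_pow_mul', if_neg (by omega),
    if_neg (by omega)]
  simp

theorem integral_legendre_mul {m : ℕ} {q : ℝ[X]} (hq : q.degree < m) :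
    ∫ x in (-1 : ℝ)..1, (legendre m).eval x * q.eval x = 0 := by
  have h : ∀ i ≤ m, ∫ x in (-1 : ℝ)..1, (derivative^[m] ((X ^ 2 - 1 : ℝ[X]) ^ m)).eval x * q.eval x
      = (-1) ^ i * ∫ x in (-1 : ℝ)..1, (derivative^[m - i] ((X ^ 2 - 1 : ℝ[X]) ^ m)).eval x *
        (derivative^[i] q).eval x := by
    intro i
    induction i with
    | zero => intro _; simp
    | succ i ih =>
      intro hi
      rw [ih (by omega)]
      obtain ⟨j, hj⟩ : ∃ j, m - i = j + 1 := ⟨m - i - 1, by omega⟩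
      have hj' : m - (i + 1) = j := by omega
      rw [hj, hj', Function.iterate_succ_apply', Function.iterate_succ_apply',
        integral_eval_derivative_mul, (iterate_derivative_sq_sub_one_eval (by omega)).1,
        (iterate_derivative_sq_sub_one_eval (by omega)).2, pow_succ]
      ring
  have h0 : derivative^[m] q = 0 := by
    rcases eq_or_ne q 0 with rfl | h0
    · simp
    · exact iterate_derivative_eq_zero ((natDegree_lt_iff_degree_lt h0).2 hq)
  have := h m le_rfl
  rw [h0] at this
  simp only [legendre, eval_mul, eval_C, mul_assoc]
  rw [intervalIntegral.integral_const_mul, this]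
  simp

theorem degree_X_mul_derivative_sub_lt {p : ℝ[X]} {m : ℕ} (hp : p.natDegree ≤ m) :
    (X * derivative p - C (m : ℝ) * p).degree < (m : WithBot ℕ) := by
  rw [degree_lt_iff_coeff_zero]
  intro n hn
  rw [coeff_sub, coeff_C_mul]
  rcases Nat.eq_zero_or_pos n with rfl | hn0
  · obtain rfl : m = 0 := by omega
    simp
  · obtain ⟨n, rfl⟩ := Nat.exists_eq_add_of_lt hn0
    rw [zero_add, coeff_X_mul, coeff_derivative]
    rcases hn.eq_or_lt with h | h
    · rw [h]; push_cast; ring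
    · simp [coeff_eq_zero_of_natDegree_lt (p := p) (n := n + 1) (by omega)]

theorem integral_legendre_sq (m : ℕ) :
    ∫ x in (-1 : ℝ)..1, (legendre m).eval x * (legendre m).eval x = 2 / (2 * m + 1) := by
  have h1 := integral_legendre_mul (degree_X_mul_derivative_sub_lt (natDegree_legendre_le m))
  have h2 := integral_eval_derivative_mul (legendre m * legendre m) X (-1) 1
  have h3 : ∫ x in (-1 : ℝ)..1, (derivative (legendre m * legendre m)).eval x * (X : ℝ[X]).eval x =
      2 * ∫ x in (-1 : ℝ)..1, (legendre m).eval x * (X * derivative (legendre m)).eval x := by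
    rw [← intervalIntegral.integral_const_mul]
    congr 1; ext x
    simp only [derivative_mul, eval_add, eval_mul, eval_X]; ring
  have h4 : ∫ x in (-1 : ℝ)..1, (legendre m).eval x *
      (X * derivative (legendre m) - C (m : ℝ) * legendre m).eval x =
      (∫ x in (-1 : ℝ)..1, (legendre m).eval x * (X * derivative (legendre m)).eval x) -
      m * ∫ x in (-1 : ℝ)..1, (legendre m).eval x * (legendre m).eval x := by
    rw [← intervalIntegral.integral_const_mul, ← intervalIntegral.integral_sub]
    · congr 1; ext x
      simp only [eval_sub, eval_mul, eval_X, eval_C]; ring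
    · exact Continuous.intervalIntegrable (by fun_prop) _ _
    · exact Continuous.intervalIntegrable (by fun_prop) _ _
  rw [h4] at h1
  rw [h3] at h2
  simp only [eval_mul, legendre_eval_one, legendre_eval_neg_one, derivative_X, eval_one,
    mul_one, eval_X, ← pow_add, ← two_mul, pow_mul] at h2
  norm_num at h2
  rw [eq_div_iff (by positivity)]
  simp only [eval_mul, eval_X] at h1
  linarith

theorem degree_legendre (m : ℕ) : (legendre m).degree = m := by
  refine le_antisymm (natDegree_le_iff_degree_le.1 (natDegree_legendre_le m)) ?_
  by_contra! h
  have h1 := integral_legendre_mul h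
  rw [integral_legendre_sq] at h1
  have : (0 : ℝ) < 2 / (2 * m + 1) := by positivity
  linarith

theorem exists_legendre_bound (k : ℕ) : ∃ c : ℝ, 1 ≤ c ∧ ∀ m ≤ k, ∀ x ∈ Icc (-1 : ℝ) 1,
    |(legendre m).eval x| ≤ c := by
  induction k with
  | zero =>
    obtain ⟨c, hc⟩ := isCompact_Icc.exists_bound_of_continuousOn (s := Icc (-1 : ℝ) 1)
      (f := fun x => (legendre 0).eval x) (by fun_prop)
    refine ⟨max 1 c, le_max_left _ _, fun m hm x hx => ?_⟩
    obtain rfl : m = 0 := by omega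
    exact (hc x hx).trans (le_max_right _ _)
  | succ k ih =>
    obtain ⟨c', h1, hc'⟩ := ih
    obtain ⟨c, hc⟩ := isCompact_Icc.exists_bound_of_continuousOn (s := Icc (-1 : ℝ) 1)
      (f := fun x => (legendre (k + 1)).eval x) (by fun_prop)
    refine ⟨max c' c, h1.trans (le_max_left _ _), fun m hm x hx => ?_⟩
    rcases Nat.lt_or_ge m (k + 1) with h | h
    · exact (hc' m (by omega) x hx).trans (le_max_left _ _)
    · obtain rfl : m = k + 1 := by omega
      exact (hc x hx).trans (le_max_right _ _)

/-! ### Legendre expansions on a cell -/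

/-- The Legendre polynomial of degree `m` on the cell `(a, b)`, as a polynomial. -/
def cellLeg (a b : ℝ) (m : ℕ) : ℝ[X] :=
  (legendre m).comp (C ((b - a) / 2)⁻¹ * X - C (((b - a) / 2)⁻¹ * ((a + b) / 2)))

theorem eval_cellLeg (a b : ℝ) (m : ℕ) (x : ℝ) : (cellLeg a b m).eval x = cellLegendre a b m x := by
  simp only [cellLeg, cellLegendre, eval_comp, eval_sub, eval_mul, eval_C, eval_X]
  congr 1; rw [div_eq_inv_mul]; ring

section Cell

variable {a b : ℝ}

theorem eval_cellLeg_right (hab : a < b) (m : ℕ) : (cellLeg a b m).eval b = 1 := by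
  rw [eval_cellLeg, cellLegendre, show (b - (a + b) / 2) / ((b - a) / 2) = 1 by
    rw [div_eq_one_iff_eq] <;> linarith, legendre_eval_one]

theorem eval_cellLeg_left (hab : a < b) (m : ℕ) : (cellLeg a b m).eval a = (-1) ^ m := by
  rw [eval_cellLeg, cellLegendre, show (a - (a + b) / 2) / ((b - a) / 2) = -1 by
    rw [div_eq_iff (by linarith)]; ring, legendre_eval_neg_one]

theorem degree_cellLeg (hab : a < b) (m : ℕ) : (cellLeg a b m).degree = m := by
  have h0 : ((b - a) / 2)⁻¹ ≠ 0 := inv_ne_zero (by linarith)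
  have h2 : (C ((b - a) / 2)⁻¹ * X - C (((b - a) / 2)⁻¹ * ((a + b) / 2)) : ℝ[X]).natDegree = 1 := by
    rw [natDegree_sub_C, natDegree_C_mul_X _ h0]
  have h4 : (cellLeg a b m).natDegree = m := by
    rw [cellLeg, natDegree_comp, h2, mul_one]
    exact natDegree_eq_of_degree_eq_some (degree_legendre m)
  have hne : cellLeg a b m ≠ 0 := by
    intro h
    have := eval_cellLeg_right hab m
    rw [h] at this; simp at this
  rw [degree_eq_natDegree hne, h4]

theorem natDegree_cellLeg (hab : a < b) (m : ℕ) : (cellLeg a b m).natDegree = m :=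
  natDegree_eq_of_degree_eq_some (degree_cellLeg hab m)

theorem integral_eval_cell (hab : a < b) (p : ℝ[X]) :
    ∫ x in a..b, p.eval (((b - a) / 2)⁻¹ * x - ((b - a) / 2)⁻¹ * ((a + b) / 2)) =
      (b - a) / 2 * ∫ x in (-1 : ℝ)..1, p.eval x := by
  have h0 : ((b - a) / 2)⁻¹ ≠ 0 := inv_ne_zero (by linarith)
  have hb : b - a ≠ 0 := by linarith
  rw [intervalIntegral.integral_comp_mul_sub (fun x => p.eval x) h0, inv_inv, smul_eq_mul]
  congr 2 <;> field_simp <;> ring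

theorem integral_cellLeg_mul (hab : a < b) {m : ℕ} {q : ℝ[X]} (hq : q.degree < m) :
    ∫ x in a..b, (cellLeg a b m).eval x * q.eval x = 0 := by
  set r : ℝ[X] := C ((b - a) / 2) * X + C ((a + b) / 2) with hr
  have hb : b - a ≠ 0 := by linarith
  have h1 : ∀ x, (cellLeg a b m).eval x * q.eval x =
      (legendre m * q.comp r).eval
        (((b - a) / 2)⁻¹ * x - ((b - a) / 2)⁻¹ * ((a + b) / 2)) := by
    intro x
    rw [eval_mul, eval_comp, cellLeg, eval_comp]
    simp only [hr, eval_sub, eval_mul, eval_C, eval_X, eval_add]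
    congr 2; field_simp; ring
  simp only [h1]
  rw [integral_eval_cell hab]
  simp only [eval_mul]
  rw [integral_legendre_mul, mul_zero]
  rcases eq_or_ne q 0 with rfl | h0
  · simp
  · have h2 := (natDegree_lt_iff_degree_lt h0).2 hq
    have h3 : (q.comp r).natDegree ≤ q.natDegree := by
      refine natDegree_comp_le.trans ?_
      calc _ ≤ q.natDegree * 1 := Nat.mul_le_mul_left _ (natDegree_linear_le)
        _ = _ := mul_one _
    exact degree_le_natDegree.trans_lt (by exact_mod_cast h3.trans_lt h2)

theorem integral_cellLeg_sq (hab : a < b) (m : ℕ) :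
    ∫ x in a..b, (cellLeg a b m).eval x * (cellLeg a b m).eval x = (b - a) / (2 * m + 1) := by
  have h1 : ∀ x, (cellLeg a b m).eval x * (cellLeg a b m).eval x =
      (legendre m * legendre m).eval
        (((b - a) / 2)⁻¹ * x - ((b - a) / 2)⁻¹ * ((a + b) / 2)) := by
    intro x
    rw [eval_mul, cellLeg, eval_comp]
    simp only [eval_sub, eval_mul, eval_C, eval_X]
  simp only [h1]
  rw [integral_eval_cell hab]
  simp only [eval_mul]
  rw [integral_legendre_sq]
  field_simp

theorem integral_cellLeg_mul_cellLeg (hab : a < b) {m n : ℕ} (hmn : m ≠ n) :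
    ∫ x in a..b, (cellLeg a b m).eval x * (cellLeg a b n).eval x = 0 := by
  rcases Nat.lt_or_ge n m with h | h
  · exact integral_cellLeg_mul hab (by rw [degree_cellLeg hab]; exact_mod_cast h)
  · simp_rw [mul_comm ((cellLeg a b m).eval _)]
    exact integral_cellLeg_mul hab (by
      rw [degree_cellLeg hab]; exact_mod_cast lt_of_le_of_ne h hmn)

theorem exists_cellLeg_coeff (hab : a < b) {k : ℕ} {p : ℝ[X]} (hp : p.natDegree ≤ k) :
    ∃ c : ℝ, (p - C c * cellLeg a b k).degree < k := by
  have hl : (cellLeg a b k).coeff k ≠ 0 := by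
    have h := degree_cellLeg hab k
    have h2 := natDegree_cellLeg hab k
    intro h3
    have h4 : (cellLeg a b k).leadingCoeff = 0 := by rw [leadingCoeff, h2, h3]
    rw [leadingCoeff_eq_zero] at h4
    rw [h4] at h; simp at h
  refine ⟨p.coeff k / (cellLeg a b k).coeff k, ?_⟩
  rw [degree_lt_iff_coeff_zero]
  intro n hn
  rw [coeff_sub, coeff_C_mul]
  rcases hn.eq_or_lt with h | h
  · rw [← h]; field_simp; ring
  · rw [coeff_eq_zero_of_natDegree_lt (p := p) (n := n) (by omega),
      coeff_eq_zero_of_natDegree_lt (p := cellLeg a b k) (n := n)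
        (by rw [natDegree_cellLeg hab]; exact h)]
    ring

/-- The Legendre expansion of a polynomial of degree at most `k` on the cell `(a, b)`. -/
theorem eq_sum_cellLeg (hab : a < b) {k : ℕ} {p : ℝ[X]} (hp : p.natDegree ≤ k) :
    p = ∑ m ∈ Finset.range (k + 1),
      C ((2 * m + 1) / (b - a) * ∫ x in a..b, p.eval x * (cellLeg a b m).eval x) *
        cellLeg a b m := by
  have key : ∀ n (p : ℝ[X]), p.degree < (n : ℕ) → ∃ c : ℕ → ℝ,
      p = ∑ m ∈ Finset.range n, C (c m) * cellLeg a b m := by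
    intro n
    induction n with
    | zero =>
      intro p hp
      refine ⟨fun _ => 0, ?_⟩
      have : p = 0 := by
        by_contra h
        rw [degree_eq_natDegree h] at hp
        exact absurd (Nat.cast_lt.1 hp) (by omega)
      simp [this]
    | succ n ih =>
      intro p hp
      have hp' : p.natDegree ≤ n := by
        rw [natDegree_le_iff_coeff_eq_zero]
        intro N hN
        exact (degree_lt_iff_coeff_zero _ _).1 hp N hN
      obtain ⟨c, hc⟩ := exists_cellLeg_coeff hab hp'
      obtain ⟨d, hd⟩ := ih _ hc
      refine ⟨fun m => if m = n then c else d m, ?_⟩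
      simp only [Finset.sum_range_succ, if_true]
      rw [Finset.sum_congr rfl (g := fun m => C (d m) * cellLeg a b m), ← hd]
      · ring
      · intro m hm
        rw [if_neg (by rw [Finset.mem_range] at hm; omega)]
  obtain ⟨c, hc⟩ := key (k + 1) p (by
    rw [degree_lt_iff_coeff_zero]
    intro m hm
    exact coeff_eq_zero_of_natDegree_lt (by omega))
  have hcm : ∀ m ∈ Finset.range (k + 1), c m =
      (2 * m + 1) / (b - a) * ∫ x in a..b, p.eval x * (cellLeg a b m).eval x := by
    intro m hm
    have h1 : ∫ x in a..b, p.eval x * (cellLeg a b m).eval x = c m * ((b - a) / (2 * m + 1)) := by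
      rw [hc]
      simp only [eval_finsetSum, Finset.sum_mul, eval_mul, eval_C, mul_assoc]
      rw [intervalIntegral.integral_finsetSum]
      · simp only [intervalIntegral.integral_const_mul]
        rw [Finset.sum_eq_single m]
        · rw [integral_cellLeg_sq hab]
        · intro n _ hn
          rw [integral_cellLeg_mul_cellLeg hab hn, mul_zero]
        · intro h; exact absurd hm h
      · intro i _
        exact Continuous.intervalIntegrable (by fun_prop) _ _
    rw [h1]
    have : b - a ≠ 0 := by linarith
    field_simp
  nth_rw 1 [hc]
  exact Finset.sum_congr rfl fun m hm => by rw [hcm m hm]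

end Cell

/-! ### Gauss–Radau projections -/

/-- The other choice of alternating fluxes. -/
def Flux.swap : Flux → Flux
  | .left => .right
  | .right => .left

/-- The end point of the cell `(a, b)` at which the flux `û` is taken from this cell: the right one
for `û = u⁻`, the left one for `û = u⁺`. -/
def Flux.endpoint : Flux → ℝ → ℝ → ℝ
  | .left, _, b => b
  | .right, a, _ => a

@[simp] theorem Flux.swap_swap (fl : Flux) : fl.swap.swap = fl := by cases fl <;> rfl

theorem Flux.endpoint_eq (fl : Flux) (a b : ℝ) : fl.endpoint a b = a ∨ fl.endpoint a b = b := by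
  cases fl
  · exact Or.inr rfl
  · exact Or.inl rfl

/-- The kernel that reproduces the value at `e` of polynomials of degree at most `k`. -/
def endKernel (k : ℕ) (a b e : ℝ) : ℝ[X] :=
  ∑ m ∈ Finset.range (k + 1), C ((2 * m + 1) * (cellLeg a b m).eval e) * cellLeg a b m

/-- The coefficient of the Legendre polynomial of degree `k` in `v - P v`, where `P` is the
Gauss–Radau projection that interpolates at the end point chosen by the flux. It equals
`coeffMinus` or `coeffPlus`. -/
def radauCoeff (k : ℕ) (a b : ℝ) (fl : Flux) (v : ℝ → ℝ) : ℝ :=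
  (cellLeg a b k).eval (fl.endpoint a b) * (-v (fl.endpoint a b) +
    (b - a)⁻¹ * ∫ x in a..b, v x * (endKernel k a b (fl.endpoint a b)).eval x)

/-- The projection `P⁻` or `P⁺` that belongs to the flux `û`. -/
def proj (k : ℕ) (a b : ℝ) (fl : Flux) (v : ℝ → ℝ) : ℝ[X] :=
  gaussRadau k a b (fl.endpoint a b) v

/-- The Legendre coefficients of the Gauss–Radau projection. -/
def projCoeff (k : ℕ) (a b : ℝ) (fl : Flux) (v : ℝ → ℝ) (m : ℕ) : ℝ :=
  (2 * m + 1) / (b - a) * (∫ x in a..b, v x * (cellLeg a b m).eval x) -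
    if m = k then radauCoeff k a b fl v else 0

section Cell

variable {k : ℕ} {a b : ℝ}

theorem integral_mul_endKernel (hab : a < b) (e : ℝ) {p : ℝ[X]} (hp : p.natDegree ≤ k) :
    ∫ x in a..b, p.eval x * (endKernel k a b e).eval x = (b - a) * p.eval e := by
  conv_rhs => rw [eq_sum_cellLeg hab hp]
  simp only [endKernel, eval_finsetSum, Finset.mul_sum, eval_mul, eval_C]
  rw [intervalIntegral.integral_finsetSum]
  · refine Finset.sum_congr rfl fun m _ => ?_
    have h : ∀ x, p.eval x * ((2 * m + 1) * (cellLeg a b m).eval e * (cellLeg a b m).eval x) =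
        (2 * m + 1) * (cellLeg a b m).eval e * (p.eval x * (cellLeg a b m).eval x) :=
      fun x => by ring
    simp only [h]
    rw [intervalIntegral.integral_const_mul]
    have : b - a ≠ 0 := by linarith
    field_simp
  · intro i _
    exact Continuous.intervalIntegrable (by fun_prop) _ _

theorem coeffMinus_eq (hab : a < b) (v : ℝ → ℝ) :
    coeffMinus k a b v = radauCoeff k a b .left v := by
  simp only [coeffMinus, radauCoeff, Flux.endpoint, endKernel, eval_cellLeg_right hab, one_mul,
    eval_finsetSum, eval_mul, eval_C, eval_cellLeg, mul_one]

theorem coeffPlus_eq (hab : a < b) (v : ℝ → ℝ) :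
    coeffPlus k a b v = radauCoeff k a b .right v := by
  simp only [coeffPlus, radauCoeff, Flux.endpoint, endKernel, eval_cellLeg_left hab,
    eval_finsetSum, eval_mul, eval_C, eval_cellLeg]
  rw [mul_add, mul_left_comm ((-1 : ℝ) ^ k) (b - a)⁻¹,
    ← intervalIntegral.integral_const_mul ((-1 : ℝ) ^ k)]
  congr 1
  · ring
  · congr 1
    refine intervalIntegral.integral_congr fun x _ => ?_
    rw [Finset.mul_sum, Finset.mul_sum, Finset.mul_sum]
    refine Finset.sum_congr rfl fun m _ => ?_
    rw [pow_add]; ring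

theorem projMinus_eq (v : ℝ → ℝ) : projMinus k a b v = proj k a b .left v := rfl

theorem projPlus_eq (v : ℝ → ℝ) : projPlus k a b v = proj k a b .right v := rfl

theorem isGaussRadau_proj (hab : a < b) (fl : Flux) {v : ℝ → ℝ}
    (hv : IntervalIntegrable v volume a b) :
    IsGaussRadau k a b (fl.endpoint a b) v (proj k a b fl v) := by
  have h := exists_isGaussRadau k hab (fl.endpoint_eq a b) hv
  rw [proj, gaussRadau, dif_pos h]
  exact h.choose_spec

theorem eval_cellLeg_endpoint_mul_self (hab : a < b) (m : ℕ) (fl : Flux) :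
    (cellLeg a b m).eval (fl.endpoint a b) * (cellLeg a b m).eval (fl.endpoint a b) = 1 := by
  cases fl
  · simp [Flux.endpoint, eval_cellLeg_right hab]
  · simp [Flux.endpoint, eval_cellLeg_left hab, ← mul_pow]

/-- Tested with polynomials of degree at most `k`, the projection error `v - P v` is a multiple of
the Legendre polynomial of degree `k`. -/
theorem integral_proj_mul (hab : a < b) (fl : Flux) {v : ℝ → ℝ}
    (hv : IntervalIntegrable v volume a b) {w : ℝ[X]} (hw : w.natDegree ≤ k) :
    ∫ x in a..b, (proj k a b fl v).eval x * w.eval x =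
      (∫ x in a..b, v x * w.eval x) -
        radauCoeff k a b fl v * ∫ x in a..b, (cellLeg a b k).eval x * w.eval x := by
  have hP := isGaussRadau_proj (k := k) hab fl hv
  set P := proj k a b fl v with hPdef
  set e := fl.endpoint a b with he
  set d : ℝ[X] → ℝ := fun w => (∫ x in a..b, v x * w.eval x) - ∫ x in a..b, P.eval x * w.eval x
    with hd
  have hlow : ∀ w : ℝ[X], w.degree < k → d w = 0 := fun w hw => by
    simp only [hd]; rw [hP.moments w hw, sub_self]
  have hadd : ∀ w w' : ℝ[X], ∀ c : ℝ, d (w + C c * w') = d w + c * d w' := by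
    intro w w' c
    simp only [hd, eval_add, eval_mul, eval_C, mul_add]
    have h1 : ∀ f : ℝ → ℝ, ∀ x, f x * (c * w'.eval x) = c * (f x * w'.eval x) := fun f x => by ring
    rw [intervalIntegral.integral_add (intervalIntegrable_mul_eval hv _),
      intervalIntegral.integral_add (intervalIntegrable_mul_eval (intervalIntegrable_eval P a b) _),
      h1 v |> funext, h1 (fun x => P.eval x) |> funext, intervalIntegral.integral_const_mul,
      intervalIntegral.integral_const_mul]
    · ring
    · rw [h1 (fun x => P.eval x) |> funext]
      exact (intervalIntegrable_mul_eval (intervalIntegrable_eval P a b) _).const_mul _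
    · rw [h1 v |> funext]
      exact (intervalIntegrable_mul_eval hv _).const_mul _
  have hba : b - a ≠ 0 := by linarith
  -- the reproducing kernel singles out the component along the Legendre polynomial of degree `k`
  have hker : d (endKernel k a b e) = (2 * k + 1) * (cellLeg a b k).eval e * d (cellLeg a b k) := by
    rw [endKernel, Finset.sum_range_succ, hadd, hlow, zero_add]
    refine (degree_sum_le _ _).trans_lt ?_
    rw [Finset.sup_lt_iff (WithBot.bot_lt_coe _)]
    intro m hm
    rw [← smul_eq_C_mul]
    refine (degree_smul_le _ _).trans_lt ?_
    rw [degree_cellLeg hab]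
    exact_mod_cast Finset.mem_range.1 hm
  have hcoef : radauCoeff k a b fl v = (2 * k + 1) / (b - a) * d (cellLeg a b k) := by
    have h1 : d (endKernel k a b e) =
        (∫ x in a..b, v x * (endKernel k a b e).eval x) - (b - a) * v e := by
      simp only [hd]
      rw [integral_mul_endKernel hab e hP.natDegree_le, hP.interp]
    rw [radauCoeff, ← he]
    have h2 : -v e + (b - a)⁻¹ * ∫ x in a..b, v x * (endKernel k a b e).eval x =
        (b - a)⁻¹ * d (endKernel k a b e) := by
      rw [h1]; field_simp; ring
    rw [h2, hker]
    have h3 := eval_cellLeg_endpoint_mul_self hab k fl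
    rw [← he] at h3
    calc _ = (2 * k + 1) / (b - a) * d (cellLeg a b k) *
          ((cellLeg a b k).eval e * (cellLeg a b k).eval e) := by ring
      _ = _ := by rw [h3, mul_one]
  obtain ⟨c, hc⟩ := exists_cellLeg_coeff hab hw
  have hw' : w = (w - C c * cellLeg a b k) + C c * cellLeg a b k := by ring
  have h1 : d w = c * d (cellLeg a b k) := by
    rw [hw', hadd, hlow _ hc, zero_add]
  have h2 : ∫ x in a..b, (cellLeg a b k).eval x * w.eval x = c * ((b - a) / (2 * k + 1)) := by
    have h3 := integral_cellLeg_mul hab hc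
    simp only [eval_sub, eval_mul, eval_C, mul_sub] at h3
    rw [intervalIntegral.integral_sub] at h3
    · have h4 : ∀ x, (cellLeg a b k).eval x * (c * (cellLeg a b k).eval x) =
          c * ((cellLeg a b k).eval x * (cellLeg a b k).eval x) := fun x => by ring
      simp only [h4] at h3
      rw [intervalIntegral.integral_const_mul, integral_cellLeg_sq hab] at h3
      linarith
    · exact Continuous.intervalIntegrable (by fun_prop) _ _
    · exact Continuous.intervalIntegrable (by fun_prop) _ _
  have h3 : d w = radauCoeff k a b fl v * ∫ x in a..b, (cellLeg a b k).eval x * w.eval x := by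
    rw [h1, h2, hcoef]
    have : (2 * (k : ℝ) + 1) ≠ 0 := by positivity
    field_simp
  simp only [hd] at h3
  linarith

/-- The Legendre expansion of the projection. In contrast to the definition of the projection by
choice, it shows how the projection depends on `v`. -/
theorem proj_eq_sum (hab : a < b) (fl : Flux) {v : ℝ → ℝ}
    (hv : IntervalIntegrable v volume a b) :
    proj k a b fl v = ∑ m ∈ Finset.range (k + 1), C (projCoeff k a b fl v m) * cellLeg a b m := by
  rw [eq_sum_cellLeg hab (isGaussRadau_proj (k := k) hab fl hv).natDegree_le]
  refine Finset.sum_congr rfl fun m hm => ?_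
  have hm' : m ≤ k := Nat.lt_succ_iff.1 (Finset.mem_range.1 hm)
  congr 2
  rw [integral_proj_mul hab fl hv (by rwa [natDegree_cellLeg hab]), projCoeff]
  split_ifs with h
  · subst h
    rw [integral_cellLeg_sq hab]
    have : b - a ≠ 0 := by linarith
    have : (2 * (m : ℝ) + 1) ≠ 0 := by positivity
    field_simp
  · rw [integral_cellLeg_mul_cellLeg hab (Ne.symm h), mul_zero, sub_zero, sub_zero]

theorem radauCoeff_eval (hab : a < b) (fl : Flux) {p : ℝ[X]} (hp : p.natDegree ≤ k) :
    radauCoeff k a b fl (fun x => p.eval x) = 0 := by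
  rw [radauCoeff, integral_mul_endKernel hab _ hp]
  have hba : b - a ≠ 0 := by linarith
  rw [inv_mul_cancel_left₀ hba]; ring

theorem radauCoeff_sub (fl : Flux) {v v' : ℝ → ℝ}
    (hv : IntervalIntegrable v volume a b) (hv' : IntervalIntegrable v' volume a b) :
    radauCoeff k a b fl (fun x => v x - v' x) = radauCoeff k a b fl v - radauCoeff k a b fl v' := by
  simp only [radauCoeff, sub_mul]
  rw [intervalIntegral.integral_sub (intervalIntegrable_mul_eval hv _)
    (intervalIntegrable_mul_eval hv' _)]
  ring

theorem abs_cellLeg_le {c : ℝ}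
    (hc : ∀ m ≤ k, ∀ x ∈ Icc (-1 : ℝ) 1, |(legendre m).eval x| ≤ c) (hab : a < b) {m : ℕ}
    (hm : m ≤ k) {x : ℝ} (hx : x ∈ Icc a b) : |(cellLeg a b m).eval x| ≤ c := by
  rw [eval_cellLeg, cellLegendre]
  refine hc m hm _ ⟨?_, ?_⟩
  · rw [le_div_iff₀ (by linarith)]; linarith [hx.1]
  · rw [div_le_iff₀ (by linarith)]; linarith [hx.2]

theorem endpoint_mem (hab : a < b) (fl : Flux) : fl.endpoint a b ∈ Icc a b := by
  rcases fl.endpoint_eq a b with h | h <;> rw [h]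
  · exact left_mem_Icc.2 hab.le
  · exact right_mem_Icc.2 hab.le

theorem abs_integral_mul_le {v w : ℝ → ℝ} (hab : a < b) {m n : ℝ}
    (hv : ∀ x ∈ Icc a b, |v x| ≤ m) (hw : ∀ x ∈ Icc a b, |w x| ≤ n) :
    |∫ x in a..b, v x * w x| ≤ m * n * (b - a) := by
  have := intervalIntegral.norm_integral_le_of_norm_le_const (a := a) (b := b)
    (f := fun x => v x * w x) (C := m * n) (fun x hx => by
      rw [uIoc_of_le hab.le] at hx
      have hx' : x ∈ Icc a b := ⟨hx.1.le, hx.2⟩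
      rw [Real.norm_eq_abs, abs_mul]
      exact mul_le_mul (hv x hx') (hw x hx') (abs_nonneg _)
        ((abs_nonneg _).trans (hv x hx')))
  rwa [Real.norm_eq_abs, abs_of_pos (sub_pos.2 hab)] at this

theorem abs_endKernel_le {c : ℝ}
    (hc : ∀ m ≤ k, ∀ x ∈ Icc (-1 : ℝ) 1, |(legendre m).eval x| ≤ c) (hab : a < b) (fl : Flux)
    {x : ℝ} (hx : x ∈ Icc a b) :
    |(endKernel k a b (fl.endpoint a b)).eval x| ≤ ∑ m ∈ Finset.range (k + 1), (2 * m + 1) * c := by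
  rw [endKernel, eval_finsetSum]
  refine (Finset.abs_sum_le_sum_abs _ _).trans (Finset.sum_le_sum fun m hm => ?_)
  have h1 := eval_cellLeg_endpoint_mul_self hab m fl
  have h2 : |(cellLeg a b m).eval (fl.endpoint a b)| = 1 := by
    have : |(cellLeg a b m).eval (fl.endpoint a b)| *
        |(cellLeg a b m).eval (fl.endpoint a b)| = 1 := by
      rw [← abs_mul, h1, abs_one]
    nlinarith [abs_nonneg ((cellLeg a b m).eval (fl.endpoint a b))]
  rw [eval_mul, eval_C, abs_mul, abs_mul, h2, mul_one, abs_of_pos (by positivity)]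
  gcongr
  exact abs_cellLeg_le hc hab (Nat.lt_succ_iff.1 (Finset.mem_range.1 hm)) hx

theorem exists_radauCoeff_bound (k : ℕ) : ∃ c : ℝ, 1 ≤ c ∧ ∀ (a b : ℝ), a < b → ∀ (fl : Flux)
    (v : ℝ → ℝ) (m : ℝ), (∀ x ∈ Icc a b, |v x| ≤ m) → |radauCoeff k a b fl v| ≤ c * m := by
  obtain ⟨c, hc1, hc⟩ := exists_legendre_bound k
  set c' := ∑ m ∈ Finset.range (k + 1), (2 * (m : ℝ) + 1) * c with hc'
  have hc'0 : 0 ≤ c' := Finset.sum_nonneg fun m _ => by positivity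
  refine ⟨1 + c', by linarith, fun a b hab fl v m hv => ?_⟩
  have h1 := eval_cellLeg_endpoint_mul_self hab k fl
  have h2 : |(cellLeg a b k).eval (fl.endpoint a b)| = 1 := by
    have : |(cellLeg a b k).eval (fl.endpoint a b)| *
        |(cellLeg a b k).eval (fl.endpoint a b)| = 1 := by
      rw [← abs_mul, h1, abs_one]
    nlinarith [abs_nonneg ((cellLeg a b k).eval (fl.endpoint a b))]
  have h3 := abs_integral_mul_le hab hv fun x hx => abs_endKernel_le hc hab fl hx
  rw [radauCoeff, abs_mul, h2, one_mul]
  refine (abs_add_le _ _).trans ?_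
  rw [abs_neg, abs_mul, abs_of_pos (inv_pos.2 (sub_pos.2 hab)), one_add_mul]
  refine add_le_add (hv _ (endpoint_mem hab fl)) ?_
  rw [inv_mul_le_iff₀ (sub_pos.2 hab)]
  linarith

theorem exists_proj_bound (k : ℕ) : ∃ c : ℝ, 1 ≤ c ∧ ∀ (a b : ℝ), a < b → ∀ (fl : Flux)
    (v : ℝ → ℝ) (m : ℝ), IntervalIntegrable v volume a b → (∀ x ∈ Icc a b, |v x| ≤ m) →
      ∀ x ∈ Icc a b, |(proj k a b fl v).eval x| ≤ c * m := by
  obtain ⟨c, hc1, hc⟩ := exists_legendre_bound k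
  obtain ⟨c2, hc2, hcoef⟩ := exists_radauCoeff_bound k
  set c' := ∑ m ∈ Finset.range (k + 1), ((2 * (m : ℝ) + 1) * c + c2) * c with hc'
  have hc'0 : 0 ≤ c' := Finset.sum_nonneg fun m _ => by positivity
  refine ⟨1 + c', by linarith, fun a b hab fl v m hvi hv x hx => ?_⟩
  have hm0 : 0 ≤ m := (abs_nonneg _).trans (hv x hx)
  rw [proj_eq_sum hab fl hvi, eval_finsetSum]
  refine (Finset.abs_sum_le_sum_abs _ _).trans ?_
  have : ∑ i ∈ Finset.range (k + 1), |(C (projCoeff k a b fl v i) * cellLeg a b i).eval x| ≤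
      c' * m := by
    rw [hc', Finset.sum_mul]
    refine Finset.sum_le_sum fun i hi => ?_
    have hi' : i ≤ k := Nat.lt_succ_iff.1 (Finset.mem_range.1 hi)
    have h1 : |projCoeff k a b fl v i| ≤ ((2 * (i : ℝ) + 1) * c + c2) * m := by
      rw [projCoeff]
      refine (abs_sub _ _).trans ?_
      rw [add_mul]
      refine add_le_add ?_ ?_
      · have h3 := abs_integral_mul_le hab hv fun x hx => abs_cellLeg_le hc hab hi' hx
        have hba := sub_pos.2 hab
        rw [abs_mul, abs_of_pos (by positivity)]
        calc _ ≤ (2 * (i : ℝ) + 1) / (b - a) * (m * c * (b - a)) := by gcongr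
          _ = _ := by field_simp
      · split_ifs
        · exact hcoef a b hab fl v m hv
        · rw [abs_zero]; positivity
    rw [eval_mul, eval_C, abs_mul]
    calc _ ≤ (((2 * (i : ℝ) + 1) * c + c2) * m) * c := by
          gcongr
          exact abs_cellLeg_le hc hab hi' hx
      _ = _ := by ring
  linarith

/-- Inverse estimate for the trace of a polynomial at an end point of a cell. -/
theorem exists_trace_bound (k : ℕ) : ∃ c : ℝ, 1 ≤ c ∧ ∀ (a b : ℝ), a < b → ∀ (fl : Flux)
    (p : ℝ[X]), p.natDegree ≤ k →
      (p.eval (fl.endpoint a b)) ^ 2 * (b - a) ≤ c * ∫ x in a..b, p.eval x * p.eval x := by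
  obtain ⟨c, hc1, hc⟩ := exists_legendre_bound k
  set c' := ∑ m ∈ Finset.range (k + 1), (2 * (m : ℝ) + 1) * c with hc'
  have hc'0 : 0 ≤ c' := Finset.sum_nonneg fun m _ => by positivity
  refine ⟨1 + c', by linarith, fun a b hab fl p hp => ?_⟩
  set K := endKernel k a b (fl.endpoint a b) with hK
  set y := p.eval (fl.endpoint a b) with hy
  have hba := sub_pos.2 hab
  have hKd : K.natDegree ≤ k := by
    rw [hK, endKernel]
    refine natDegree_sum_le_of_forall_le _ _ fun m hm => ?_
    refine (natDegree_C_mul_le _ _).trans ?_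
    rw [natDegree_cellLeg hab]
    exact Nat.lt_succ_iff.1 (Finset.mem_range.1 hm)
  have h1 : ∫ x in a..b, p.eval x * K.eval x = (b - a) * y := integral_mul_endKernel hab _ hp
  have h2 : ∫ x in a..b, K.eval x * K.eval x ≤ (b - a) * c' := by
    rw [integral_mul_endKernel hab _ hKd]
    exact mul_le_mul_of_nonneg_left
      ((le_abs_self _).trans (abs_endKernel_le hc hab fl (endpoint_mem hab fl))) hba.le
  -- expand `∫ ((1 + c') p - y K)² ≥ 0`
  have h3 : 0 ≤ ∫ x in a..b, ((1 + c') * p.eval x - y * K.eval x) ^ 2 :=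
    intervalIntegral.integral_nonneg hab.le fun x _ => sq_nonneg _
  have h4 : ∫ x in a..b, ((1 + c') * p.eval x - y * K.eval x) ^ 2 =
      (1 + c') ^ 2 * (∫ x in a..b, p.eval x * p.eval x) -
        2 * (1 + c') * y * (∫ x in a..b, p.eval x * K.eval x) +
        y ^ 2 * ∫ x in a..b, K.eval x * K.eval x := by
    rw [← intervalIntegral.integral_const_mul, ← intervalIntegral.integral_const_mul,
      ← intervalIntegral.integral_const_mul, ← intervalIntegral.integral_sub,
      ← intervalIntegral.integral_add]
    · congr 1; ext x; ring
    · exact Continuous.intervalIntegrable (by fun_prop) _ _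
    · exact Continuous.intervalIntegrable (by fun_prop) _ _
    · exact Continuous.intervalIntegrable (by fun_prop) _ _
    · exact Continuous.intervalIntegrable (by fun_prop) _ _
  rw [h4, h1] at h3
  have h5 : y ^ 2 * ∫ x in a..b, K.eval x * K.eval x ≤ y ^ 2 * ((b - a) * c') :=
    mul_le_mul_of_nonneg_left h2 (sq_nonneg _)
  have h6 : 0 ≤ (1 + c') * ((1 + c') * (∫ x in a..b, p.eval x * p.eval x) - y ^ 2 * (b - a)) := by
    nlinarith [mul_nonneg (sq_nonneg y) hba.le]
  have h7 := nonneg_of_mul_nonneg_right h6 (by positivity)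
  linarith

end Cell

/-! ### Correction functions on a cell -/

/-- The correction functions: `corr 0` is the Legendre polynomial of degree `k`, and `corr (p + 1)`
is `P D⁻¹` applied to the function `corr p` for the other fluxes. They comprise the functions
`F₁`, `F₂`, `barF₁`, `barF₂`. -/
def corr (k : ℕ) (a b : ℝ) : ℕ → Flux → ℝ[X]
  | 0, _ => cellLeg a b k
  | p + 1, fl => proj k a b fl (intOp a b fun x => (corr k a b p fl.swap).eval x)

/-- The projection of `v` minus the corrections of orders `1, …, k` with coefficients `e p`. -/
def corrected (k : ℕ) (a b : ℝ) (fl : Flux) (v : ℝ → ℝ) (e : ℕ → ℝ) : ℝ[X] :=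
  proj k a b fl v - ∑ p ∈ Finset.Icc 1 k, C (((b - a) / 2) ^ p * e p) * corr k a b p fl

section Cell

variable {k : ℕ} {a b : ℝ}

theorem F₂_succ_eq (i : ℕ) : F₂ k a b (i + 1) = corr k a b (2 * i + 1) .left := by
  have h0 : (fun x => (cellLeg a b k).eval x) = cellLegendre a b k :=
    funext fun x => eval_cellLeg a b k x
  induction i with
  | zero => simp [F₂, corr, projMinus_eq, h0]
  | succ i ih =>
    rw [F₂, Nat.add_sub_cancel, Function.iterate_succ_apply'] at *
    rw [ih]; rfl

theorem F₁_succ_eq (i : ℕ) : F₁ k a b (i + 1) = corr k a b (2 * i + 1) .right := by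
  have h0 : (fun x => (cellLeg a b k).eval x) = cellLegendre a b k :=
    funext fun x => eval_cellLeg a b k x
  induction i with
  | zero => simp [F₁, corr, projPlus_eq, h0]
  | succ i ih =>
    rw [F₁, Nat.add_sub_cancel, Function.iterate_succ_apply'] at *
    rw [ih]; rfl

theorem barF₁_succ_eq (i : ℕ) : barF₁ k a b (i + 1) = corr k a b (2 * i + 2) .left := by
  rw [barF₁, F₁_succ_eq]; rfl

theorem barF₂_succ_eq (i : ℕ) : barF₂ k a b (i + 1) = corr k a b (2 * i + 2) .right := by
  rw [barF₂, F₂_succ_eq]; rfl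

theorem sum_Icc_even_add_odd {M : Type*} [AddCommMonoid M] (f : ℕ → M) (k : ℕ) :
    ∑ p ∈ Finset.Icc 1 k, f p = ∑ i ∈ Finset.Icc 1 (k / 2), f (2 * i) +
      ∑ i ∈ Finset.Icc 1 ((k + 1) / 2), f (2 * i - 1) := by
  induction k with
  | zero => simp
  | succ k ih =>
    rw [Finset.sum_Icc_succ_top (by omega), ih]
    rcases Nat.even_or_odd' k with ⟨n, rfl | rfl⟩
    · have h1 : 2 * n / 2 = n := by omega
      have h2 : (2 * n + 1) / 2 = n := by omega
      have h3 : (2 * n + 1 + 1) / 2 = n + 1 := by omega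
      rw [h1, h2, h3, Finset.sum_Icc_succ_top (a := 1) (b := n) (by omega), add_assoc]
      congr 3
    · have h1 : (2 * n + 1) / 2 = n := by omega
      have h2 : (2 * n + 1 + 1) / 2 = n + 1 := by omega
      have h3 : (2 * n + 1 + 1 + 1) / 2 = n + 1 := by omega
      rw [h1, h2, h3, Finset.sum_Icc_succ_top (a := 1) (b := n) (f := fun i => f (2 * i))
        (by omega),
        add_right_comm]
      congr 3

/-- The coefficients of the corrections of `u`: the `L_k`-coefficients of `∂_t^{p/2} u` for even `p`
and of `∂_t^{(p-1)/2} u_x` for odd `p`. -/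
def corrCoeff (k : ℕ) (a b T : ℝ) (u : ℝ → ℝ → ℝ) (fl : Flux) (t : ℝ) (p : ℕ) : ℝ :=
  if p % 2 = 0 then G k a b T u fl (p / 2) t else Q k a b T u fl (p / 2) t

/-- The interpolant with its even and odd corrections merged into one sum over the order. -/
theorem interpolant_eq (T : ℝ) (u : ℝ → ℝ → ℝ) (t : ℝ) (fl : Flux) :
    interpolant k k a b T u t fl =
      corrected k a b fl (fun x => u x t) (corrCoeff k a b T u fl t) := by
  rw [corrected, sum_Icc_even_add_odd]
  have he : ∀ i, corrCoeff k a b T u fl t (2 * i) = G k a b T u fl i t := by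
    intro i
    rw [corrCoeff, if_pos (by omega), show 2 * i / 2 = i by omega]
  have ho : ∀ i, 1 ≤ i → corrCoeff k a b T u fl t (2 * i - 1) = Q k a b T u fl (i - 1) t := by
    intro i hi
    rw [corrCoeff, if_neg (by omega), show (2 * i - 1) / 2 = i - 1 by omega]
  cases fl
  · simp only [interpolant, W₂, projMinus_eq]
    congr 2
    · refine Finset.sum_congr rfl fun i hi => ?_
      obtain ⟨i, rfl⟩ := Nat.exists_eq_add_of_le' (Finset.mem_Icc.1 hi).1
      rw [he, barF₁_succ_eq, show 2 * (i + 1) = 2 * i + 2 by ring]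
    · refine Finset.sum_congr rfl fun i hi => ?_
      obtain ⟨i, rfl⟩ := Nat.exists_eq_add_of_le' (Finset.mem_Icc.1 hi).1
      rw [ho _ (by omega), F₂_succ_eq, show 2 * (i + 1) - 1 = 2 * i + 1 by omega]
  · simp only [interpolant, W₂, projPlus_eq]
    rw [add_comm]
    congr 2
    · refine Finset.sum_congr rfl fun i hi => ?_
      obtain ⟨i, rfl⟩ := Nat.exists_eq_add_of_le' (Finset.mem_Icc.1 hi).1
      rw [he, barF₂_succ_eq, show 2 * (i + 1) = 2 * i + 2 by ring]
    · refine Finset.sum_congr rfl fun i hi => ?_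
      obtain ⟨i, rfl⟩ := Nat.exists_eq_add_of_le' (Finset.mem_Icc.1 hi).1
      rw [ho _ (by omega), F₁_succ_eq, show 2 * (i + 1) - 1 = 2 * i + 1 by omega]

theorem hasDerivAt_intOp (a b : ℝ) (p : ℝ[X]) (x : ℝ) :
    HasDerivAt (intOp a b fun y => p.eval y) (((b - a) / 2)⁻¹ * p.eval x) x := by
  refine HasDerivAt.const_mul _ ?_
  exact intervalIntegral.integral_hasDerivAt_right (intervalIntegrable_eval p a x)
    (p.continuous.stronglyMeasurableAtFilter _ _) p.continuous.continuousAt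

theorem continuous_intOp (a b : ℝ) (p : ℝ[X]) : Continuous (intOp a b fun y => p.eval y) :=
  continuous_iff_continuousAt.2 fun x => (hasDerivAt_intOp a b p x).continuousAt

theorem intOp_left (a b : ℝ) (v : ℝ → ℝ) : intOp a b v a = 0 := by
  rw [intOp, intervalIntegral.integral_same, mul_zero]

theorem natDegree_proj_le (hab : a < b) (fl : Flux) {v : ℝ → ℝ}
    (hv : IntervalIntegrable v volume a b) : (proj k a b fl v).natDegree ≤ k :=
  (isGaussRadau_proj hab fl hv).natDegree_le

theorem natDegree_corr_le (hab : a < b) (p : ℕ) (fl : Flux) : (corr k a b p fl).natDegree ≤ k := by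
  cases p with
  | zero => rw [corr, natDegree_cellLeg hab]
  | succ p =>
    exact natDegree_proj_le hab fl ((continuous_intOp a b _).intervalIntegrable a b)

theorem integral_intOp_mul_derivative (f w : ℝ[X])
    (h0 : intOp a b (fun y => f.eval y) b = 0) :
    ∫ x in a..b, intOp a b (fun y => f.eval y) x * w.derivative.eval x =
      -(((b - a) / 2)⁻¹ * ∫ x in a..b, f.eval x * w.eval x) := by
  have h := intervalIntegral.integral_mul_deriv_eq_deriv_mul (a := a) (b := b)
    (u := intOp a b fun y => f.eval y) (v := fun x => w.eval x)
    (u' := fun x => ((b - a) / 2)⁻¹ * f.eval x) (v' := fun x => w.derivative.eval x)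
    (fun x _ => hasDerivAt_intOp a b f x) (fun x _ => w.hasDerivAt x)
    ((intervalIntegrable_eval f a b).const_mul _) (intervalIntegrable_eval _ a b)
  rw [h, h0, intOp_left, ← intervalIntegral.integral_const_mul]
  simp only [mul_assoc]; ring

theorem exists_derivative_eq {n : ℕ} {w : ℝ[X]} (hw : w.degree < (n : WithBot ℕ)) :
    ∃ v : ℝ[X], v.derivative = w ∧ v.degree < ((n + 1 : ℕ) : WithBot ℕ) := by
  refine ⟨∑ i ∈ Finset.range n, monomial (i + 1) (w.coeff i / (i + 1)), ?_, ?_⟩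
  · ext m
    simp only [derivative_sum, derivative_monomial, finsetSum_coeff, coeff_monomial,
      Nat.add_sub_cancel]
    rw [Finset.sum_ite_eq']
    split_ifs with h
    · push_cast
      field_simp
    · rw [Finset.mem_range, not_lt] at h
      exact ((degree_lt_iff_coeff_zero _ _).1 hw m h).symm
  · refine (degree_sum_le _ _).trans_lt ?_
    rw [Finset.sup_lt_iff (WithBot.bot_lt_coe _)]
    intro i hi
    refine (degree_monomial_le _ _).trans_lt ?_
    exact_mod_cast Nat.succ_lt_succ (Finset.mem_range.1 hi)

/-- The correction of order `p` is orthogonal to the polynomials of degree less than `k - p`: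
each antiderivative costs one order of orthogonality. -/
theorem integral_corr_mul (hab : a < b) {p : ℕ} (hp : p ≤ k) (fl : Flux) {w : ℝ[X]}
    (hw : w.degree < (k - p : ℕ)) : ∫ x in a..b, (corr k a b p fl).eval x * w.eval x = 0 := by
  induction p generalizing fl w with
  | zero => exact integral_cellLeg_mul hab hw
  | succ p ih =>
    set f := corr k a b p fl.swap with hf
    have h0 : intOp a b (fun y => f.eval y) b = 0 := by
      have := ih (by omega) fl.swap (w := 1) (by
        rw [degree_one]; exact_mod_cast (by omega : 0 < k - p))
      simp only [eval_one, mul_one] at this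
      rw [intOp, hf, this, mul_zero]
    -- with `w = v'`, integration by parts leads back to order `p`, tested with `v`
    obtain ⟨v, rfl, hv⟩ := exists_derivative_eq hw
    rw [corr, (isGaussRadau_proj hab fl ((continuous_intOp a b _).intervalIntegrable a b)).moments,
      integral_intOp_mul_derivative f v h0, ih (by omega), mul_zero, neg_zero]
    · rwa [show k - p = k - (p + 1) + 1 by omega]
    · refine hw.trans ?_
      exact_mod_cast (by omega : k - (p + 1) < k)

theorem intOp_corr_right (hab : a < b) {p : ℕ} (hp : p < k) (fl : Flux) :
    intOp a b (fun y => (corr k a b p fl).eval y) b = 0 := by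
  have := integral_corr_mul hab hp.le fl (w := 1) (by
    rw [degree_one]; exact_mod_cast (by omega : 0 < k - p))
  simp only [eval_one, mul_one] at this
  rw [intOp, this, mul_zero]

theorem eval_corr_endpoint (hab : a < b) {p : ℕ} (hp : p ∈ Finset.Icc 1 k) (fl : Flux) :
    (corr k a b p fl).eval (fl.endpoint a b) = 0 := by
  obtain ⟨h1, h2⟩ := Finset.mem_Icc.1 hp
  obtain ⟨p, rfl⟩ := Nat.exists_eq_add_of_le' h1
  rw [corr, (isGaussRadau_proj hab fl ((continuous_intOp a b _).intervalIntegrable a b)).interp]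
  rcases fl.endpoint_eq a b with h | h <;> rw [h]
  · exact intOp_left _ _ _
  · exact intOp_corr_right hab (by omega) _

theorem integral_corr_mul_derivative (hab : a < b) {p : ℕ} (hp : p < k) (fl : Flux) {w : ℝ[X]}
    (hw : w.natDegree ≤ k) :
    (b - a) / 2 * ∫ x in a..b, (corr k a b (p + 1) fl).eval x * w.derivative.eval x =
      -∫ x in a..b, (corr k a b p fl.swap).eval x * w.eval x := by
  have h1 : w.derivative.degree < k := by
    rcases eq_or_ne w.derivative 0 with h | h
    · rw [h, degree_zero]; exact WithBot.bot_lt_coe _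
    · rw [← natDegree_lt_iff_degree_lt h]
      have := natDegree_derivative_le w
      omega
  rw [corr, (isGaussRadau_proj hab fl ((continuous_intOp a b _).intervalIntegrable a b)).moments
    _ h1, integral_intOp_mul_derivative _ w (intOp_corr_right hab hp _)]
  have : b - a ≠ 0 := by linarith
  field_simp

theorem exists_corr_bound (k p : ℕ) : ∃ c : ℝ, 1 ≤ c ∧ ∀ (a b : ℝ), a < b → ∀ (fl : Flux),
    ∀ x ∈ Icc a b, |(corr k a b p fl).eval x| ≤ c := by
  induction p with
  | zero =>
    obtain ⟨c, hc1, hc⟩ := exists_legendre_bound k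
    exact ⟨c, hc1, fun a b hab fl x hx => abs_cellLeg_le hc hab le_rfl hx⟩
  | succ p ih =>
    obtain ⟨c, hc1, hc⟩ := ih
    obtain ⟨c', hc1', hc'⟩ := exists_proj_bound k
    refine ⟨c' * (2 * c), by nlinarith, fun a b hab fl x hx => ?_⟩
    rw [corr]
    refine hc' a b hab fl _ _ ((continuous_intOp a b _).intervalIntegrable a b)
      (fun y hy => ?_) x hx
    have h1 := intervalIntegral.norm_integral_le_of_norm_le_const (a := a) (b := y) (C := c)
      (f := fun z => (corr k a b p fl.swap).eval z) (fun z hz => by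
        rw [uIoc_of_le hy.1] at hz
        exact hc a b hab _ z ⟨hz.1.le, hz.2.trans hy.2⟩)
    rw [Real.norm_eq_abs, abs_of_nonneg (sub_nonneg.2 hy.1)] at h1
    have hba := sub_pos.2 hab
    rw [intOp, abs_mul, abs_of_pos (by positivity), inv_mul_le_iff₀ (by positivity)]
    refine h1.trans ?_
    nlinarith [hy.2]

theorem natDegree_corrected_le (hab : a < b) (fl : Flux) {v : ℝ → ℝ}
    (hv : IntervalIntegrable v volume a b) (e : ℕ → ℝ) :
    (corrected k a b fl v e).natDegree ≤ k := by
  refine (natDegree_sub_le _ _).trans (max_le (natDegree_proj_le hab fl hv) ?_)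
  exact natDegree_sum_le_of_forall_le _ _ fun p _ =>
    (natDegree_C_mul_le _ _).trans (natDegree_corr_le hab p fl)

theorem eval_corrected_endpoint (hab : a < b) (fl : Flux) {v : ℝ → ℝ}
    (hv : IntervalIntegrable v volume a b) (e : ℕ → ℝ) :
    (corrected k a b fl v e).eval (fl.endpoint a b) = v (fl.endpoint a b) := by
  rw [corrected, eval_sub, (isGaussRadau_proj hab fl hv).interp, eval_finsetSum,
    Finset.sum_eq_zero, sub_zero]
  intro p hp
  rw [eval_mul, eval_corr_endpoint hab hp, mul_zero]

theorem integral_corrected_mul (fl : Flux) (v : ℝ → ℝ) (e : ℕ → ℝ) (w : ℝ[X]) :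
    ∫ x in a..b, (corrected k a b fl v e).eval x * w.eval x =
      (∫ x in a..b, (proj k a b fl v).eval x * w.eval x) -
        ∑ p ∈ Finset.Icc 1 k, ((b - a) / 2) ^ p * e p *
          ∫ x in a..b, (corr k a b p fl).eval x * w.eval x := by
  simp only [corrected, eval_sub, eval_finsetSum, sub_mul, Finset.sum_mul, eval_mul, eval_C]
  rw [intervalIntegral.integral_sub, intervalIntegral.integral_finsetSum]
  · congr 1
    refine Finset.sum_congr rfl fun p _ => ?_
    rw [← intervalIntegral.integral_const_mul]
    simp only [mul_assoc]
  · intro i _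
    exact Continuous.intervalIntegrable (by fun_prop) _ _
  · exact Continuous.intervalIntegrable (by fun_prop) _ _
  · exact Continuous.intervalIntegrable (by fun_prop) _ _

/-- The corrected projections satisfy the cell equations up to the last correction term: the
contributions of all other orders cancel in pairs. Here `v` and `v'` stand for `u` and `u_x`, or
for `u_x` and `u_t`. -/
theorem integral_corrected_add (hk : 1 ≤ k) (hab : a < b) (fl : Flux) {v v' : ℝ → ℝ}
    (hv : IntervalIntegrable v volume a b) (hv' : IntervalIntegrable v' volume a b) {e : ℕ → ℝ}
    (he : e 1 = radauCoeff k a b fl.swap v') {w : ℝ[X]}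
    (hw : w.natDegree ≤ k) :
    (∫ x in a..b, (corrected k a b fl.swap v' fun p => e (p + 1)).eval x * w.eval x) +
        ∫ x in a..b, (corrected k a b fl v e).eval x * w.derivative.eval x =
      (∫ x in a..b, v' x * w.eval x) + (∫ x in a..b, v x * w.derivative.eval x) -
        ((b - a) / 2) ^ k * e (k + 1) *
          ∫ x in a..b, (corr k a b k fl.swap).eval x * w.eval x := by
  have hwd : w.derivative.degree < k := by
    rcases eq_or_ne w.derivative 0 with h | h
    · rw [h, degree_zero]; exact WithBot.bot_lt_coe _
    · rw [← natDegree_lt_iff_degree_lt h]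
      have := natDegree_derivative_le w
      omega
  rw [integral_corrected_mul, integral_corrected_mul,
    integral_proj_mul hab _ hv' hw, (isGaussRadau_proj hab fl hv).moments _ hwd, ← he]
  -- by integration by parts, order `p` of the first sum cancels order `p + 1` of the second
  have tel : ∀ n ≤ k, e 1 * (∫ x in a..b, (cellLeg a b k).eval x * w.eval x) +
      (∑ p ∈ Finset.Icc 1 n, ((b - a) / 2) ^ p * e (p + 1) *
          ∫ x in a..b, (corr k a b p fl.swap).eval x * w.eval x) +
      (∑ p ∈ Finset.Icc 1 n, ((b - a) / 2) ^ p * e p *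
          ∫ x in a..b, (corr k a b p fl).eval x * w.derivative.eval x) =
      ((b - a) / 2) ^ n * e (n + 1) * ∫ x in a..b, (corr k a b n fl.swap).eval x * w.eval x := by
    intro n
    induction n with
    | zero => intro _; simp [corr]
    | succ n ih =>
      intro hn
      have h1 := ih (by omega)
      have h2 := integral_corr_mul_derivative hab (p := n) (by omega) fl hw
      rw [Finset.sum_Icc_succ_top (by omega), Finset.sum_Icc_succ_top (by omega)]
      have h3 : ((b - a) / 2) ^ (n + 1) * e (n + 1) *
          (∫ x in a..b, (corr k a b (n + 1) fl).eval x * w.derivative.eval x) =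
          -(((b - a) / 2) ^ n * e (n + 1) *
            ∫ x in a..b, (corr k a b n fl.swap).eval x * w.eval x) := by
        rw [pow_succ, ← mul_neg, ← h2]; ring
      rw [h3]
      linarith
  have := tel k le_rfl
  linarith

end Cell

/-! ### Classical representatives of Sobolev functions -/

/-- Integration by parts for a continuously differentiable `φ` and an absolutely continuous `W`. -/
theorem integral_deriv_mul_of_integral {φ φ' W z : ℝ → ℝ} (hφ : ∀ x, HasDerivAt φ (φ' x) x)
    (hφ' : Continuous φ') (hz : LocallyIntegrable z) (hW : ∀ x y, W y - W x = ∫ s in x..y, z s)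
    (a b : ℝ) :
    ∫ x in a..b, φ' x * W x = φ b * W b - φ a * W a - ∫ x in a..b, φ x * z x := by
  have hzi : ∀ x y, IntervalIntegrable z volume x y := fun x y =>
    intervalIntegrable_iff.mpr
      ((hz.integrableOn_isCompact isCompact_uIcc).mono_set uIoc_subset_uIcc)
  have hφ'' : deriv φ = φ' := funext fun x => (hφ x).deriv
  have hC : ContDiff ℝ 1 φ := by
    rw [contDiff_one_iff_deriv]
    exact ⟨fun x => (hφ x).differentiableAt, by rwa [hφ'']⟩
  have hWeq : W = fun x => W a + ∫ s in a..x, z s := by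
    ext x; rw [← hW a x]; ring
  have h1 : AbsolutelyContinuousOnInterval φ a b :=
    hC.contDiffOn.absolutelyContinuousOnInterval
  have h2 : AbsolutelyContinuousOnInterval W a b := by
    rw [hWeq]
    refine AbsolutelyContinuousOnInterval.fun_add (f := fun _ => W a) ?_
      ((hzi a b).absolutelyContinuousOnInterval_intervalIntegral left_mem_uIcc)
    exact (contDiff_const (n := 1)).contDiffOn.absolutelyContinuousOnInterval
  have h3 := AbsolutelyContinuousOnInterval.integral_mul_deriv_eq_deriv_mul h1 h2
  have h4 : ∫ x in a..b, φ x * deriv W x = ∫ x in a..b, φ x * z x := by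
    refine intervalIntegral.integral_congr_ae ?_
    filter_upwards [_root_.LocallyIntegrable.ae_hasDerivAt_integral hz] with x hx _
    have : HasDerivAt W (z x) x := by
      rw [hWeq]; simpa using (hx a).const_add (W a)
    rw [this.deriv]
  rw [hφ''] at h3
  rw [← h4, h3]; ring

theorem exists_Icc_of_isCompact {a b : ℝ} {K : Set ℝ} (hK : IsCompact K) (hab : a < b)
    (hKs : K ⊆ Ioo a b) : ∃ c d, a < c ∧ c ≤ d ∧ d < b ∧ K ⊆ Icc c d := by
  rcases K.eq_empty_or_nonempty with rfl | hne
  · exact ⟨(a + b) / 2, (a + b) / 2, by linarith, le_rfl, by linarith, empty_subset _⟩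
  · obtain ⟨c, hc⟩ := hK.exists_isLeast hne
    obtain ⟨d, hd⟩ := hK.exists_isGreatest hne
    exact ⟨c, d, (hKs hc.1).1, hc.2 hd.1, (hKs hd.1).2, fun x hx => ⟨hc.2 hx, hd.2 hx⟩⟩

/-- **du Bois-Reymond lemma**. -/
theorem exists_ae_eq_const_of_integral_deriv {a b : ℝ} (hab : a < b) {h : ℝ → ℝ}
    (hh : IntegrableOn h (Ioo a b))
    (h0 : ∀ φ : ℝ → ℝ, ContDiff ℝ (⊤ : ℕ∞) φ → HasCompactSupport φ → tsupport φ ⊆ Ioo a b →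
      ∫ x in a..b, h x * deriv φ x = 0) :
    ∃ c : ℝ, h =ᵐ[volume.restrict (Ioo a b)] fun _ => c := by
  have hhi : IntervalIntegrable h volume a b := by
    rw [intervalIntegrable_iff_integrableOn_Ioo_of_le hab.le]; exact hh
  let ψ : ContDiffBump ((a + b) / 2) := ⟨(b - a) / 8, (b - a) / 4, by linarith, by linarith⟩
  set g := ψ.normed volume with hg
  have hgc : ContDiff ℝ (⊤ : ℕ∞) g := ψ.contDiff_normed
  have hgs : tsupport g ⊆ Ioo a b := by
    rw [hg, ψ.tsupport_normed_eq, Real.closedBall_eq_Icc]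
    intro x hx
    have h1 := hx.1; have h2 := hx.2
    simp only [ψ] at h1 h2
    exact ⟨by linarith, by linarith⟩
  have int_eq : ∀ φ : ℝ → ℝ, tsupport φ ⊆ Ioo a b → ∫ x in a..b, φ x = ∫ x, φ x := by
    intro φ hφ
    refine intervalIntegral.integral_eq_integral_of_support_subset ?_
    exact (subset_tsupport φ).trans (hφ.trans Ioo_subset_Ioc_self)
  have hg1 : ∫ x in a..b, g x = 1 := by rw [int_eq g hgs]; exact ψ.integral_normed
  set c := ∫ x in a..b, h x * g x with hc
  have hmul : ∀ φ : ℝ → ℝ, Continuous φ → IntervalIntegrable (fun x => h x * φ x) volume a b :=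
    fun φ hφ => hhi.mul_continuousOn hφ.continuousOn
  refine ⟨c, ?_⟩
  have key : ∀ φ : ℝ → ℝ, ContDiff ℝ (⊤ : ℕ∞) φ → HasCompactSupport φ → tsupport φ ⊆ Ioo a b →
      ∫ x, φ x • (h x - c) = 0 := by
    intro φ hφc hφs hφt
    -- `φ - m g` has mean zero, so its primitive `F` is a test function
    set m := ∫ x in a..b, φ x with hm
    set F : ℝ → ℝ := fun x => ∫ y in a..x, (φ y - m * g y) with hF
    have hcont : Continuous fun y => φ y - m * g y :=
      hφc.continuous.sub (continuous_const.mul hgc.continuous)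
    have hF' : ∀ x, HasDerivAt F (φ x - m * g x) x := fun x =>
      intervalIntegral.integral_hasDerivAt_right (hcont.intervalIntegrable _ _)
        (hcont.stronglyMeasurableAtFilter _ _) hcont.continuousAt
    have hdF : deriv F = fun x => φ x - m * g x := funext fun x => (hF' x).deriv
    have hFc : ContDiff ℝ (⊤ : ℕ∞) F := by
      rw [contDiff_infty_iff_deriv, hdF]
      exact ⟨fun x => (hF' x).differentiableAt, hφc.sub (contDiff_const.mul hgc)⟩
    obtain ⟨l, r, hal, hlr, hrb, hK⟩ := exists_Icc_of_isCompact
      (hφs.isCompact.union (ψ.hasCompactSupport_normed (μ := volume)).isCompact) hab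
      (union_subset hφt hgs)
    have hzero : ∀ x, x ∉ Icc l r → φ x - m * g x = 0 := by
      intro x hx
      rw [image_eq_zero_of_notMem_tsupport fun h => hx (hK (Or.inl h)),
        image_eq_zero_of_notMem_tsupport (f := g) fun h => hx (hK (Or.inr h))]
      ring
    have hFs : ∀ x, x ∉ Icc l r → F x = 0 := by
      intro x hx
      rw [mem_Icc, not_and_or, not_le, not_le] at hx
      rcases hx with hx | hx
      · rw [hF]
        refine intervalIntegral.integral_zero_ae
          (Filter.Eventually.of_forall fun y hy => hzero y ?_)
        intro hy2
        rcases hy with ⟨-, h2⟩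
        have := hy2.1
        rcases le_max_iff.1 h2 with h3 | h3 <;> linarith
      · have h1 : F b = 0 := by
          rw [hF]
          simp only
          rw [intervalIntegral.integral_sub (hφc.continuous.intervalIntegrable _ _)
            ((hgc.continuous.intervalIntegrable _ _).const_mul _),
            intervalIntegral.integral_const_mul, hg1, ← hm]
          ring
        have h2 : F b - F x = 0 := by
          rw [hF]
          simp only
          rw [intervalIntegral.integral_interval_sub_left (hcont.intervalIntegrable _ _)
            (hcont.intervalIntegrable _ _)]
          refine intervalIntegral.integral_zero_ae
            (Filter.Eventually.of_forall fun y hy => hzero y ?_)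
          intro hy2
          rcases hy with ⟨h3, -⟩
          have := hy2.2
          rcases min_lt_iff.1 h3 with h3 | h3 <;> linarith
        linarith
    have hFts : tsupport F ⊆ Icc l r := by
      refine closure_minimal (fun x hx => ?_) isClosed_Icc
      by_contra hx'
      exact hx (hFs x hx')
    have h1 := h0 F hFc (HasCompactSupport.of_support_subset_isCompact isCompact_Icc
      ((subset_tsupport F).trans hFts))
      (hFts.trans fun x hx => ⟨hal.trans_le hx.1, hx.2.trans_lt hrb⟩)
    rw [hdF] at h1
    have h2 : ∫ x, φ x • (h x - c) = ∫ x in a..b, φ x * (h x - c) := by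
      rw [intervalIntegral.integral_eq_integral_of_support_subset]
      · rfl
      · refine (Function.support_mul_subset_left _ _).trans ?_
        exact (subset_tsupport φ).trans (hφt.trans Ioo_subset_Ioc_self)
    rw [h2]
    have h3 : ∫ x in a..b, h x * (φ x - m * g x) = (∫ x in a..b, h x * φ x) - m * c := by
      rw [hc, ← intervalIntegral.integral_const_mul, ← intervalIntegral.integral_sub]
      · congr 1; ext x; ring
      · exact hmul φ hφc.continuous
      · exact (hmul g hgc.continuous).const_mul _
    have h4 : ∫ x in a..b, φ x * (h x - c) = (∫ x in a..b, h x * φ x) - m * c := by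
      rw [hm, ← intervalIntegral.integral_mul_const, ← intervalIntegral.integral_sub]
      · congr 1; ext x; ring
      · exact hmul φ hφc.continuous
      · exact (hφc.continuous.mul continuous_const).intervalIntegrable _ _
    rw [h4, ← h3, h1]
  have hloc : LocallyIntegrableOn (fun x => h x - c) (Ioo a b) volume := by
    refine IntegrableOn.locallyIntegrableOn ?_
    exact hh.sub (integrableOn_const (by simp))
  have := isOpen_Ioo.ae_eq_zero_of_integral_contDiff_smul_eq_zero hloc key
  rw [Filter.EventuallyEq, ae_restrict_iff' measurableSet_Ioo]
  filter_upwards [this] with x hx hx'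
  have := hx hx'
  linarith

/-- A function with a weak derivative is almost everywhere a primitive of it. -/
theorem IsWeakDeriv.exists_ae_eq {a b : ℝ} (hab : a < b) {f g G : ℝ → ℝ} (h : IsWeakDeriv a b f g)
    (hf : IntegrableOn f (Ioo a b)) (hG : LocallyIntegrable G)
    (hgG : g =ᵐ[volume.restrict (Ioo a b)] G) :
    ∃ c : ℝ, f =ᵐ[volume.restrict (Ioo a b)] fun x => c + ∫ s in a..x, G s := by
  have hGi : ∀ x y, IntervalIntegrable G volume x y := fun x y =>
    intervalIntegrable_iff.mpr
      ((hG.integrableOn_isCompact isCompact_uIcc).mono_set uIoc_subset_uIcc)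
  have hcont : Continuous fun x => ∫ s in a..x, G s := intervalIntegral.continuous_primitive hGi a
  obtain ⟨c, hc⟩ := exists_ae_eq_const_of_integral_deriv hab
    (h := fun x => f x - ∫ s in a..x, G s)
    (hf.sub ((hcont.integrableOn_Icc (a := a) (b := b)).mono_set Ioo_subset_Icc_self)) (by
      intro φ hφc hφs hφt
      have h1 := h φ hφc hφs hφt
      have hφd : Continuous (deriv φ) := hφc.continuous_deriv (by simp)
      have h2 := integral_deriv_mul_of_integral (φ := φ) (φ' := deriv φ)
        (W := fun x => ∫ s in a..x, G s) (z := G)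
        (fun x => (hφc.differentiable (by simp) x).hasDerivAt) hφd hG
        (fun x y => by
          rw [intervalIntegral.integral_interval_sub_left (hGi _ _) (hGi _ _)]) a b
      have hb : φ b = 0 := image_eq_zero_of_notMem_tsupport fun h => lt_irrefl _ (hφt h).2
      have h3 : ∫ x in a..b, g x * φ x = ∫ x in a..b, φ x * G x := by
        refine intervalIntegral.integral_congr_ae ?_
        rw [uIoc_of_le hab.le]
        rw [Filter.EventuallyEq, ae_restrict_iff' measurableSet_Ioo] at hgG
        filter_upwards [hgG, (measure_eq_zero_iff_ae_notMem.1 (measure_singleton b) :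
          ∀ᵐ x, x ∉ ({b} : Set ℝ))] with x hx hxb hx'
        rw [hx ⟨hx'.1, lt_of_le_of_ne hx'.2 hxb⟩]; ring
      have h4 : ∀ x, (f x - ∫ s in a..x, G s) * deriv φ x =
          f x * deriv φ x - deriv φ x * ∫ s in a..x, G s := fun x => by ring
      have hfi : IntervalIntegrable f volume a b := by
        rw [intervalIntegrable_iff_integrableOn_Ioo_of_le hab.le]; exact hf
      have hcc : Continuous fun x => deriv φ x * ∫ s in a..x, G s := hφd.mul hcont
      simp only [h4]
      rw [intervalIntegral.integral_sub (hfi.mul_continuousOn hφd.continuousOn)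
        (hcc.intervalIntegrable _ _), h1, h2, h3, hb,
        intervalIntegral.integral_same]
      ring)
  refine ⟨c, ?_⟩
  filter_upwards [hc] with x hx
  linarith

/-- `D 0, …, D (n + 1)` represent `f` and its derivatives on `[a, b]`: the first `n` of them are
differentiable, each with the next one as its derivative, `D n` is a primitive of the bounded
function `D (n + 1)`, and all of them are bounded by `m`. They are extended to the whole line, so
that derivatives and integrals need no restriction to `[a, b]`. -/
structure IsClassicalRep (a b : ℝ) (n : ℕ) (m : ℝ) (f : ℝ → ℝ) (D : ℕ → ℝ → ℝ) : Prop where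
  zero : ∀ x ∈ Icc a b, D 0 x = f x
  hasDerivAt : ∀ i < n, ∀ x, HasDerivAt (D i) (D (i + 1) x) x
  measurable_top : Measurable (D (n + 1))
  abs_top_le : ∀ x, |D (n + 1) x| ≤ m
  integral_top : ∀ x y, D n y - D n x = ∫ s in x..y, D (n + 1) s
  abs_le : ∀ i ≤ n, ∀ x ∈ Icc a b, |D i x| ≤ m

theorem locallyIntegrable_of_bound {z : ℝ → ℝ} (hz : Measurable z) {m : ℝ} (hm : ∀ x, |z x| ≤ m) :
    LocallyIntegrable z := by
  refine LocallyIntegrable.mono (locallyIntegrable_const m) hz.aestronglyMeasurable ?_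
  exact Filter.Eventually.of_forall fun x => (hm x).trans (le_abs_self m)

theorem abs_le_of_ae_abs_le {a b m : ℝ} (hab : a < b) {g : ℝ → ℝ} (hg : Continuous g)
    (h : ∀ᵐ x ∂(volume.restrict (Ioo a b)), |g x| ≤ m) : ∀ x ∈ Icc a b, |g x| ≤ m := by
  have h1 : (fun x => max |g x| m) =ᵐ[volume.restrict (Icc a b)] fun _ => m := by
    rw [Measure.restrict_congr_set Ioo_ae_eq_Icc.symm]
    filter_upwards [h] with x hx
    exact max_eq_right hx
  have h2 := Measure.eqOn_Icc_of_ae_eq volume hab.ne h1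
    (by fun_prop) continuousOn_const
  intro x hx
  exact (le_max_left _ _).trans (h2 hx).le

/-- Induction on the order: the representative of `d 0` is a primitive of that of `d 1`. -/
theorem exists_classicalRep_aux {a b : ℝ} (hab : a < b) {m : ℝ} (hm : 0 ≤ m) (n : ℕ) :
    ∀ d : ℕ → ℝ → ℝ, (∀ i ≤ n + 1, MemLp (d i) ∞ (volume.restrict (Ioo a b))) →
      (∀ i < n + 1, IsWeakDeriv a b (d i) (d (i + 1))) →
      (∀ i ≤ n + 1, eLpNorm (d i) ∞ (volume.restrict (Ioo a b)) ≤ ENNReal.ofReal m) →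
      ∃ D : ℕ → ℝ → ℝ, D 0 =ᵐ[volume.restrict (Ioo a b)] d 0 ∧
        (∀ i < n, ∀ x, HasDerivAt (D i) (D (i + 1) x) x) ∧ Measurable (D (n + 1)) ∧
        (∀ x, |D (n + 1) x| ≤ m) ∧ (∀ x y, D n y - D n x = ∫ s in x..y, D (n + 1) s) ∧
        (∀ i ≤ n, ∀ x ∈ Icc a b, |D i x| ≤ m) ∧ Continuous (D 0) := by
  have hbd : ∀ f : ℝ → ℝ, eLpNorm f ∞ (volume.restrict (Ioo a b)) ≤ ENNReal.ofReal m →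
      ∀ᵐ x ∂(volume.restrict (Ioo a b)), |f x| ≤ m := by
    intro f hf
    filter_upwards [ae_le_eLpNormEssSup (f := f) (μ := volume.restrict (Ioo a b))] with x hx
    rw [eLpNorm_exponent_top] at hf
    have h1 := hx.trans hf
    rw [← ofReal_norm, ENNReal.ofReal_le_ofReal_iff hm] at h1
    exact h1
  have hint : ∀ f : ℝ → ℝ, MemLp f ∞ (volume.restrict (Ioo a b)) → IntegrableOn f (Ioo a b) :=
    fun f hf => hf.integrable le_top
  have hcont : ∀ z : ℝ → ℝ, LocallyIntegrable z → ∀ c,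
      Continuous fun x => c + ∫ s in a..x, z s := by
    intro z hz c
    refine continuous_const.add (intervalIntegral.continuous_primitive (fun x y => ?_) a)
    exact intervalIntegrable_iff.mpr
      ((hz.integrableOn_isCompact isCompact_uIcc).mono_set uIoc_subset_uIcc)
  induction n with
  | zero =>
    intro d hd hw hb
    set g := (hd 1 le_rfl).1.mk (d 1) with hg
    have hgm : Measurable g := (hd 1 le_rfl).1.measurable_mk
    -- truncated, so that the bound holds everywhere instead of almost everywhere
    set z : ℝ → ℝ := fun x => max (-m) (min m (g x)) with hz
    have hzm : Measurable z := by fun_prop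
    have hzb : ∀ x, |z x| ≤ m := fun x =>
      abs_le.2 ⟨le_max_left _ _, max_le (by linarith) (min_le_left _ _)⟩
    have hzd : d 1 =ᵐ[volume.restrict (Ioo a b)] z := by
      filter_upwards [(hd 1 le_rfl).1.ae_eq_mk, hbd _ (hb 1 le_rfl)] with x hx hx2
      rw [abs_le] at hx2
      rw [hz]
      simp only [hg, ← hx]
      rw [min_eq_right hx2.2, max_eq_right hx2.1]
    have hzl := locallyIntegrable_of_bound hzm hzb
    have hzi : ∀ x y, IntervalIntegrable z volume x y := fun x y =>
      intervalIntegrable_iff.mpr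
        ((hzl.integrableOn_isCompact isCompact_uIcc).mono_set uIoc_subset_uIcc)
    obtain ⟨c, hc⟩ := (hw 0 (by omega)).exists_ae_eq hab (hint _ (hd 0 (by omega))) hzl hzd
    refine ⟨fun i => if i = 0 then fun x => c + ∫ s in a..x, z s else z, ?_, by simp, ?_, ?_, ?_,
      ?_, ?_⟩
    · simpa using hc.symm
    · simpa using hzm
    · simpa using hzb
    · intro x y
      simp only [if_true, zero_add, one_ne_zero, if_false]
      rw [add_sub_add_left_eq_sub, intervalIntegral.integral_interval_sub_left (hzi _ _) (hzi _ _)]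
    · intro i hi
      obtain rfl : i = 0 := by omega
      simp only [if_true]
      refine abs_le_of_ae_abs_le hab (hcont z hzl c) ?_
      filter_upwards [hc, hbd _ (hb 0 (by omega))] with x hx hx2
      rwa [← hx]
    · simpa using hcont z hzl c
  | succ n ih =>
    intro d hd hw hb
    obtain ⟨D, hD0, hDd, hDm, hDb, hDi, hDa, hDc⟩ := ih (fun i => d (i + 1))
      (fun i hi => hd _ (by omega)) (fun i hi => hw _ (by omega)) (fun i hi => hb _ (by omega))
    have hl : LocallyIntegrable (D 0) := hDc.locallyIntegrable
    obtain ⟨c, hc⟩ := (hw 0 (by omega)).exists_ae_eq hab (hint _ (hd 0 (by omega))) hl hD0.symm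
    refine ⟨fun i => Nat.casesOn i (fun x => c + ∫ s in a..x, D 0 s) D, ?_, ?_, hDm, hDb, hDi,
      ?_, ?_⟩
    · exact hc.symm
    · intro i hi x
      cases i with
      | zero =>
        exact (intervalIntegral.integral_hasDerivAt_right (hDc.intervalIntegrable _ _)
          (hDc.stronglyMeasurableAtFilter _ _) hDc.continuousAt).const_add c
      | succ i => exact hDd i (by omega) x
    · intro i hi
      cases i with
      | zero =>
        refine abs_le_of_ae_abs_le hab (hcont _ hl c) ?_
        filter_upwards [hc, hbd _ (hb 0 (by omega))] with x hx hx2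
        change |c + ∫ s in a..x, D 0 s| ≤ m
        rwa [← hx]
      | succ i => exact hDa i (by omega)
    · exact hcont _ hl c

/-- A continuous function in `W^{n+1,∞}` has a classical representation. The inequality for the norm
is strict because the norm is an infimum over all choices of weak derivatives. -/
theorem exists_isClassicalRep {a b : ℝ} (hab : a < b) {m : ℝ} (hm : 0 ≤ m) (n : ℕ) {f : ℝ → ℝ}
    (hf : ContinuousOn f (Icc a b)) (h : sobolevNorm a b (n + 1) f < ENNReal.ofReal m) :
    ∃ D, IsClassicalRep a b n m f D := by
  rw [sobolevNorm] at h
  obtain ⟨d, hd⟩ := iInf_lt_iff.1 h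
  obtain ⟨hs, hd⟩ := iInf_lt_iff.1 hd
  obtain ⟨D, h0, h1, h2, h3, h4, h5, h6⟩ := exists_classicalRep_aux hab hm n d hs.memLp
    hs.weakDeriv (fun i hi => (le_iSup₂_of_le i hi le_rfl).trans hd.le)
  refine ⟨D, ?_, h1, h2, h3, h4, h5⟩
  rw [hs.zero] at h0
  refine Measure.eqOn_Icc_of_ae_eq volume hab.ne ?_ h6.continuousOn hf
  rwa [Measure.restrict_congr_set Ioo_ae_eq_Icc.symm]

/-! ### Time regularity of the exact solution -/

theorem abs_sub_le_of_abs_deriv_le {g g' : ℝ → ℝ} {a b m : ℝ}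
    (hg : ∀ x ∈ Icc a b, HasDerivWithinAt g (g' x) (Icc a b) x) (hm : ∀ x ∈ Icc a b, |g' x| ≤ m)
    {x y : ℝ} (hx : x ∈ Icc a b) (hy : y ∈ Icc a b) : |g y - g x| ≤ m * |y - x| :=
  (convex_Icc a b).norm_image_sub_le_of_norm_hasDerivWithin_le hg hm hx hy

theorem abs_sub_sub_le_of_lipschitz {g g' : ℝ → ℝ} {a b m : ℝ} (hg : ∀ x, HasDerivAt g (g' x) x)
    (hl : ∀ x ∈ Icc a b, ∀ y ∈ Icc a b, |g' y - g' x| ≤ m * |y - x|) (hm : 0 ≤ m)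
    {x y : ℝ} (hx : x ∈ Icc a b) (hy : y ∈ Icc a b) :
    |g y - g x - (y - x) * g' x| ≤ m * (y - x) ^ 2 := by
  have hsub : uIcc x y ⊆ Icc a b := uIcc_subset_Icc hx hy
  have h := (convex_uIcc x y).norm_image_sub_le_of_norm_hasDerivWithin_le
    (f := fun z => g z - z * g' x) (f' := fun z => g' z - 1 * g' x) (C := m * |y - x|)
    (fun z _ => ((hg z).sub ((hasDerivAt_id z).mul_const _)).hasDerivWithinAt)
    (fun z hz => by
      rw [one_mul]
      refine (hl x hx z (hsub hz)).trans (mul_le_mul_of_nonneg_left ?_ hm)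
      exact abs_sub_left_of_mem_uIcc hz)
    left_mem_uIcc right_mem_uIcc
  rw [Real.norm_eq_abs, Real.norm_eq_abs] at h
  calc _ = |g y - y * g' x - (g x - x * g' x)| := by congr 1; ring
    _ ≤ m * |y - x| * |y - x| := h
    _ = _ := by rw [mul_assoc, abs_mul_abs_self]; ring

/-- Interpolation between a small function and its Lipschitz continuous derivative. -/
theorem abs_deriv_le_interpolation {g g' : ℝ → ℝ} {a b m ε d : ℝ} (hg : ∀ x, HasDerivAt g (g' x) x)
    (hl : ∀ x ∈ Icc a b, ∀ y ∈ Icc a b, |g' y - g' x| ≤ m * |y - x|) (hm : 0 ≤ m)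
    (hε : ∀ x ∈ Icc a b, |g x| ≤ ε) (hd : 0 < d) (hdab : 2 * d ≤ b - a) {x : ℝ}
    (hx : x ∈ Icc a b) : |g' x| ≤ 2 * ε / d + m * d := by
  obtain ⟨y, hy, hyx⟩ : ∃ y ∈ Icc a b, |y - x| = d := by
    rcases le_total x ((a + b) / 2) with h | h
    · exact ⟨x + d, ⟨by linarith [hx.1], by linarith⟩, by rw [add_sub_cancel_left, abs_of_pos hd]⟩
    · refine ⟨x - d, ⟨by linarith, by linarith [hx.2]⟩, ?_⟩
      rw [sub_sub_cancel_left, abs_neg, abs_of_pos hd]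
  have h1 := abs_sub_sub_le_of_lipschitz hg hl hm hx hy
  rw [← sq_abs (y - x), hyx] at h1
  have h2 := hε x hx
  have h3 := hε y hy
  have h4 : d * |g' x| ≤ 2 * ε + m * d ^ 2 := by
    rw [← hyx, ← abs_mul]
    calc |(y - x) * g' x| = |g y - g x - (g y - g x - (y - x) * g' x)| := by congr 1; ring
      _ ≤ |g y - g x| + |g y - g x - (y - x) * g' x| := abs_sub _ _
      _ ≤ |g y| + |g x| + m * d ^ 2 := add_le_add (abs_sub _ _) h1
      _ ≤ _ := by rw [hyx]; linarith
  rw [← mul_le_mul_iff_right₀ hd]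
  calc _ ≤ _ := h4
    _ = _ := by field_simp

theorem hasDerivWithinAt_of_uniform {F : ℝ → ℝ} {c : ℝ} {S : Set ℝ} {s : ℝ}
    (h : ∀ ε > 0, ∃ δ > 0, ∀ t ∈ S, |t - s| < δ → |F t - F s - (t - s) * c| ≤ ε * |t - s|) :
    HasDerivWithinAt F c S s := by
  rw [hasDerivWithinAt_iff_isLittleO, Asymptotics.isLittleO_iff]
  intro ε hε
  obtain ⟨δ, hδ, hδ'⟩ := h ε hε
  rw [eventually_nhdsWithin_iff]
  filter_upwards [Metric.ball_mem_nhds s hδ] with t ht htS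
  exact hδ' t htS ht

namespace IsClassicalRep

variable {a b : ℝ} {n : ℕ} {m : ℝ} {f : ℝ → ℝ} {D : ℕ → ℝ → ℝ}

theorem mono (h : IsClassicalRep a b n m f D) {m' : ℝ} (hm : m ≤ m') :
    IsClassicalRep a b n m' f D :=
  ⟨h.zero, h.hasDerivAt, h.measurable_top, fun x => (h.abs_top_le x).trans hm, h.integral_top,
    fun i hi x hx => (h.abs_le i hi x hx).trans hm⟩

theorem locallyIntegrable (h : IsClassicalRep a b n m f D) : LocallyIntegrable (D (n + 1)) :=
  locallyIntegrable_of_bound h.measurable_top h.abs_top_le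

theorem intervalIntegrable (h : IsClassicalRep a b n m f D) (x y : ℝ) :
    IntervalIntegrable (D (n + 1)) volume x y :=
  intervalIntegrable_iff.mpr
    ((h.locallyIntegrable.integrableOn_isCompact isCompact_uIcc).mono_set uIoc_subset_uIcc)

theorem continuous (h : IsClassicalRep a b n m f D) {i : ℕ} (hi : i ≤ n) : Continuous (D i) := by
  rcases hi.lt_or_eq with hi | rfl
  · exact continuous_iff_continuousAt.2 fun x => (h.hasDerivAt i hi x).continuousAt
  · have : D i = fun x => D i 0 + ∫ s in (0 : ℝ)..x, D (i + 1) s := by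
      ext x; rw [← h.integral_top 0 x]; ring
    rw [this]
    exact continuous_const.add (intervalIntegral.continuous_primitive h.intervalIntegrable 0)

theorem lipschitz (h : IsClassicalRep a b n m f D) {i : ℕ} (hi : i ≤ n) {x y : ℝ}
    (hx : x ∈ Icc a b) (hy : y ∈ Icc a b) : |D i y - D i x| ≤ m * |y - x| := by
  rcases hi.lt_or_eq with hi | rfl
  · exact abs_sub_le_of_abs_deriv_le (fun z _ => (h.hasDerivAt i hi z).hasDerivWithinAt)
      (fun z hz => h.abs_le (i + 1) (by omega) z hz) hx hy
  · rw [h.integral_top x y]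
    exact intervalIntegral.norm_integral_le_of_norm_le_const (f := D (i + 1))
      fun z _ => h.abs_top_le z

end IsClassicalRep

section Time

variable {T m : ℝ} {n : ℕ} {u : ℝ → ℝ → ℝ} {D : ℝ → ℕ → ℝ → ℝ}

/-- The space derivatives are continuous in time, uniformly in space. By interpolation between
`D i` and a Lipschitz bound for `D (i + 1)`, continuity passes from order `i` to order `i + 1`. -/
theorem uniform_continuous_time (hu : IsHeatSolution T u)
    (hD : ∀ s ∈ Icc 0 T, IsClassicalRep 0 (2 * Real.pi) n m (fun x => u x s) (D s)) (hm : 0 < m)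
    {i : ℕ} (hi : i ≤ n) : ∀ ε > 0, ∃ δ > 0, ∀ s ∈ Icc 0 T, ∀ t ∈ Icc 0 T, |t - s| < δ →
      ∀ x ∈ Icc 0 (2 * Real.pi), |D t i x - D s i x| ≤ ε := by
  have hpi := Real.pi_pos
  induction i with
  | zero =>
    intro ε hε
    have h := (isCompact_Icc.prod isCompact_Icc).uniformContinuousOn_of_continuous hu.continuousOn
    rw [Metric.uniformContinuousOn_iff] at h
    obtain ⟨δ, hδ, h⟩ := h ε hε
    refine ⟨δ, hδ, fun s hs t ht hst x hx => ?_⟩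
    rw [(hD t ht).zero x hx, (hD s hs).zero x hx]
    refine (h (x, t) ⟨hx, ht⟩ (x, s) ⟨hx, hs⟩ ?_).le
    rw [Prod.dist_eq, dist_self]
    simpa [Real.dist_eq, hδ] using hst
  | succ i ih =>
    intro ε hε
    -- the term `2 m d` of the interpolation inequality becomes at most `ε / 2`
    set d := min Real.pi (ε / (4 * m)) with hd
    have hd0 : 0 < d := lt_min hpi (by positivity)
    obtain ⟨δ, hδ, h⟩ := ih (by omega) (ε / 4 * d) (by positivity)
    refine ⟨δ, hδ, fun s hs t ht hst x hx => ?_⟩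
    have h1 := abs_deriv_le_interpolation (g := fun x => D t i x - D s i x)
      (g' := fun x => D t (i + 1) x - D s (i + 1) x) (m := 2 * m) (d := d)
      (fun x => ((hD t ht).hasDerivAt i (by omega) x).sub ((hD s hs).hasDerivAt i (by omega) x))
      (fun x hx y hy => by
        have h1 := (hD t ht).lipschitz hi hx hy
        have h2 := (hD s hs).lipschitz hi hx hy
        calc |(D t (i + 1) y - D s (i + 1) y - (D t (i + 1) x - D s (i + 1) x))|
            = |(D t (i + 1) y - D t (i + 1) x - (D s (i + 1) y - D s (i + 1) x))| := by
              congr 1; ring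
          _ ≤ _ := (abs_sub _ _).trans (by linarith))
      (by linarith) (h s hs t ht hst) hd0 (by
        have := min_le_left Real.pi (ε / (4 * m)); linarith) hx
    refine h1.trans ?_
    have h2 : 2 * m * d ≤ ε / 2 := by
      have := min_le_right Real.pi (ε / (4 * m))
      rw [← hd, le_div_iff₀ (by positivity)] at this
      linarith
    have h3 : 2 * (ε / 4 * d) / d = ε / 2 := by field_simp; ring
    linarith

theorem continuousOn_time (hu : IsHeatSolution T u)
    (hD : ∀ s ∈ Icc 0 T, IsClassicalRep 0 (2 * Real.pi) n m (fun x => u x s) (D s)) (hm : 0 < m)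
    {i : ℕ} (hi : i ≤ n) {x : ℝ} (hx : x ∈ Icc 0 (2 * Real.pi)) :
    ContinuousOn (fun s => D s i x) (Icc 0 T) := by
  rw [Metric.continuousOn_iff]
  intro s hs ε hε
  obtain ⟨δ, hδ, h⟩ := uniform_continuous_time hu hD hm hi (ε / 2) (by linarith)
  refine ⟨δ, hδ, fun t ht hst => ?_⟩
  rw [Real.dist_eq]
  exact (h s hs t ht hst x hx).trans_lt (by linarith)

theorem intervalIntegrable_time (hu : IsHeatSolution T u)
    (hD : ∀ s ∈ Icc 0 T, IsClassicalRep 0 (2 * Real.pi) n m (fun x => u x s) (D s)) (hm : 0 < m)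
    {i : ℕ} (hi : i ≤ n) {x : ℝ} (hx : x ∈ Icc 0 (2 * Real.pi)) {s t : ℝ} (hs : s ∈ Icc 0 T)
    (ht : t ∈ Icc 0 T) : IntervalIntegrable (fun s => D s i x) volume s t :=
  ((continuousOn_time hu hD hm hi hx).mono (uIcc_subset_Icc hs ht)).intervalIntegrable

theorem dx_eq {s : ℝ} (hD : IsClassicalRep 0 (2 * Real.pi) n m (fun x => u x s) (D s)) (hn : 1 ≤ n)
    {x : ℝ} (hx : x ∈ Icc 0 (2 * Real.pi)) : dx u x s = D s 1 x := by
  have hU := (uniqueDiffOn_Icc (by have := Real.pi_pos; linarith : (0 : ℝ) < 2 * Real.pi)) x hx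
  rw [dx]
  refine HasDerivWithinAt.derivWithin ?_ hU
  exact ((hD.hasDerivAt 0 (by omega) x).hasDerivWithinAt).congr (fun y hy => (hD.zero y hy).symm)
    (hD.zero x hx).symm

theorem iteratedDerivWithin_two_eq {s : ℝ}
    (hD : IsClassicalRep 0 (2 * Real.pi) n m (fun x => u x s) (D s)) (hn : 2 ≤ n)
    {x : ℝ} (hx : x ∈ Icc 0 (2 * Real.pi)) :
    iteratedDerivWithin 2 (fun y => u y s) (Icc 0 (2 * Real.pi)) x = D s 2 x := by
  have hU := (uniqueDiffOn_Icc (by have := Real.pi_pos; linarith : (0 : ℝ) < 2 * Real.pi)) x hx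
  rw [iteratedDerivWithin_succ]
  refine HasDerivWithinAt.derivWithin ?_ hU
  exact ((hD.hasDerivAt 1 (by omega) x).hasDerivWithinAt).congr
    (fun y hy => by rw [iteratedDerivWithin_one]; exact dx_eq hD (by omega) hy)
    (by rw [iteratedDerivWithin_one]; exact dx_eq hD (by omega) hx)

/-- The heat equation for the space derivatives of `u`, integrated in time. The mixed derivatives
of `u` are not assumed to exist, hence the integrated form. -/
theorem integral_time_eq (hu : IsHeatSolution T u)
    (hD : ∀ s ∈ Icc 0 T, IsClassicalRep 0 (2 * Real.pi) n m (fun x => u x s) (D s)) (hm : 0 < m)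
    {i : ℕ} (hi : i + 2 ≤ n) {x : ℝ} (hx : x ∈ Icc 0 (2 * Real.pi)) {s t : ℝ} (hs : s ∈ Icc 0 T)
    (ht : t ∈ Icc 0 T) : D t i x - D s i x = ∫ r in s..t, D r (i + 2) x := by
  induction i generalizing x with
  | zero =>
    wlog hst : s ≤ t generalizing s t
    · have := this ht hs (le_of_not_ge hst)
      rw [intervalIntegral.integral_symm, ← this]; ring
    refine (intervalIntegral.integral_eq_sub_of_hasDerivAt_of_le hst
      ((continuousOn_time hu hD hm (by omega) hx).mono (Icc_subset_Icc hs.1 ht.2)) ?_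
      (intervalIntegrable_time hu hD hm hi hx hs ht)).symm
    intro r hr
    have hr' : r ∈ Ioc 0 T := ⟨hs.1.trans_lt hr.1, hr.2.le.trans ht.2⟩
    have hr'' : r ∈ Icc 0 T := Ioc_subset_Icc_self hr'
    have h1 := hu.heat r hr' x hx
    rw [iteratedDerivWithin_two_eq (hD r hr'') hi hx] at h1
    have h2 : HasDerivWithinAt (fun s => D s 0 x) (D r 2 x) (Icc 0 T) r :=
      h1.congr (fun y hy => (hD y hy).zero x hx) ((hD r hr'').zero x hx)
    exact h2.hasDerivAt (Icc_mem_nhds hr'.1 (hr.2.trans_le ht.2))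
  | succ i ih =>
    -- differentiate the formula for `i` with respect to `x`
    have hU := (uniqueDiffOn_Icc (by have := Real.pi_pos; linarith : (0 : ℝ) < 2 * Real.pi)) x hx
    have h1 : HasDerivWithinAt (fun y => D t i y - D s i y) (D t (i + 1) x - D s (i + 1) x)
        (Icc 0 (2 * Real.pi)) x :=
      (((hD t ht).hasDerivAt i (by omega) x).sub
        ((hD s hs).hasDerivAt i (by omega) x)).hasDerivWithinAt
    have h2 : HasDerivWithinAt (fun y => D t i y - D s i y) (∫ r in s..t, D r (i + 1 + 2) x)
        (Icc 0 (2 * Real.pi)) x := by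
      refine hasDerivWithinAt_of_uniform fun ε hε => ?_
      refine ⟨ε / (m * (|t - s| + 1)), by positivity, fun y hy hyx => ?_⟩
      rw [ih (by omega) hy, ih (by omega) hx, ← intervalIntegral.integral_sub
        (intervalIntegrable_time hu hD hm (by omega) hy hs ht)
        (intervalIntegrable_time hu hD hm (by omega) hx hs ht),
        ← intervalIntegral.integral_const_mul, ← intervalIntegral.integral_sub
        ((intervalIntegrable_time hu hD hm (by omega) hy hs ht).sub
        (intervalIntegrable_time hu hD hm (by omega) hx hs ht))
        ((intervalIntegrable_time hu hD hm (by omega) hx hs ht).const_mul _)]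
      have h3 := intervalIntegral.norm_integral_le_of_norm_le_const (a := s) (b := t)
        (f := fun r => D r (i + 2) y - D r (i + 2) x - (y - x) * D r (i + 1 + 2) x)
        (C := m * (y - x) ^ 2) (fun r hr => by
          have hr' : r ∈ Icc 0 T := (uIcc_subset_Icc hs ht) (uIoc_subset_uIcc hr)
          exact abs_sub_sub_le_of_lipschitz (g := D r (i + 2)) (g' := D r (i + 1 + 2))
            (fun z => (hD r hr').hasDerivAt (i + 2) (by omega) z)
            (fun z hz w hw => (hD r hr').lipschitz (by omega) hz hw) hm.le hx hy)
      refine h3.trans ?_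
      rw [lt_div_iff₀ (by positivity)] at hyx
      rw [← sq_abs (y - x)]
      have h4 := abs_nonneg (y - x)
      have h5 := abs_nonneg (t - s)
      nlinarith [mul_nonneg hm.le (mul_nonneg h4 h4), mul_le_mul_of_nonneg_right hyx.le h4]
    exact hU.eq_deriv _ h1 h2

/-- The space derivatives are differentiable in time, uniformly in space. -/
theorem uniform_deriv_time (hu : IsHeatSolution T u)
    (hD : ∀ s ∈ Icc 0 T, IsClassicalRep 0 (2 * Real.pi) n m (fun x => u x s) (D s)) (hm : 0 < m)
    {i : ℕ} (hi : i + 2 ≤ n) : ∀ ε > 0, ∃ δ > 0, ∀ s ∈ Icc 0 T, ∀ t ∈ Icc 0 T, |t - s| < δ →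
      ∀ x ∈ Icc 0 (2 * Real.pi),
        |D t i x - D s i x - (t - s) * D s (i + 2) x| ≤ ε * |t - s| := by
  intro ε hε
  obtain ⟨δ, hδ, h⟩ := uniform_continuous_time hu hD hm hi ε hε
  refine ⟨δ, hδ, fun s hs t ht hst x hx => ?_⟩
  have h1 : D t i x - D s i x - (t - s) * D s (i + 2) x =
      ∫ r in s..t, (D r (i + 2) x - D s (i + 2) x) := by
    rw [intervalIntegral.integral_sub (intervalIntegrable_time hu hD hm hi hx hs ht)
      intervalIntegrable_const, ← integral_time_eq hu hD hm hi hx hs ht,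
      intervalIntegral.integral_const, smul_eq_mul]
  rw [h1]
  refine intervalIntegral.norm_integral_le_of_norm_le_const
    (f := fun r => D r (i + 2) x - D s (i + 2) x) fun r hr => ?_
  have hr' : r ∈ Icc 0 T := (uIcc_subset_Icc hs ht) (uIoc_subset_uIcc hr)
  refine h s hs r hr' ?_ x hx
  have := abs_sub_left_of_mem_uIcc (uIoc_subset_uIcc hr)
  exact this.trans_lt hst

theorem hasDerivWithinAt_time (hu : IsHeatSolution T u)
    (hD : ∀ s ∈ Icc 0 T, IsClassicalRep 0 (2 * Real.pi) n m (fun x => u x s) (D s)) (hm : 0 < m)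
    {i : ℕ} (hi : i + 2 ≤ n) {x : ℝ} (hx : x ∈ Icc 0 (2 * Real.pi)) {s : ℝ} (hs : s ∈ Icc 0 T) :
    HasDerivWithinAt (fun s => D s i x) (D s (i + 2) x) (Icc 0 T) s := by
  refine hasDerivWithinAt_of_uniform fun ε hε => ?_
  obtain ⟨δ, hδ, h⟩ := uniform_deriv_time hu hD hm hi ε hε
  exact ⟨δ, hδ, fun t ht hst => h s hs t ht hst x hx⟩

theorem hasDerivWithinAt_integral_time (hu : IsHeatSolution T u)
    (hD : ∀ s ∈ Icc 0 T, IsClassicalRep 0 (2 * Real.pi) n m (fun x => u x s) (D s)) (hm : 0 < m)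
    {i : ℕ} (hi : i + 2 ≤ n) {a b : ℝ} (ha : 0 ≤ a) (hab : a ≤ b) (hb : b ≤ 2 * Real.pi)
    {w : ℝ → ℝ} (hw : Continuous w) {s : ℝ} (hs : s ∈ Icc 0 T) :
    HasDerivWithinAt (fun s => ∫ x in a..b, D s i x * w x) (∫ x in a..b, D s (i + 2) x * w x)
      (Icc 0 T) s := by
  obtain ⟨c, hc⟩ := isCompact_Icc.exists_bound_of_continuousOn (s := Icc a b) hw.continuousOn
  have hc0 : 0 ≤ c := (norm_nonneg _).trans (hc a (left_mem_Icc.2 hab))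
  refine hasDerivWithinAt_of_uniform fun ε hε => ?_
  obtain ⟨δ, hδ, h⟩ := uniform_deriv_time hu hD hm hi (ε / (c * (b - a) + 1))
    (by have := sub_nonneg.2 hab; positivity)
  refine ⟨δ, hδ, fun t ht hst => ?_⟩
  have hI : ∀ r ∈ Icc 0 T, ∀ j ≤ n, IntervalIntegrable (fun x => D r j x * w x) volume a b :=
    fun r hr j hj => (((hD r hr).continuous hj).mul hw).intervalIntegrable a b
  rw [← intervalIntegral.integral_sub (hI t ht i (by omega)) (hI s hs i (by omega)),
    ← intervalIntegral.integral_const_mul, ← intervalIntegral.integral_sub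
    ((hI t ht i (by omega)).sub (hI s hs i (by omega))) ((hI s hs _ hi).const_mul _)]
  have h3 := intervalIntegral.norm_integral_le_of_norm_le_const (a := a) (b := b)
    (f := fun x => D t i x * w x - D s i x * w x - (t - s) * (D s (i + 2) x * w x))
    (C := ε / (c * (b - a) + 1) * |t - s| * c) (fun x hx => by
      rw [uIoc_of_le hab] at hx
      have h1 := h s hs t ht hst x ⟨ha.trans hx.1.le, hx.2.trans hb⟩
      have h2 : D t i x * w x - D s i x * w x - (t - s) * (D s (i + 2) x * w x) =
          (D t i x - D s i x - (t - s) * D s (i + 2) x) * w x := by ring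
      rw [h2, norm_mul]
      exact mul_le_mul h1 (hc x ⟨hx.1.le, hx.2⟩) (norm_nonneg _) (by
        have := sub_nonneg.2 hab; positivity))
  refine h3.trans ?_
  rw [abs_of_nonneg (sub_nonneg.2 hab)]
  have h4 : c * (b - a) ≤ c * (b - a) + 1 := by linarith
  have h5 : 0 < c * (b - a) + 1 := by have := sub_nonneg.2 hab; positivity
  calc _ = ε * |t - s| * (c * (b - a) / (c * (b - a) + 1)) := by field_simp
    _ ≤ ε * |t - s| * 1 := by
        gcongr
        exact (div_le_one h5).2 h4
    _ = _ := mul_one _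

theorem hasDerivWithinAt_radauCoeff (k : ℕ) (hu : IsHeatSolution T u)
    (hD : ∀ s ∈ Icc 0 T, IsClassicalRep 0 (2 * Real.pi) n m (fun x => u x s) (D s)) (hm : 0 < m)
    {i : ℕ} (hi : i + 2 ≤ n) {a b : ℝ} (ha : 0 ≤ a) (hab : a < b) (hb : b ≤ 2 * Real.pi)
    (fl : Flux) {s : ℝ} (hs : s ∈ Icc 0 T) :
    HasDerivWithinAt (fun s => radauCoeff k a b fl (D s i)) (radauCoeff k a b fl (D s (i + 2)))
      (Icc 0 T) s := by
  have he := endpoint_mem hab fl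
  refine HasDerivWithinAt.const_mul _ (HasDerivWithinAt.add ?_ (HasDerivWithinAt.const_mul _ ?_))
  · exact (hasDerivWithinAt_time hu hD hm hi ⟨ha.trans he.1, he.2.trans hb⟩ hs).neg
  · exact hasDerivWithinAt_integral_time hu hD hm hi ha hab.le hb (by fun_prop) hs

theorem hasDerivWithinAt_projCoeff (k : ℕ) (hu : IsHeatSolution T u)
    (hD : ∀ s ∈ Icc 0 T, IsClassicalRep 0 (2 * Real.pi) n m (fun x => u x s) (D s)) (hm : 0 < m)
    {i : ℕ} (hi : i + 2 ≤ n) {a b : ℝ} (ha : 0 ≤ a) (hab : a < b) (hb : b ≤ 2 * Real.pi)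
    (fl : Flux) (l : ℕ) {s : ℝ} (hs : s ∈ Icc 0 T) :
    HasDerivWithinAt (fun s => projCoeff k a b fl (D s i) l) (projCoeff k a b fl (D s (i + 2)) l)
      (Icc 0 T) s := by
  refine HasDerivWithinAt.sub (HasDerivWithinAt.const_mul _
    (hasDerivWithinAt_integral_time hu hD hm hi ha hab.le hb (by fun_prop) hs)) ?_
  split_ifs
  · exact hasDerivWithinAt_radauCoeff k hu hD hm hi ha hab hb fl hs
  · exact hasDerivWithinAt_const _ _ _

theorem radauCoeff_congr {k : ℕ} {a b : ℝ} (hab : a < b) (fl : Flux) {v v' : ℝ → ℝ}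
    (h : ∀ x ∈ Icc a b, v x = v' x) : radauCoeff k a b fl v = radauCoeff k a b fl v' := by
  rw [radauCoeff, radauCoeff, h _ (endpoint_mem hab fl)]
  congr 3
  refine intervalIntegral.integral_congr fun x hx => ?_
  rw [uIcc_of_le hab.le] at hx
  simp only [h x hx]

theorem iteratedDerivWithin_radauCoeff (k : ℕ) (hT : 0 < T) (hu : IsHeatSolution T u)
    (hD : ∀ s ∈ Icc 0 T, IsClassicalRep 0 (2 * Real.pi) n m (fun x => u x s) (D s)) (hm : 0 < m)
    {a b : ℝ} (ha : 0 ≤ a) (hab : a < b) (hb : b ≤ 2 * Real.pi) (fl : Flux) {F : ℝ → ℝ} {j : ℕ}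
    (hF : ∀ s ∈ Icc 0 T, F s = radauCoeff k a b fl (D s j)) (i : ℕ) (hi : j + 2 * i ≤ n) :
    ∀ s ∈ Icc 0 T, iteratedDerivWithin i F (Icc 0 T) s =
      radauCoeff k a b fl (D s (j + 2 * i)) := by
  induction i with
  | zero => simpa using hF
  | succ i ih =>
    intro s hs
    rw [iteratedDerivWithin_succ]
    refine HasDerivWithinAt.derivWithin ?_ (uniqueDiffOn_Icc hT s hs)
    exact (hasDerivWithinAt_radauCoeff k hu hD hm (i := j + 2 * i) (by omega) ha hab hb fl
      hs).congr (ih (by omega)) (ih (by omega) s hs)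

/-- The fluxes whose projection is applied to `∂_x^p u`: those of `u` for even `p` and those of `q`
for odd `p`. -/
def Flux.parity (fl : Flux) (p : ℕ) : Flux := if p % 2 = 0 then fl else fl.swap

theorem Flux.parity_add_two (fl : Flux) (p : ℕ) : fl.parity (p + 2) = fl.parity p := by
  simp [Flux.parity, Nat.add_mod_right]

/-- Since `∂_t = ∂_x²`, the correction coefficient of order `p` is the Gauss–Radau coefficient of
`∂_x^p u`. -/
theorem corrCoeff_eq (k : ℕ) (hT : 0 < T) (hu : IsHeatSolution T u)
    (hD : ∀ s ∈ Icc 0 T, IsClassicalRep 0 (2 * Real.pi) n m (fun x => u x s) (D s)) (hm : 0 < m)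
    {a b : ℝ} (ha : 0 ≤ a) (hab : a < b) (hb : b ≤ 2 * Real.pi) (fl : Flux) {p : ℕ}
    (hp : p ≤ n) {s : ℝ} (hs : s ∈ Icc 0 T) :
    corrCoeff k a b T u fl s p = radauCoeff k a b (fl.parity p) (D s p) := by
  have hG : ∀ fl' : Flux, ∀ s ∈ Icc 0 T, radauCoeff k a b fl' (fun x => u x s) =
      radauCoeff k a b fl' (D s 0) := fun fl' s hs =>
    radauCoeff_congr hab fl' fun x hx =>
      ((hD s hs).zero x ⟨ha.trans hx.1, hx.2.trans hb⟩).symm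
  have hQ : 1 ≤ n → ∀ fl' : Flux, ∀ s ∈ Icc 0 T, radauCoeff k a b fl' (fun x => dx u x s) =
      radauCoeff k a b fl' (D s 1) := fun hn fl' s hs =>
    radauCoeff_congr hab fl' fun x hx =>
      dx_eq (hD s hs) hn ⟨ha.trans hx.1, hx.2.trans hb⟩
  rw [corrCoeff, Flux.parity]
  split_ifs with h
  · have hp2 : 0 + 2 * (p / 2) = p := by omega
    cases fl
    · have := iteratedDerivWithin_radauCoeff k hT hu hD hm ha hab hb .left (j := 0)
        (F := fun s => coeffMinus k a b fun x => u x s)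
        (fun s hs => by rw [coeffMinus_eq hab]; exact hG _ s hs) (p / 2) (by omega) s hs
      rwa [hp2] at this
    · have := iteratedDerivWithin_radauCoeff k hT hu hD hm ha hab hb .right (j := 0)
        (F := fun s => coeffPlus k a b fun x => u x s)
        (fun s hs => by rw [coeffPlus_eq hab]; exact hG _ s hs) (p / 2) (by omega) s hs
      rwa [hp2] at this
  · have hp2 : 1 + 2 * (p / 2) = p := by omega
    cases fl
    · have := iteratedDerivWithin_radauCoeff k hT hu hD hm ha hab hb .right (j := 1)
        (F := fun s => coeffPlus k a b fun x => dx u x s)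
        (fun s hs => by rw [coeffPlus_eq hab]; exact hQ (by omega) _ s hs) (p / 2) (by omega) s hs
      rwa [hp2] at this
    · have := iteratedDerivWithin_radauCoeff k hT hu hD hm ha hab hb .left (j := 1)
        (F := fun s => coeffMinus k a b fun x => dx u x s)
        (fun s hs => by rw [coeffMinus_eq hab]; exact hQ (by omega) _ s hs) (p / 2) (by omega) s hs
      rwa [hp2] at this

/-- The derivative of order `n - 1` is Lipschitz continuous in time. -/
theorem abs_time_sub_le (hu : IsHeatSolution T u)
    (hD : ∀ s ∈ Icc 0 T, IsClassicalRep 0 (2 * Real.pi) n m (fun x => u x s) (D s)) (hm : 0 < m)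
    {i : ℕ} (hi : i + 2 = n) {x : ℝ} (hx : x ∈ Icc 0 (2 * Real.pi)) {s t : ℝ} (hs : s ∈ Icc 0 T)
    (ht : t ∈ Icc 0 T) : |D t (i + 1) x - D s (i + 1) x| ≤ m * |t - s| := by
  have hU := (uniqueDiffOn_Icc (by have := Real.pi_pos; linarith : (0 : ℝ) < 2 * Real.pi)) x hx
  have h1 : HasDerivWithinAt (fun y => D t i y - D s i y) (D t (i + 1) x - D s (i + 1) x)
      (Icc 0 (2 * Real.pi)) x :=
    (((hD t ht).hasDerivAt i (by omega) x).sub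
      ((hD s hs).hasDerivAt i (by omega) x)).hasDerivWithinAt
  have h2 : ∀ y ∈ Icc 0 (2 * Real.pi),
      ‖(D t i y - D s i y) - (D t i x - D s i x)‖ ≤ m * |t - s| * ‖y - x‖ := by
    intro y hy
    rw [integral_time_eq hu hD hm hi.le hy hs ht, integral_time_eq hu hD hm hi.le hx hs ht,
      ← intervalIntegral.integral_sub (intervalIntegrable_time hu hD hm hi.le hy hs ht)
      (intervalIntegrable_time hu hD hm hi.le hx hs ht)]
    refine (intervalIntegral.norm_integral_le_of_norm_le_const
      (C := m * |y - x|) fun r hr => ?_).trans_eq (by rw [Real.norm_eq_abs]; ring)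
    have hr' : r ∈ Icc 0 T := (uIcc_subset_Icc hs ht) (uIoc_subset_uIcc hr)
    exact (hD r hr').lipschitz hi.le hx hy
  rw [hasDerivWithinAt_iff_tendsto_slope] at h1
  have hne : (nhdsWithin x (Icc 0 (2 * Real.pi) \ {x})).NeBot := by
    have := uniqueDiffWithinAt_iff_accPt.1 hU
    rwa [accPt_principal_iff_nhdsWithin] at this
  refine le_of_tendsto h1.norm ?_
  filter_upwards [self_mem_nhdsWithin] with y hy
  have hyx : 0 < ‖y - x‖ := norm_pos_iff.2 (sub_ne_zero.2 hy.2)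
  rw [slope_def_field, norm_div, div_le_iff₀ hyx]
  exact h2 y hy.1

end Time

/-! ### Time modulus of the highest derivative -/

/-- The sine coefficients on `[0, 2π]`. -/
def sineCoeff (f : ℝ → ℝ) (q : ℕ) : ℝ := ∫ x in (0 : ℝ)..2 * Real.pi, f x * Real.sin (q / 2 * x)

theorem intervalIntegrable_of_bound {f : ℝ → ℝ} (hf : Measurable f) {m : ℝ} (hm : ∀ x, |f x| ≤ m)
    (a b : ℝ) : IntervalIntegrable f volume a b :=
  intervalIntegrable_iff.mpr (((locallyIntegrable_of_bound hf hm).integrableOn_isCompact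
    isCompact_uIcc).mono_set uIoc_subset_uIcc)

/-- Parseval's identity for the sine system on `[0, 2π]`, from the odd extension. -/
theorem hasSum_sineCoeff_sq {f : ℝ → ℝ} (hf : Measurable f) {m : ℝ} (hm : ∀ x, |f x| ≤ m) :
    HasSum (fun q : ℕ => sineCoeff f q ^ 2) (Real.pi * ∫ x in (0 : ℝ)..2 * Real.pi, f x ^ 2) := by
  have hpi := Real.pi_pos
  -- the Fourier coefficients of the odd extension are multiples of the sine coefficients
  set F : ℝ → ℝ := fun x => if 0 ≤ x then f x else -f (-x) with hF
  have hFm : Measurable F :=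
    Measurable.ite measurableSet_Ici hf (hf.comp measurable_neg).neg
  have hFb : ∀ x, |F x| ≤ m := by
    intro x
    simp only [hF]
    split_ifs
    · exact hm x
    · rw [abs_neg]; exact hm _
  have hab : -(2 * Real.pi) < 2 * Real.pi := by linarith
  have hL2 : MemLp (fun x => (F x : ℂ)) 2
      (volume.restrict (Ioc (-(2 * Real.pi)) (2 * Real.pi))) := by
    refine MemLp.of_bound (C := m) ?_ (Filter.Eventually.of_forall fun x => ?_)
    · exact (Complex.measurable_ofReal.comp hFm).aestronglyMeasurable
    · rw [Complex.norm_real]; exact hFb x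
  have hP := hasSum_sq_fourierCoeffOn hab hL2
  have hsym : ∀ w : ℝ → ℂ, IntervalIntegrable w volume (-(2 * Real.pi)) (2 * Real.pi) →
      ∫ x in (-(2 * Real.pi))..(2 * Real.pi), w x =
      ∫ x in (0 : ℝ)..2 * Real.pi, (w x + w (-x)) := by
    intro w h
    have h1 : IntervalIntegrable w volume (-(2 * Real.pi)) 0 :=
      h.mono_set (by rw [uIcc_of_le hab.le, uIcc_of_le (by linarith)]; gcongr; linarith)
    have h2 : IntervalIntegrable w volume 0 (2 * Real.pi) :=
      h.mono_set (by rw [uIcc_of_le hab.le, uIcc_of_le (by linarith)]; gcongr; linarith)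
    have h3 : IntervalIntegrable (fun x => w (-x)) volume 0 (2 * Real.pi) := by
      have := ((IntervalIntegrable.iff_comp_neg (f := w)).1 h1).symm
      simpa using this
    rw [← intervalIntegral.integral_add_adjacent_intervals h1 h2,
      intervalIntegral.integral_add h2 h3, intervalIntegral.integral_comp_neg (fun x => w x)]
    simp [add_comm]
  have hFi : ∀ a b, IntervalIntegrable (fun x => (F x : ℂ)) volume a b := fun a b =>
    ⟨(intervalIntegrable_of_bound hFm hFb a b).1.ofReal,
      (intervalIntegrable_of_bound hFm hFb a b).2.ofReal⟩
  have hcongr : ∀ w w' : ℝ → ℂ, (∀ x, 0 < x → w x = w' x) →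
      ∫ x in (0 : ℝ)..2 * Real.pi, w x = ∫ x in (0 : ℝ)..2 * Real.pi, w' x := by
    intro w w' h
    refine intervalIntegral.integral_congr_ae (Filter.Eventually.of_forall fun x hx => h x ?_)
    rw [uIoc_of_le (by linarith)] at hx
    exact hx.1
  have hFpos : ∀ x, 0 < x → F x = f x := fun x hx => by simp only [hF]; rw [if_pos hx.le]
  have hFneg : ∀ x, 0 < x → F (-x) = -f x := fun x hx => by
    simp only [hF]; rw [if_neg (by linarith), neg_neg]
  have hcoef : ∀ q : ℤ, ‖fourierCoeffOn hab (fun x => (F x : ℂ)) q‖ ^ 2 =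
      (∫ x in (0 : ℝ)..2 * Real.pi, f x * Real.sin (q / 2 * x)) ^ 2 / (4 * Real.pi ^ 2) := by
    intro q
    have hfou : ∀ x : ℝ, (fourier (-q) (x : AddCircle (2 * Real.pi - -(2 * Real.pi))) : ℂ) =
        Complex.exp (-((q / 2 * x : ℝ) : ℂ) * Complex.I) := by
      intro x
      rw [fourier_coe_apply]
      congr 1
      have : (Real.pi : ℂ) ≠ 0 := by exact_mod_cast hpi.ne'
      push_cast
      field_simp
      ring
    have hc : Continuous fun x : ℝ => Complex.exp (-((q / 2 * x : ℝ) : ℂ) * Complex.I) := by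
      fun_prop
    have h1 : fourierCoeffOn hab (fun x => (F x : ℂ)) q =
        (1 / (4 * Real.pi)) • (((-2 : ℂ) * Complex.I) *
          ((∫ x in (0 : ℝ)..2 * Real.pi, f x * Real.sin (q / 2 * x) : ℝ) : ℂ)) := by
      rw [fourierCoeffOn_eq_integral]
      simp only [hfou, smul_eq_mul]
      rw [hsym _ ((hFi _ _).continuousOn_mul hc.continuousOn)]
      congr 1
      · congr 1; ring
      rw [← intervalIntegral.integral_ofReal, ← intervalIntegral.integral_const_mul]
      refine hcongr _ _ fun x hx => ?_
      rw [hFpos x hx, hFneg x hx]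
      have e1 : -((q / 2 * -x : ℝ) : ℂ) * Complex.I = ((q / 2 * x : ℝ) : ℂ) * Complex.I := by
        push_cast; ring
      rw [e1]
      push_cast
      rw [Complex.sin]
      have e2 : (2 : ℂ) ≠ 0 := two_ne_zero
      field_simp
      rw [Complex.I_sq]
      ring
    rw [h1, norm_smul, norm_mul, norm_mul, Complex.norm_I, Complex.norm_real, Real.norm_eq_abs,
      Real.norm_eq_abs, mul_pow, mul_pow, mul_pow, sq_abs, sq_abs]
    norm_num
    field_simp
  have hnorm : ∫ x in (-(2 * Real.pi))..(2 * Real.pi), ‖(F x : ℂ)‖ ^ 2 =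
      2 * ∫ x in (0 : ℝ)..2 * Real.pi, f x ^ 2 := by
    have h := hsym (fun x => ((F x ^ 2 : ℝ) : ℂ)) (by
      have := intervalIntegrable_of_bound (hFm.pow_const 2) (m := m ^ 2) (fun x => by
        rw [abs_pow]; exact pow_le_pow_left₀ (abs_nonneg _) (hFb x) 2)
        (-(2 * Real.pi)) (2 * Real.pi)
      exact ⟨this.1.ofReal, this.2.ofReal⟩)
    rw [hcongr _ (fun x => ((2 * f x ^ 2 : ℝ) : ℂ)) fun x hx => by
      rw [hFpos x hx, hFneg x hx]; push_cast; ring, intervalIntegral.integral_ofReal,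
      intervalIntegral.integral_ofReal, intervalIntegral.integral_const_mul] at h
    simp only [Complex.norm_real, Real.norm_eq_abs, sq_abs]
    exact_mod_cast h
  rw [hnorm] at hP
  simp only [hcoef] at hP
  have h2 := (hP.mul_right (4 * Real.pi ^ 2)).nat_add_neg
  have h3 := h2.mul_right (1 / 2)
  convert h3 using 1
  · rfl
  · funext q
    have e : ∀ x : ℝ, f x * Real.sin ((-(q : ℝ)) / 2 * x) = -(f x * Real.sin (q / 2 * x)) := by
      intro x
      rw [neg_div, neg_mul, Real.sin_neg, mul_neg]
    simp only [Int.cast_natCast, Int.cast_neg, e, intervalIntegral.integral_neg, sineCoeff]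
    field_simp
    ring
  · simp only [Int.cast_zero, zero_div, zero_mul, Real.sin_zero, mul_zero,
      intervalIntegral.integral_zero, smul_eq_mul]
    field_simp
    ring

/-- The mild form of `c' = g' - l c` for `c = a' = g - l a`, when `g` is merely Lipschitz
continuous. -/
theorem abs_linear_ode_le {a g : ℝ → ℝ} {l K s t T : ℝ} (hl : 0 < l) (hs : 0 ≤ s)
    (hst : s ≤ t) (htT : t ≤ T)
    (ha : ∀ r ∈ Icc 0 T, HasDerivWithinAt a (g r - l * a r) (Icc 0 T) r)
    (hg : ∀ r ∈ Icc 0 T, ∀ r' ∈ Icc 0 T, |g r - g r'| ≤ K * |r - r'|) :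
    |(g t - l * a t) - Real.exp (-(l * (t - s))) * (g s - l * a s)| ≤
      K * ((1 - Real.exp (-(l * (t - s)))) / l) := by
  have hsub : Icc s t ⊆ Icc 0 T := Icc_subset_Icc hs htT
  have hmem : ∀ r ∈ Ioo s t, r ∈ Icc 0 T := fun r hr => hsub ⟨hr.1.le, hr.2.le⟩
  have htm : t ∈ Icc 0 T := hsub ⟨hst, le_rfl⟩
  have hexp : ∀ r, HasDerivAt (fun r => Real.exp (-(l * (t - r))))
      (l * Real.exp (-(l * (t - r)))) r := by
    intro r
    have h1 : HasDerivAt (fun r => -(l * (t - r))) l r := by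
      exact (((hasDerivAt_id r).const_sub t).const_mul l).fun_neg.congr_deriv (by simp)
    exact h1.exp.congr_deriv (by ring)
  have hlin : ∀ r, HasDerivAt (fun r => t - r + 1 / l) (-1 : ℝ) r := by
    intro r
    exact ((hasDerivAt_id r).const_sub t).add_const (1 / l)
  have h := abs_sub_le_of_hasDerivAt (F := fun r => Real.exp (-(l * (t - r))) * (g t - l * a r))
    (G := fun r => K * (Real.exp (-(l * (t - r))) * (t - r + 1 / l)))
    (f := fun r => l * Real.exp (-(l * (t - r))) * (g t - g r))
    (g := fun r => l * Real.exp (-(l * (t - r))) * (K * (t - r))) hst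
    (ContinuousOn.mul (by fun_prop) (continuousOn_const.sub (continuousOn_const.mul
      fun r hr => ((ha r (hsub hr)).continuousWithinAt).mono hsub)))
    (by fun_prop)
    (fun r hr => by
      have h1 : HasDerivAt a (g r - l * a r) r := (ha r (hmem r hr)).hasDerivAt
        (Icc_mem_nhds (hs.trans_lt hr.1) (hr.2.trans_le htT))
      refine ((hexp r).mul ((h1.const_mul l).const_sub (g t))).congr_deriv ?_
      ring)
    (fun r hr => by
      refine (((hexp r).mul (hlin r)).const_mul K).congr_deriv ?_
      field_simp
      ring)
    (fun r hr => by
      rw [abs_mul, abs_of_pos (by positivity)]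
      have := hg t htm r (hmem r hr)
      rw [abs_of_pos (sub_pos.2 hr.2)] at this
      gcongr)
  have h2 := hg t htm s (hsub ⟨le_rfl, hst⟩)
  rw [abs_of_nonneg (sub_nonneg.2 hst)] at h2
  simp only [sub_self, mul_zero, neg_zero, Real.exp_zero, one_mul, zero_add] at h
  set E := Real.exp (-(l * (t - s))) with hE
  have hE0 : 0 < E := Real.exp_pos _
  calc |(g t - l * a t) - E * (g s - l * a s)|
      = |((g t - l * a t) - E * (g t - l * a s)) + E * (g t - g s)| := by congr 1; ring
    _ ≤ |(g t - l * a t) - E * (g t - l * a s)| + |E * (g t - g s)| := abs_add_le _ _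
    _ ≤ (K * (1 / l) - K * (E * (t - s + 1 / l))) + E * (K * (t - s)) := by
        refine add_le_add h ?_
        rw [abs_mul, abs_of_pos hE0]
        gcongr
    _ = _ := by field_simp; ring

/-- The Cauchy–Schwarz inequality. -/
theorem sq_integral_mul_le {f g : ℝ → ℝ} {a b : ℝ} (hab : a ≤ b)
    (hf : IntervalIntegrable (fun x => f x ^ 2) volume a b)
    (hg : IntervalIntegrable (fun x => g x ^ 2) volume a b)
    (hfg : IntervalIntegrable (fun x => f x * g x) volume a b) :
    (∫ x in a..b, f x * g x) ^ 2 ≤ (∫ x in a..b, f x ^ 2) * ∫ x in a..b, g x ^ 2 := by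
  have h : ∀ r : ℝ, 0 ≤ (∫ x in a..b, f x ^ 2) * (r * r) + (2 * ∫ x in a..b, f x * g x) * r +
      ∫ x in a..b, g x ^ 2 := by
    intro r
    have h0 : 0 ≤ ∫ x in a..b, (r * f x + g x) ^ 2 :=
      intervalIntegral.integral_nonneg hab fun x _ => sq_nonneg _
    have e : ∀ x, (r * f x + g x) ^ 2 = r * r * f x ^ 2 + 2 * r * (f x * g x) + g x ^ 2 :=
      fun x => by ring
    simp only [e] at h0
    rw [intervalIntegral.integral_add ((hf.const_mul _).add (hfg.const_mul _)) hg,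
      intervalIntegral.integral_add (hf.const_mul _) (hfg.const_mul _),
      intervalIntegral.integral_const_mul, intervalIntegral.integral_const_mul] at h0
    linarith
  have := discrim_le_zero h
  rw [discrim] at this
  nlinarith

/-- Two integrations by parts: the sine coefficient of a second derivative. -/
theorem sineCoeff_second_deriv {F F' z : ℝ → ℝ} (hF : ∀ x, HasDerivAt F (F' x) x)
    (hF' : Continuous F') (hz : LocallyIntegrable z)
    (hzF : ∀ x y, F' y - F' x = ∫ s in x..y, z s) (q : ℕ) :
    sineCoeff z q = (q / 2) * (F 0 - (-1) ^ q * F (2 * Real.pi)) -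
      (q : ℝ) ^ 2 / 4 * sineCoeff F q := by
  have hlin : ∀ x : ℝ, HasDerivAt (fun x => (q : ℝ) / 2 * x) (q / 2) x := fun x => by
    simpa using (hasDerivAt_id x).const_mul ((q : ℝ) / 2)
  have h1 := integral_deriv_mul_of_integral (φ := fun x => Real.sin (q / 2 * x))
    (φ' := fun x => Real.cos (q / 2 * x) * (q / 2)) (fun x => (hlin x).sin) (by fun_prop) hz hzF
    0 (2 * Real.pi)
  have h2 := integral_deriv_mul_of_integral (φ := fun x => Real.cos (q / 2 * x))
    (φ' := fun x => -Real.sin (q / 2 * x) * (q / 2)) (fun x => (hlin x).cos) (by fun_prop)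
    hF'.locallyIntegrable (W := F) (fun x y =>
      (intervalIntegral.integral_eq_sub_of_hasDerivAt (fun s _ => hF s)
        (hF'.intervalIntegrable x y)).symm) 0 (2 * Real.pi)
  have e : (q : ℝ) / 2 * (2 * Real.pi) = q * Real.pi := by ring
  simp only [e, mul_zero, Real.sin_zero, Real.cos_zero, Real.sin_nat_mul_pi, Real.cos_nat_mul_pi,
    zero_mul, one_mul, sub_zero, zero_sub] at h1 h2
  have e1 : ∫ x in (0 : ℝ)..2 * Real.pi, Real.cos (q / 2 * x) * (q / 2) * F' x =
      (q / 2) * ∫ x in (0 : ℝ)..2 * Real.pi, Real.cos (q / 2 * x) * F' x := by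
    rw [← intervalIntegral.integral_const_mul]; congr 1; ext x; ring
  have e2 : ∫ x in (0 : ℝ)..2 * Real.pi, -Real.sin (q / 2 * x) * (q / 2) * F x =
      -(q / 2) * sineCoeff F q := by
    rw [sineCoeff, ← intervalIntegral.integral_const_mul]; congr 1; ext x; ring
  have e3 : sineCoeff z q = ∫ x in (0 : ℝ)..2 * Real.pi, Real.sin (q / 2 * x) * z x := by
    rw [sineCoeff]; congr 1; ext x; ring
  rw [e1] at h1
  rw [e2] at h2
  rw [e3]
  linear_combination h1 - (q / 2 : ℝ) * h2

theorem sineCoeff_sub {f g : ℝ → ℝ} (hf : IntervalIntegrable f volume 0 (2 * Real.pi))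
    (hg : IntervalIntegrable g volume 0 (2 * Real.pi)) (q : ℕ) :
    sineCoeff (fun x => f x - g x) q = sineCoeff f q - sineCoeff g q := by
  simp only [sineCoeff, sub_mul]
  exact intervalIntegral.integral_sub (hf.mul_continuousOn (by fun_prop))
    (hg.mul_continuousOn (by fun_prop))

section Modulus

variable {T m : ℝ} {u : ℝ → ℝ → ℝ} {D : ℝ → ℕ → ℝ → ℝ} {i : ℕ}

theorem IsClassicalRep.sineCoeff_top {a b : ℝ} {f : ℝ → ℝ} {D : ℕ → ℝ → ℝ}
    (h : IsClassicalRep a b (i + 1) m f D) (q : ℕ) :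
    sineCoeff (D (i + 2)) q = (q / 2) * (D i 0 - (-1) ^ q * D i (2 * Real.pi)) -
      (q : ℝ) ^ 2 / 4 * sineCoeff (D i) q :=
  sineCoeff_second_deriv (h.hasDerivAt i (by omega)) (h.continuous le_rfl) h.locallyIntegrable
    h.integral_top q

theorem IsClassicalRep.sineCoeff_second {a b : ℝ} {n j : ℕ} {f : ℝ → ℝ} {D : ℕ → ℝ → ℝ}
    (h : IsClassicalRep a b n m f D) (hj : j + 2 ≤ n) (q : ℕ) :
    sineCoeff (D (j + 2)) q = (q / 2) * (D j 0 - (-1) ^ q * D j (2 * Real.pi)) -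
      (q : ℝ) ^ 2 / 4 * sineCoeff (D j) q :=
  sineCoeff_second_deriv (h.hasDerivAt j (by omega)) (h.continuous (by omega))
    (h.continuous hj).locallyIntegrable (fun x y =>
      (intervalIntegral.integral_eq_sub_of_hasDerivAt (fun s _ => h.hasDerivAt (j + 1) (by omega) s)
        ((h.continuous hj).intervalIntegrable x y)).symm) q

/-- The sine coefficients `c` of the highest derivative satisfy `c' = g' - (q²/4) c` in the mild
sense, where `g` collects the boundary values and is Lipschitz in time. -/
theorem abs_sineCoeff_sub_exp_le (hu : IsHeatSolution T u)
    (hD : ∀ s ∈ Icc 0 T, IsClassicalRep 0 (2 * Real.pi) (i + 3) m (fun x => u x s) (D s))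
    (hm : 0 < m) {q : ℕ} (hq : 1 ≤ q) {s t : ℝ} (hs : 0 ≤ s) (hst : s ≤ t) (htT : t ≤ T) :
    |sineCoeff (D t (i + 4)) q -
        Real.exp (-((q : ℝ) ^ 2 / 4 * (t - s))) * sineCoeff (D s (i + 4)) q| ≤
      4 * m / q * (1 - Real.exp (-((q : ℝ) ^ 2 / 4 * (t - s)))) := by
  have hq0 : (0 : ℝ) < q := by exact_mod_cast hq
  have h0 : (0 : ℝ) ∈ Icc 0 (2 * Real.pi) := ⟨le_rfl, by positivity⟩
  have h2 : 2 * Real.pi ∈ Icc 0 (2 * Real.pi) := ⟨by positivity, le_rfl⟩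
  set g : ℝ → ℝ := fun r => (q / 2) * (D r (i + 2) 0 - (-1) ^ q * D r (i + 2) (2 * Real.pi)) with hg
  have hc : ∀ r ∈ Icc 0 T, sineCoeff (D r (i + 4)) q =
      g r - (q : ℝ) ^ 2 / 4 * sineCoeff (D r (i + 2)) q := fun r hr => (hD r hr).sineCoeff_top q
  have key := abs_linear_ode_le (a := fun r => sineCoeff (D r (i + 2)) q) (g := g)
    (l := (q : ℝ) ^ 2 / 4) (K := q * m) (T := T) (by positivity) hs hst htT
    (fun r hr => by
      have e1 : ∀ r ∈ Icc 0 T, sineCoeff (D r (i + 2)) q =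
          (q / 2) * (D r i 0 - (-1) ^ q * D r i (2 * Real.pi)) -
          (q : ℝ) ^ 2 / 4 * sineCoeff (D r i) q := fun r hr =>
        (hD r hr).sineCoeff_second (by omega) q
      refine HasDerivWithinAt.congr ?_ e1 (e1 r hr)
      exact (((hasDerivWithinAt_time hu hD hm (by omega) h0 hr).sub
        ((hasDerivWithinAt_time hu hD hm (by omega) h2 hr).const_mul _)).const_mul _).sub
        ((hasDerivWithinAt_integral_time hu hD hm (by omega) le_rfl h2.1 le_rfl
          (by fun_prop) hr).const_mul _))
    (fun r hr r' hr' => by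
      have e1 := abs_time_sub_le (i := i + 1) hu hD hm rfl h0 hr' hr
      have e2 := abs_time_sub_le (i := i + 1) hu hD hm rfl h2 hr' hr
      have e3 : g r - g r' = (q / 2) * ((D r (i + 2) 0 - D r' (i + 2) 0) -
          (-1) ^ q * (D r (i + 2) (2 * Real.pi) - D r' (i + 2) (2 * Real.pi))) := by
        simp only [hg]; ring
      rw [e3, abs_mul, abs_of_pos (by positivity)]
      have e4 : |(D r (i + 2) 0 - D r' (i + 2) 0) -
          (-1) ^ q * (D r (i + 2) (2 * Real.pi) - D r' (i + 2) (2 * Real.pi))| ≤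
          m * |r - r'| + m * |r - r'| := by
        refine (abs_sub _ _).trans (add_le_add e1 ?_)
        rw [abs_mul, abs_pow, abs_neg, abs_one, one_pow, one_mul]
        exact e2
      calc (q : ℝ) / 2 * _ ≤ (q : ℝ) / 2 * (m * |r - r'| + m * |r - r'|) := by gcongr
        _ = _ := by ring)
  rw [← hc t ⟨hs.trans hst, htT⟩, ← hc s ⟨hs, hst.trans htT⟩] at key
  refine key.trans (le_of_eq ?_)
  field_simp

theorem one_sub_exp_mem {y : ℝ} (hy : 0 ≤ y) : 0 ≤ 1 - Real.exp (-y) ∧ 1 - Real.exp (-y) ≤ 1 ∧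
    1 - Real.exp (-y) ≤ y := by
  refine ⟨?_, ?_, ?_⟩
  · linarith [Real.exp_le_one_iff.2 (neg_nonpos.2 hy)]
  · linarith [Real.exp_pos (-y)]
  · linarith [Real.add_one_le_exp (-y)]

/-- The increment of a sine coefficient in time. The first term on the right comes from the initial
value and is summable by Bessel's inequality, the second one from the boundary values. -/
theorem sq_sineCoeff_sub_le (hu : IsHeatSolution T u)
    (hD : ∀ s ∈ Icc 0 T, IsClassicalRep 0 (2 * Real.pi) (i + 3) m (fun x => u x s) (D s))
    (hm : 0 < m) (q : ℕ) {s t : ℝ} (hs : 0 ≤ s) (hst : s < t) (htT : t ≤ T) :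
    (sineCoeff (D t (i + 4)) q - sineCoeff (D s (i + 4)) q) ^ 2 ≤
      4 * ((t - s) / t) * sineCoeff (D 0 (i + 4)) q ^ 2 +
      128 * m ^ 2 * (t - s) ^ (1 / 4 : ℝ) * ((q : ℝ) ^ (3 / 2 : ℝ))⁻¹ := by
  have ht0 : 0 < t := hs.trans_lt hst
  have hτ : 0 < t - s := sub_pos.2 hst
  rcases Nat.eq_zero_or_pos q with rfl | hq
  · have e : ∀ f, sineCoeff f 0 = 0 := fun f => by simp [sineCoeff]
    simp [e]
  have hq0 : (0 : ℝ) < q := by exact_mod_cast hq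
  set l : ℝ := (q : ℝ) ^ 2 / 4 with hl
  have hl0 : 0 < l := by positivity
  have h1 := abs_sineCoeff_sub_exp_le hu hD hm hq hs hst.le htT
  have h2 := abs_sineCoeff_sub_exp_le hu hD hm hq le_rfl hs (hst.le.trans htT)
  rw [← hl, sub_zero] at h2
  rw [← hl] at h1
  set c := fun r => sineCoeff (D r (i + 4)) q with hc
  change |c t - _ * c s| ≤ _ at h1
  change |c s - _ * c 0| ≤ _ at h2
  change (c t - c s) ^ 2 ≤ _ * _ * c 0 ^ 2 + _
  obtain ⟨w0, w1, w2⟩ := one_sub_exp_mem (mul_nonneg hl0.le hτ.le)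
  obtain ⟨v0, v1, -⟩ := one_sub_exp_mem (mul_nonneg hl0.le hs)
  have hE : 0 < Real.exp (-(l * s)) := Real.exp_pos _
  have hE2 : l * s * Real.exp (-(l * s)) ≤ 1 := by
    have h := Real.add_one_le_exp (l * s)
    rw [Real.exp_neg, ← div_eq_mul_inv, div_le_one (Real.exp_pos _)]
    linarith
  set w := 1 - Real.exp (-(l * (t - s))) with hw
  set E := Real.exp (-(l * s)) with hEd
  have hE1 : E ≤ 1 := by linarith
  have hqm : 0 ≤ 4 * m / q := by positivity
  -- the solution operator contributes `w * E`, bounded by `2 (t - s) / t`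
  have hwE : w * E ≤ 2 * ((t - s) / t) := by
    rw [← mul_div_assoc, le_div_iff₀ ht0]
    have e1 : w * E * s ≤ t - s := by
      calc w * E * s ≤ l * (t - s) * E * s := by gcongr
        _ = (t - s) * (l * s * E) := by ring
        _ ≤ (t - s) * 1 := by gcongr
        _ = t - s := mul_one _
    have e2 : w * E * (t - s) ≤ t - s := by
      have : w * E ≤ 1 := mul_le_one₀ w1 hE.le hE1
      nlinarith
    nlinarith
  have hwE0 : 0 ≤ w * E := by positivity
  have hwE1 : w * E ≤ 1 := mul_le_one₀ w1 hE.le hE1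
  have h3 : |c t - c s| ≤ w * E * |c 0| + 8 * m / q * w := by
    have e : c t - c s = (c t - (1 - w) * c s) - w * (c s - E * c 0) - w * E * c 0 := by ring
    have e1 : |c t - (1 - w) * c s| ≤ 4 * m / q * w := by
      rw [show (1 - w) = Real.exp (-(l * (t - s))) by rw [hw]; ring]; exact h1
    have e2 : |w * (c s - E * c 0)| ≤ w * (4 * m / q) := by
      rw [abs_mul, abs_of_nonneg w0]
      gcongr
      exact h2.trans (mul_le_of_le_one_right hqm v1)
    have e3 : |w * E * c 0| = w * E * |c 0| := by rw [abs_mul, abs_of_nonneg hwE0]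
    rw [e]
    refine (abs_sub _ _).trans ?_
    rw [e3]
    have := abs_sub (c t - (1 - w) * c s) (w * (c s - E * c 0))
    calc _ ≤ (4 * m / q * w + w * (4 * m / q)) + w * E * |c 0| := by linarith
      _ = _ := by ring
  have h4 : (8 * m / q * w) ^ 2 ≤
      64 * m ^ 2 * (t - s) ^ (1 / 4 : ℝ) * ((q : ℝ) ^ (3 / 2 : ℝ))⁻¹ := by
    -- the exponent `1 / 4` leaves `q ^ (-3 / 2)` after division by `q ^ 2`, which is summable
    have e1 : w ^ 2 ≤ (l * (t - s)) ^ (1 / 4 : ℝ) := by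
      calc w ^ 2 ≤ w ^ (1 / 4 : ℝ) := by
            rw [← Real.rpow_natCast]
            rcases w0.eq_or_lt with h | h
            · rw [← h, Real.zero_rpow (by norm_num), Real.zero_rpow (by norm_num)]
            · exact Real.rpow_le_rpow_of_exponent_ge h w1 (by norm_num)
        _ ≤ _ := Real.rpow_le_rpow w0 w2 (by norm_num)
    have e2 : (l * (t - s)) ^ (1 / 4 : ℝ) ≤ (q : ℝ) ^ (1 / 2 : ℝ) * (t - s) ^ (1 / 4 : ℝ) := by
      rw [Real.mul_rpow hl0.le hτ.le]
      gcongr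
      calc l ^ (1 / 4 : ℝ) ≤ ((q : ℝ) ^ (2 : ℝ)) ^ (1 / 4 : ℝ) := by
            refine Real.rpow_le_rpow hl0.le ?_ (by norm_num)
            rw [hl, Real.rpow_two]
            nlinarith [sq_nonneg (q : ℝ)]
        _ = (q : ℝ) ^ (1 / 2 : ℝ) := by rw [← Real.rpow_mul hq0.le]; norm_num
    have e3 : (q : ℝ) ^ (1 / 2 : ℝ) / (q : ℝ) ^ 2 = ((q : ℝ) ^ (3 / 2 : ℝ))⁻¹ := by
      rw [← Real.rpow_natCast, ← Real.rpow_sub hq0, ← Real.rpow_neg hq0.le]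
      norm_num
    calc (8 * m / q * w) ^ 2 = 64 * m ^ 2 / q ^ 2 * w ^ 2 := by ring
      _ ≤ 64 * m ^ 2 / q ^ 2 * ((q : ℝ) ^ (1 / 2 : ℝ) * (t - s) ^ (1 / 4 : ℝ)) := by
          gcongr
          exact e1.trans e2
      _ = 64 * m ^ 2 * (t - s) ^ (1 / 4 : ℝ) * ((q : ℝ) ^ (1 / 2 : ℝ) / (q : ℝ) ^ 2) := by ring
      _ = _ := by rw [e3]
  have h5 : (w * E * |c 0|) ^ 2 ≤ 2 * ((t - s) / t) * c 0 ^ 2 := by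
    rw [mul_pow, sq_abs]
    gcongr
    nlinarith
  calc (c t - c s) ^ 2 = |c t - c s| ^ 2 := (sq_abs _).symm
    _ ≤ (w * E * |c 0| + 8 * m / q * w) ^ 2 := by gcongr
    _ ≤ 2 * ((w * E * |c 0|) ^ 2 + (8 * m / q * w) ^ 2) := add_sq_le
    _ ≤ 2 * (2 * ((t - s) / t) * c 0 ^ 2 +
        64 * m ^ 2 * (t - s) ^ (1 / 4 : ℝ) * ((q : ℝ) ^ (3 / 2 : ℝ))⁻¹) := by gcongr
    _ = _ := by ring

/-- The time modulus in `L²(0, 2π)` of the highest derivative, by summation of the estimates for its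
sine coefficients. -/
theorem exists_integral_sq_top_le : ∃ C : ℝ, 1 ≤ C ∧ ∀ {T m : ℝ} {u : ℝ → ℝ → ℝ}
    {D : ℝ → ℕ → ℝ → ℝ} {i : ℕ}, IsHeatSolution T u →
    (∀ s ∈ Icc 0 T, IsClassicalRep 0 (2 * Real.pi) (i + 3) m (fun x => u x s) (D s)) → 0 < m →
    ∀ {s t : ℝ}, 0 ≤ s → s < t → t ≤ T →
    ∫ x in (0 : ℝ)..2 * Real.pi, (D t (i + 4) x - D s (i + 4) x) ^ 2 ≤
      C * m ^ 2 * (1 + √t) ^ 2 * ((t - s) / t) ^ (1 / 4 : ℝ) := by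
  have hpi := Real.pi_pos
  have hsum : Summable fun q : ℕ => ((q : ℝ) ^ (3 / 2 : ℝ))⁻¹ :=
    Real.summable_nat_rpow_inv.2 (by norm_num)
  set S := ∑' q : ℕ, ((q : ℝ) ^ (3 / 2 : ℝ))⁻¹ with hS
  have hS0 : 0 ≤ S := tsum_nonneg fun q => by positivity
  refine ⟨8 * Real.pi + 128 * S / Real.pi + 1, by
    have : 0 ≤ 8 * Real.pi + 128 * S / Real.pi := by positivity
    linarith, ?_⟩
  intro T m u D i hu hD hm s t hs hst htT
  have ht0 : 0 < t := hs.trans_lt hst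
  have hτ : 0 < t - s := sub_pos.2 hst
  have hsT : s ∈ Icc 0 T := ⟨hs, hst.le.trans htT⟩
  have htT' : t ∈ Icc 0 T := ⟨ht0.le, htT⟩
  have h0T : (0 : ℝ) ∈ Icc 0 T := ⟨le_rfl, ht0.le.trans htT⟩
  have hP := hasSum_sineCoeff_sq (f := fun x => D t (i + 4) x - D s (i + 4) x)
    ((hD t htT').measurable_top.sub (hD s hsT).measurable_top) (m := m + m)
    fun x => (abs_sub _ _).trans (add_le_add ((hD t htT').abs_top_le x) ((hD s hsT).abs_top_le x))
  simp only [sineCoeff_sub ((hD t htT').intervalIntegrable 0 (2 * Real.pi))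
    ((hD s hsT).intervalIntegrable 0 (2 * Real.pi))] at hP
  have hP0 := hasSum_sineCoeff_sq (hD 0 h0T).measurable_top (hD 0 h0T).abs_top_le
  have hle := hasSum_le (fun q => sq_sineCoeff_sub_le hu hD hm q hs hst htT) hP
    ((hP0.mul_left (4 * ((t - s) / t))).add
      (hsum.hasSum.mul_left (128 * m ^ 2 * (t - s) ^ (1 / 4 : ℝ))))
  rw [← hS] at hle
  have hz0 : ∫ x in (0 : ℝ)..2 * Real.pi, D 0 (i + 4) x ^ 2 ≤ 2 * Real.pi * m ^ 2 := by
    have h := intervalIntegral.norm_integral_le_of_norm_le_const (a := 0) (b := 2 * Real.pi)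
      (f := fun x => D 0 (i + 4) x ^ 2) (C := m ^ 2) (fun x _ => by
        rw [Real.norm_eq_abs, abs_pow]
        exact pow_le_pow_left₀ (abs_nonneg _) ((hD 0 h0T).abs_top_le x) 2)
    rw [sub_zero, abs_of_pos (by positivity)] at h
    linarith [le_abs_self (∫ x in (0 : ℝ)..2 * Real.pi, D 0 (i + 4) x ^ 2),
      Real.norm_eq_abs (∫ x in (0 : ℝ)..2 * Real.pi, D 0 (i + 4) x ^ 2)]
  set ρ := (t - s) / t with hρ
  have hρ0 : 0 < ρ := by positivity
  have hρ1 : ρ ≤ 1 := by rw [hρ, div_le_one ht0]; linarith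
  have hρ2 : ρ ≤ ρ ^ (1 / 4 : ℝ) := by
    conv_lhs => rw [← Real.rpow_one ρ]
    exact Real.rpow_le_rpow_of_exponent_ge hρ0 hρ1 (by norm_num)
  set L := 1 + √t with hL
  have hL1 : 1 ≤ L := by rw [hL]; linarith [Real.sqrt_nonneg t]
  have hL2 : 1 ≤ L ^ 2 := one_le_pow₀ hL1
  have hτρ : (t - s) ^ (1 / 4 : ℝ) ≤ L ^ 2 * ρ ^ (1 / 4 : ℝ) := by
    have : t - s = t * ρ := by rw [hρ]; field_simp
    rw [this, Real.mul_rpow ht0.le hρ0.le]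
    gcongr
    calc t ^ (1 / 4 : ℝ) ≤ (L ^ (2 : ℝ)) ^ (1 / 4 : ℝ) := by
          refine Real.rpow_le_rpow ht0.le ?_ (by norm_num)
          rw [Real.rpow_two, hL]
          nlinarith [Real.sqrt_nonneg t, Real.sq_sqrt ht0.le]
      _ = L ^ (1 / 2 : ℝ) := by rw [← Real.rpow_mul (by linarith)]; norm_num
      _ ≤ L ^ (2 : ℝ) := Real.rpow_le_rpow_of_exponent_le hL1 (by norm_num)
      _ = L ^ 2 := Real.rpow_two L
  have hR : 0 ≤ ρ ^ (1 / 4 : ℝ) := by positivity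
  set I := ∫ x in (0 : ℝ)..2 * Real.pi, (D t (i + 4) x - D s (i + 4) x) ^ 2 with hI
  set R := ρ ^ (1 / 4 : ℝ) with hRd
  have h1 : Real.pi * I ≤ 4 * R * (Real.pi * (2 * Real.pi * m ^ 2)) +
      128 * m ^ 2 * (L ^ 2 * R) * S := by
    refine hle.trans ?_
    have : 0 ≤ ∫ x in (0 : ℝ)..2 * Real.pi, D 0 (i + 3 + 1) x ^ 2 :=
      intervalIntegral.integral_nonneg (by positivity) fun x _ => sq_nonneg _
    gcongr
  have h2 : I ≤ 8 * Real.pi * m ^ 2 * R + 128 * S / Real.pi * m ^ 2 * L ^ 2 * R := by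
    have : Real.pi * I ≤
        Real.pi * (8 * Real.pi * m ^ 2 * R + 128 * S / Real.pi * m ^ 2 * L ^ 2 * R) := by
      refine h1.trans (le_of_eq ?_)
      field_simp
      ring
    exact le_of_mul_le_mul_left this hpi
  calc I ≤ 8 * Real.pi * m ^ 2 * R * 1 + 128 * S / Real.pi * m ^ 2 * L ^ 2 * R := by linarith
    _ ≤ 8 * Real.pi * m ^ 2 * R * L ^ 2 + 128 * S / Real.pi * m ^ 2 * L ^ 2 * R +
        m ^ 2 * L ^ 2 * R := by
        have : 0 ≤ m ^ 2 * L ^ 2 * R := by positivity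
        have : 8 * Real.pi * m ^ 2 * R * 1 ≤ 8 * Real.pi * m ^ 2 * R * L ^ 2 := by gcongr
        linarith
    _ = _ := by ring

/-- The derivative of order `i + 3` is Hölder continuous in time with exponent `1 / 2`, by
interpolation between the Lipschitz bounds for `D (i + 2)` in time and for `D (i + 3)` in space. -/
theorem abs_deriv_time_sub_le (hu : IsHeatSolution T u)
    (hD : ∀ s ∈ Icc 0 T, IsClassicalRep 0 (2 * Real.pi) (i + 3) m (fun x => u x s) (D s))
    (hm : 0 < m) {s t : ℝ} (hs : 0 ≤ s) (hst : s < t) (htT : t ≤ T) {x : ℝ}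
    (hx : x ∈ Icc 0 (2 * Real.pi)) :
    |D t (i + 3) x - D s (i + 3) x| ≤ 4 * m * √(t - s) := by
  have hτ : 0 < t - s := sub_pos.2 hst
  have hsT : s ∈ Icc 0 T := ⟨hs, hst.le.trans htT⟩
  have htT' : t ∈ Icc 0 T := ⟨hs.trans hst.le, htT⟩
  have hq : √(t - s) * √(t - s) = t - s := Real.mul_self_sqrt hτ.le
  have hq0 : 0 < √(t - s) := Real.sqrt_pos.2 hτ
  -- for `√(t - s) ≤ 1` the step `√(t - s)` fits into `[0, 2π]`; otherwise the claim is trivial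
  rcases le_total (√(t - s)) 1 with h | h
  · have := abs_deriv_le_interpolation (g := fun x => D t (i + 2) x - D s (i + 2) x)
      (g' := fun x => D t (i + 3) x - D s (i + 3) x) (m := 2 * m) (ε := m * (t - s))
      (d := √(t - s)) (a := 0) (b := 2 * Real.pi)
      (fun x => ((hD t htT').hasDerivAt (i + 2) (by omega) x).sub
        ((hD s hsT).hasDerivAt (i + 2) (by omega) x))
      (fun x hx y hy => by
        have e1 := (hD t htT').lipschitz le_rfl hx hy
        have e2 := (hD s hsT).lipschitz le_rfl hx hy
        have e3 := abs_sub (D t (i + 3) y - D t (i + 3) x) (D s (i + 3) y - D s (i + 3) x)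
        rw [show D t (i + 3) y - D s (i + 3) y - (D t (i + 3) x - D s (i + 3) x) =
          D t (i + 3) y - D t (i + 3) x - (D s (i + 3) y - D s (i + 3) x) by ring]
        linarith)
      (by positivity)
      (fun x hx => by
        have := abs_time_sub_le (i := i + 1) hu hD hm rfl hx hsT htT'
        rwa [abs_of_pos hτ] at this)
      hq0 (by linarith [Real.pi_gt_three]) hx
    refine this.trans (le_of_eq ?_)
    rw [div_add' _ _ _ hq0.ne', div_eq_iff hq0.ne']
    linear_combination (-2 * m) * hq
  · have e1 := (hD t htT').abs_le (i + 3) le_rfl x hx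
    have e2 := (hD s hsT).abs_le (i + 3) le_rfl x hx
    have e3 := abs_sub (D t (i + 3) x) (D s (i + 3) x)
    nlinarith

/-- The time moduli in `L²(0, 2π)` of the two highest derivatives. Beyond boundedness of the highest
one, and Hölder continuity with exponent `1 / 2` of the other one, there is a factor
`((t - s) / t) ^ (1 / 8)` that tends to zero as `s → t`. The modulus of the second follows from that
of the first by `∫ F'² = [F F'] - ∫ F F''`, with `F` of order `t - s`. -/
theorem exists_time_modulus : ∃ C : ℝ, 1 ≤ C ∧ ∀ {T m : ℝ} {u : ℝ → ℝ → ℝ}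
    {D : ℝ → ℕ → ℝ → ℝ} {i : ℕ}, IsHeatSolution T u →
    (∀ s ∈ Icc 0 T, IsClassicalRep 0 (2 * Real.pi) (i + 3) m (fun x => u x s) (D s)) → 0 < m →
    ∀ {s t : ℝ}, 0 ≤ s → s < t → t ≤ T →
    ∫ x in (0 : ℝ)..2 * Real.pi, (D t (i + 4) x - D s (i + 4) x) ^ 2 ≤
        C * m ^ 2 * (1 + √t) ^ 2 * ((t - s) / t) ^ (1 / 8 : ℝ) ∧
    ∫ x in (0 : ℝ)..2 * Real.pi, (D t (i + 3) x - D s (i + 3) x) ^ 2 ≤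
        C * m ^ 2 * (1 + √t) ^ 2 * (t - s) * ((t - s) / t) ^ (1 / 8 : ℝ) := by
  obtain ⟨C, hC1, hC⟩ := exists_integral_sq_top_le
  have hpi := Real.pi_pos
  refine ⟨8 + 2 * Real.pi + C, by linarith, ?_⟩
  intro T m u D i hu hD hm s t hs hst htT
  have ht0 : 0 < t := hs.trans_lt hst
  have hτ : 0 < t - s := sub_pos.2 hst
  have hsT : s ∈ Icc 0 T := ⟨hs, hst.le.trans htT⟩
  have htT' : t ∈ Icc 0 T := ⟨ht0.le, htT⟩
  have hCz := hC hu hD hm hs hst htT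
  set z := fun x => D t (i + 4) x - D s (i + 4) x with hz
  set F := fun x => D t (i + 2) x - D s (i + 2) x with hF
  set F' := fun x => D t (i + 3) x - D s (i + 3) x with hF'
  change ∫ x in (0 : ℝ)..2 * Real.pi, z x ^ 2 ≤ _ ∧ ∫ x in (0 : ℝ)..2 * Real.pi, F' x ^ 2 ≤ _
  change ∫ x in (0 : ℝ)..2 * Real.pi, z x ^ 2 ≤ _ at hCz
  set ρ := (t - s) / t with hρ
  have hρ0 : 0 < ρ := by positivity
  have hρ1 : ρ ≤ 1 := by rw [hρ, div_le_one ht0]; linarith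
  set L := 1 + √t with hL
  have hL1 : 1 ≤ L := by rw [hL]; linarith [Real.sqrt_nonneg t]
  have hρle : ∀ p : ℝ, 1 / 8 ≤ p → ρ ^ p ≤ ρ ^ (1 / 8 : ℝ) := fun p hp =>
    Real.rpow_le_rpow_of_exponent_ge hρ0 hρ1 hp
  set R := ρ ^ (1 / 8 : ℝ) with hR
  have hR0 : 0 < R := by positivity
  have hRR : ρ ^ (1 / 4 : ℝ) = R ^ 2 := by
    rw [hR, ← Real.rpow_natCast, ← Real.rpow_mul hρ0.le]; norm_num
  have hR1 : R ≤ 1 := Real.rpow_le_one hρ0.le hρ1 (by norm_num)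
  rw [hRR] at hCz
  have hF0 : ∀ x ∈ Icc 0 (2 * Real.pi), |F x| ≤ m * (t - s) := fun x hx => by
    have := abs_time_sub_le (i := i + 1) hu hD hm rfl hx hsT htT'
    rwa [abs_of_pos hτ] at this
  have hF'0 : ∀ x ∈ Icc 0 (2 * Real.pi), |F' x| ≤ 4 * m * √(t - s) := fun x hx =>
    abs_deriv_time_sub_le hu hD hm hs hst htT hx
  have h0 : (0 : ℝ) ∈ Icc 0 (2 * Real.pi) := ⟨le_rfl, by positivity⟩
  have h2 : 2 * Real.pi ∈ Icc 0 (2 * Real.pi) := ⟨by positivity, le_rfl⟩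
  have hFc : Continuous F := ((hD t htT').continuous (by omega)).sub
    ((hD s hsT).continuous (by omega))
  have hF'c : Continuous F' := ((hD t htT').continuous le_rfl).sub ((hD s hsT).continuous le_rfl)
  have hzm : Measurable z := (hD t htT').measurable_top.sub (hD s hsT).measurable_top
  have hzb : ∀ x, |z x| ≤ 2 * m := fun x => (abs_sub _ _).trans (by
    linarith [(hD t htT').abs_top_le x, (hD s hsT).abs_top_le x])
  have hzi := intervalIntegrable_of_bound hzm hzb 0 (2 * Real.pi)
  have hz2i : IntervalIntegrable (fun x => z x ^ 2) volume 0 (2 * Real.pi) :=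
    intervalIntegrable_of_bound (hzm.pow_const 2) (m := (2 * m) ^ 2) (fun x => by
      rw [abs_pow]; exact pow_le_pow_left₀ (abs_nonneg _) (hzb x) 2) _ _
  have hibp := integral_deriv_mul_of_integral (φ := F) (φ' := F') (W := F') (z := z)
    (fun x => ((hD t htT').hasDerivAt (i + 2) (by omega) x).sub
        ((hD s hsT).hasDerivAt (i + 2) (by omega) x)) hF'c (locallyIntegrable_of_bound hzm hzb)
    (fun x y => by
      have e1 := (hD t htT').integral_top x y
      have e2 := (hD s hsT).integral_top x y
      rw [hz, intervalIntegral.integral_sub ((hD t htT').intervalIntegrable x y)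
        ((hD s hsT).intervalIntegrable x y), ← e1, ← e2]
      simp only [hF']; ring) 0 (2 * Real.pi)
  have hCS := sq_integral_mul_le h2.1 ((hFc.pow 2).intervalIntegrable 0 (2 * Real.pi)) hz2i
    (hzi.continuousOn_mul hFc.continuousOn)
  have hFF : ∫ x in (0 : ℝ)..2 * Real.pi, F x ^ 2 ≤ 2 * Real.pi * (m * (t - s)) ^ 2 := by
    have h := intervalIntegral.norm_integral_le_of_norm_le_const (a := 0) (b := 2 * Real.pi)
      (f := fun x => F x ^ 2) (C := (m * (t - s)) ^ 2) (fun x hx => by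
        rw [uIoc_of_le h2.1] at hx
        rw [Real.norm_eq_abs, abs_pow]
        exact pow_le_pow_left₀ (abs_nonneg _) (hF0 x ⟨hx.1.le, hx.2⟩) 2)
    rw [sub_zero, abs_of_pos (by positivity), Real.norm_eq_abs] at h
    linarith [le_abs_self (∫ x in (0 : ℝ)..2 * Real.pi, F x ^ 2)]
  have hFz : |∫ x in (0 : ℝ)..2 * Real.pi, F x * z x| ≤
      (2 * Real.pi + C) * (m ^ 2 * (t - s) * L * R) := by
    refine abs_le_of_sq_le_sq ?_ (by positivity)
    calc _ ≤ (2 * Real.pi * (m * (t - s)) ^ 2) * (C * m ^ 2 * L ^ 2 * R ^ 2) := hCS.trans (by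
            gcongr
            exact intervalIntegral.integral_nonneg h2.1 fun x _ => sq_nonneg _)
      _ = 2 * Real.pi * C * (m ^ 2 * (t - s) * L * R) ^ 2 := by ring
      _ ≤ (2 * Real.pi + C) ^ 2 * (m ^ 2 * (t - s) * L * R) ^ 2 := by
          gcongr
          nlinarith
      _ = _ := by ring
  have hbd : ∀ x ∈ Icc 0 (2 * Real.pi), |F x * F' x| ≤ 4 * (m ^ 2 * (t - s) * L * R) := by
    intro x hx
    have e1 : √(t - s) ≤ L * R := by
      have : t - s = t * ρ := by rw [hρ]; field_simp
      rw [this, Real.sqrt_mul ht0.le, Real.sqrt_eq_rpow ρ]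
      exact mul_le_mul (by linarith) (hρle _ (by norm_num)) (by positivity) (by linarith)
    rw [abs_mul]
    calc |F x| * |F' x| ≤ (m * (t - s)) * (4 * m * √(t - s)) :=
          mul_le_mul (hF0 x hx) (hF'0 x hx) (abs_nonneg _) (by positivity)
      _ ≤ (m * (t - s)) * (4 * m * (L * R)) := by gcongr
      _ = _ := by ring
  have hL2 : L ≤ L ^ 2 := by nlinarith
  constructor
  · refine hCz.trans ?_
    have : R ^ 2 ≤ R := by nlinarith
    gcongr
    linarith
  · have e : ∫ x in (0 : ℝ)..2 * Real.pi, F' x ^ 2 = ∫ x in (0 : ℝ)..2 * Real.pi, F' x * F' x := by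
      congr 1; ext x; ring
    rw [e, hibp]
    have b1 := le_abs_self (F (2 * Real.pi) * F' (2 * Real.pi))
    have b2 := neg_abs_le (F 0 * F' 0)
    have b3 := neg_abs_le (∫ x in (0 : ℝ)..2 * Real.pi, F x * z x)
    have b4 := hbd _ h0
    have b5 := hbd _ h2
    calc _ ≤ (8 + 2 * Real.pi + C) * (m ^ 2 * (t - s) * L * R) := by linarith
      _ ≤ (8 + 2 * Real.pi + C) * (m ^ 2 * (t - s) * L ^ 2 * R) := by gcongr
      _ = _ := by ring

end Modulus

/-! ### Approximation of the Gauss–Radau coefficients -/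

/-- The Taylor polynomial at `a`, in the form of an integrated approximation of the derivative. -/
theorem exists_taylor {a b M : ℝ} (hab : a ≤ b) (n : ℕ) (f : ℕ → ℝ → ℝ)
    (hf : ∀ i < n, ∀ x, HasDerivAt (f i) (f (i + 1) x) x)
    (hM : ∀ x ∈ Icc a b, |f n x - f n a| ≤ M) :
    ∃ p : ℝ[X], p.degree < (n + 1 : ℕ) ∧ ∀ x ∈ Icc a b, |f 0 x - p.eval x| ≤ (b - a) ^ n * M := by
  induction n generalizing f with
  | zero =>
    refine ⟨C (f 0 a), lt_of_le_of_lt degree_C_le (by simp), fun x hx => ?_⟩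
    simpa using hM x hx
  | succ n ih =>
    obtain ⟨p, hp, hpx⟩ := ih (fun i => f (i + 1)) (fun i hi => hf (i + 1) (by omega)) hM
    obtain ⟨v, hv, hvd⟩ := exists_derivative_eq hp
    refine ⟨v + C (f 0 a - v.eval a), ?_, fun x hx => ?_⟩
    · refine lt_of_le_of_lt (degree_add_le _ _) (max_lt hvd (lt_of_le_of_lt degree_C_le ?_))
      exact_mod_cast Nat.succ_pos (n + 1)
    · have h := abs_sub_le_of_abs_deriv_le (g := fun x => f 0 x - v.eval x)
        (g' := fun x => f 1 x - p.eval x) (a := a) (b := b) (m := (b - a) ^ n * M)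
        (fun y _ => ((hf 0 (by omega) y).sub (by rw [← hv]; exact v.hasDerivAt y)).hasDerivWithinAt)
        hpx (left_mem_Icc.2 hab) hx
      have hM0 : 0 ≤ M := (abs_nonneg _).trans (hM a (left_mem_Icc.2 hab))
      have e : f 0 x - (v + C (f 0 a - v.eval a)).eval x =
          f 0 x - v.eval x - (f 0 a - v.eval a) := by
        rw [eval_add, eval_C]; ring
      rw [e]
      refine h.trans ?_
      rw [abs_of_nonneg (sub_nonneg.2 hx.1)]
      calc (b - a) ^ n * M * (x - a) ≤ (b - a) ^ n * M * (b - a) := by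
            have : 0 ≤ b - a := sub_nonneg.2 hab
            gcongr
            exact hx.2
        _ = _ := by ring

/-- The Gauss–Radau coefficient annihilates polynomials of degree at most `k`, so it is of order
`k + 1` on smooth functions. -/
theorem exists_sq_radauCoeff_le (k : ℕ) : ∃ C : ℝ, 1 ≤ C ∧ ∀ (a b : ℝ), a < b → ∀ (fl : Flux)
    (f : ℕ → ℝ → ℝ), (∀ i < k, ∀ x, HasDerivAt (f i) (f (i + 1) x) x) → Continuous (f k) →
    IntervalIntegrable (f (k + 1)) volume a b →
    IntervalIntegrable (fun x => f (k + 1) x ^ 2) volume a b →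
    (∀ x y, f k y - f k x = ∫ s in x..y, f (k + 1) s) →
    radauCoeff k a b fl (f 0) ^ 2 ≤ C * (b - a) ^ (2 * k + 1) * ∫ x in a..b, f (k + 1) x ^ 2 := by
  obtain ⟨c, hc1, hc⟩ := exists_radauCoeff_bound k
  refine ⟨c ^ 2, one_le_pow₀ hc1, fun a b hab fl f hf hfk hg hg2 hint => ?_⟩
  have hba : 0 < b - a := sub_pos.2 hab
  set I := ∫ x in a..b, f (k + 1) x ^ 2 with hI
  have hI0 : 0 ≤ I := intervalIntegral.integral_nonneg hab.le fun x _ => sq_nonneg _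
  have hM : ∀ x ∈ Icc a b, |f k x - f k a| ≤ √((b - a) * I) := by
    intro x hx
    have hsub : uIcc a x ⊆ uIcc a b := by
      rw [uIcc_of_le hx.1, uIcc_of_le hab.le]; exact Icc_subset_Icc_right hx.2
    refine Real.abs_le_sqrt ?_
    have h1 := sq_integral_mul_le (f := fun _ => 1) (g := f (k + 1)) hx.1 (by simp)
      (hg2.mono_set hsub) (by simpa using hg.mono_set hsub)
    simp only [one_mul, one_pow, intervalIntegral.integral_const, smul_eq_mul, mul_one] at h1
    rw [hint a x]
    refine h1.trans ?_
    have h2 : ∫ s in a..x, f (k + 1) s ^ 2 ≤ I :=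
      intervalIntegral.integral_mono_interval le_rfl hx.1 hx.2
        (Filter.Eventually.of_forall fun s => sq_nonneg _) hg2
    have h3 : 0 ≤ ∫ s in a..x, f (k + 1) s ^ 2 :=
      intervalIntegral.integral_nonneg hx.1 fun x _ => sq_nonneg _
    exact mul_le_mul (by linarith [hx.2]) h2 h3 hba.le
  obtain ⟨p, hp, hpx⟩ := exists_taylor hab.le k f hf hM
  have hpd : p.natDegree ≤ k := natDegree_le_iff_coeff_eq_zero.2 fun N hN =>
    (degree_lt_iff_coeff_zero p (k + 1)).1 hp N hN
  have hf0 : Continuous (f 0) := by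
    rcases Nat.eq_zero_or_pos k with rfl | h
    · exact hfk
    · exact continuous_iff_continuousAt.2 fun x => (hf 0 h x).continuousAt
  have h1 := hc a b hab fl (fun x => f 0 x - p.eval x) _ hpx
  rw [radauCoeff_sub fl (hf0.intervalIntegrable a b) (p.continuous.intervalIntegrable a b),
    radauCoeff_eval hab fl hpd, sub_zero] at h1
  calc radauCoeff k a b fl (f 0) ^ 2 = |radauCoeff k a b fl (f 0)| ^ 2 := (sq_abs _).symm
    _ ≤ (c * ((b - a) ^ k * √((b - a) * I))) ^ 2 := by gcongr
    _ = c ^ 2 * (b - a) ^ (2 * k) * √((b - a) * I) ^ 2 := by ring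
    _ = c ^ 2 * (b - a) ^ (2 * k + 1) * I := by rw [Real.sq_sqrt (by positivity)]; ring

section

variable {k j n : ℕ} {C a b m m' : ℝ} {f f' : ℝ → ℝ} {D D' : ℕ → ℝ → ℝ}

theorem IsClassicalRep.sq_intervalIntegrable (h : IsClassicalRep a b n m f D) (x y : ℝ) :
    IntervalIntegrable (fun x => D (n + 1) x ^ 2) volume x y :=
  intervalIntegrable_of_bound (h.measurable_top.pow_const 2) (m := m ^ 2) (fun x => by
    rw [abs_pow]; exact pow_le_pow_left₀ (abs_nonneg _) (h.abs_top_le x) 2) _ _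

theorem IsClassicalRep.sub (h : IsClassicalRep a b n m f D) (h' : IsClassicalRep a b n m' f' D') :
    IsClassicalRep a b n (m + m') (fun x => f x - f' x) (fun i x => D i x - D' i x) where
  zero x hx := by rw [h.zero x hx, h'.zero x hx]
  hasDerivAt i hi x := (h.hasDerivAt i hi x).sub (h'.hasDerivAt i hi x)
  measurable_top := h.measurable_top.sub h'.measurable_top
  abs_top_le x := (abs_sub _ _).trans (add_le_add (h.abs_top_le x) (h'.abs_top_le x))
  integral_top x y := by
    rw [intervalIntegral.integral_sub (h.intervalIntegrable x y) (h'.intervalIntegrable x y),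
      ← h.integral_top, ← h'.integral_top]
    ring
  abs_le i hi x hx := (abs_sub _ _).trans (add_le_add (h.abs_le i hi x hx) (h'.abs_le i hi x hx))

end

/-- The estimate of the Gauss–Radau coefficient for the derivatives of a classical
representation. -/
theorem exists_sq_radauCoeff_rep_le (k : ℕ) : ∃ C : ℝ, 1 ≤ C ∧ ∀ {α β m : ℝ} {j n : ℕ} {f : ℝ → ℝ}
    {D : ℕ → ℝ → ℝ}, IsClassicalRep α β n m f D → j + k ≤ n → ∀ (a b : ℝ), a < b → ∀ fl : Flux,
    radauCoeff k a b fl (D j) ^ 2 ≤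
      C * (b - a) ^ (2 * k + 1) * ∫ x in a..b, D (j + k + 1) x ^ 2 := by
  obtain ⟨C, hC1, hC⟩ := exists_sq_radauCoeff_le k
  refine ⟨C, hC1, fun {α β m j n f D} h hj a b hab fl => ?_⟩
  refine hC a b hab fl (fun i => D (j + i)) (fun i hi => h.hasDerivAt (j + i) (by omega))
    (h.continuous hj) ?_ ?_ ?_
  · change IntervalIntegrable (D (j + k + 1)) _ _ _
    rcases hj.lt_or_eq with hj | rfl
    · exact (h.continuous (by omega)).intervalIntegrable _ _
    · exact h.intervalIntegrable _ _
  · change IntervalIntegrable (fun x => D (j + k + 1) x ^ 2) _ _ _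
    rcases hj.lt_or_eq with hj | rfl
    · exact ((h.continuous (by omega)).pow 2).intervalIntegrable _ _
    · exact h.sq_intervalIntegrable _ _
  · change ∀ x y, D (j + k) y - D (j + k) x = ∫ s in x..y, D (j + k + 1) s
    intro x y
    rcases hj.lt_or_eq with hj | rfl
    · exact (intervalIntegral.integral_eq_sub_of_hasDerivAt (fun s _ => h.hasDerivAt _ hj s)
        ((h.continuous (by omega)).intervalIntegrable _ _)).symm
    · exact h.integral_top x y

/-! ### The space of broken polynomials and the discrete derivative -/

section Traces

variable {N : ℕ} (M : Mesh N)

theorem Mesh.lo_lt_hi (j : Fin N) : M.lo j < M.hi j :=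
  M.strictMono (Fin.castSucc_lt_succ (i := j))

theorem Mesh.width_pos (j : Fin N) : 0 < M.width j := sub_pos.2 (M.lo_lt_hi j)

theorem Mesh.zero_le_lo (j : Fin N) : 0 ≤ M.lo j := by
  rw [← M.first]; exact M.strictMono.monotone (Fin.zero_le _)

theorem Mesh.hi_le (j : Fin N) : M.hi j ≤ 2 * Real.pi := by
  rw [← M.last]; exact M.strictMono.monotone (Fin.le_last _)

/-- A mesh of `[0, 2π]` has at least one cell. -/
theorem Mesh.exists_eq_add_one {N : ℕ} (M : Mesh N) : ∃ n, N = n + 1 := by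
  rcases N with _ | n
  · have h1 := M.first
    have h2 := M.last
    have h3 : Fin.last 0 = 0 := rfl
    rw [h3, h1] at h2
    linarith [Real.pi_pos]
  · exact ⟨n, rfl⟩

@[simp] theorem Mesh.traceMinus_zero (g : ℝ) (v : Fin N → ℝ[X]) : M.traceMinus g v 0 = g := rfl

@[simp] theorem Mesh.traceMinus_succ (g : ℝ) (v : Fin N → ℝ[X]) (j : Fin N) :
    M.traceMinus g v j.succ = (v j).eval (M.hi j) := rfl

@[simp] theorem Mesh.tracePlus_last (g : ℝ) (v : Fin N → ℝ[X]) :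
    M.tracePlus g v (Fin.last N) = g := by simp [Mesh.tracePlus]

@[simp] theorem Mesh.tracePlus_castSucc (g : ℝ) (v : Fin N → ℝ[X]) (j : Fin N) :
    M.tracePlus g v j.castSucc = (v j).eval (M.lo j) := by simp [Mesh.tracePlus]

theorem Mesh.traceMinus_linear (a g g' : ℝ) (v v' : Fin N → ℝ[X]) (i : Fin (N + 1)) :
    M.traceMinus (a * g + g') (a • v + v') i = a * M.traceMinus g v i + M.traceMinus g' v' i := by
  cases i using Fin.cases <;> simp

theorem Mesh.tracePlus_linear (a g g' : ℝ) (v v' : Fin N → ℝ[X]) (i : Fin (N + 1)) :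
    M.tracePlus (a * g + g') (a • v + v') i = a * M.tracePlus g v i + M.tracePlus g' v' i := by
  cases i using Fin.lastCases <;> simp

/-- The boundary conditions of the same type with zero data. -/
def Boundary.homogeneous : Boundary → Boundary
  | .periodic => .periodic
  | .mixed _ _ => .mixed (fun _ => 0) fun _ => 0

/-- The flux of `q` is the flux of `u` for the other choice. In the mixed case `g₀` and `g₁` change
their roles accordingly. -/
theorem fluxQ_eq (t : ℝ) (v : Fin N → ℝ[X]) (fl : Flux) (bc : Boundary) :
    fluxQ M t v fl bc = fluxU M t v fl.swap bc := by
  cases fl <;> cases bc <;> rfl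

/-- The flux is affine: its linear part is the flux for zero boundary data. -/
theorem fluxU_affine (a t : ℝ) (v w : Fin N → ℝ[X]) (fl : Flux) (bc : Boundary) (i : Fin (N + 1)) :
    fluxU M t (a • v + w) fl bc i =
      a * fluxU M 0 v fl bc.homogeneous i + fluxU M t w fl bc i := by
  have h : ∀ g : ℝ, g = a * 0 + g := fun g => by ring
  cases fl <;> cases bc <;> simp only [fluxU, Boundary.homogeneous]
  · rw [show M.traceMinus 0 (a • v + w) (Fin.last N) =
      a * M.traceMinus 0 v (Fin.last N) + M.traceMinus 0 w (Fin.last N) by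
        conv_lhs => rw [h 0]
        exact M.traceMinus_linear _ _ _ _ _ _]
    exact M.traceMinus_linear _ _ _ _ _ _
  · exact (congrArg (fun g => M.traceMinus g (a • v + w) i) (h _)).trans
      (M.traceMinus_linear _ _ _ _ _ _)
  · rw [show M.tracePlus 0 (a • v + w) 0 = a * M.tracePlus 0 v 0 + M.tracePlus 0 w 0 by
        conv_lhs => rw [h 0]
        exact M.tracePlus_linear _ _ _ _ _ _]
    exact M.tracePlus_linear _ _ _ _ _ _
  · exact (congrArg (fun g => M.tracePlus g (a • v + w) i) (h _)).trans
      (M.tracePlus_linear _ _ _ _ _ _)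

theorem fluxU_sub (t : ℝ) (v w : Fin N → ℝ[X]) (fl : Flux) (bc : Boundary) (i : Fin (N + 1)) :
    fluxU M t v fl bc i - fluxU M t w fl bc i = fluxU M 0 (v - w) fl bc.homogeneous i := by
  have h := fluxU_affine M 1 t (v - w) w fl bc i
  rw [one_smul, sub_add_cancel, one_mul] at h
  rw [h]; ring

theorem Boundary.homogeneous_homogeneous (bc : Boundary) :
    bc.homogeneous.homogeneous = bc.homogeneous := by cases bc <;> rfl

theorem fluxU_zero (fl : Flux) (bc : Boundary) (i : Fin (N + 1)) :
    fluxU M 0 0 fl bc.homogeneous i = 0 := by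
  have := fluxU_sub M 0 0 0 fl bc i
  rw [sub_self, sub_self] at this
  exact this.symm

theorem fluxU_add (v w : Fin N → ℝ[X]) (fl : Flux) (bc : Boundary) (i : Fin (N + 1)) :
    fluxU M 0 (v + w) fl bc.homogeneous i =
      fluxU M 0 v fl bc.homogeneous i + fluxU M 0 w fl bc.homogeneous i := by
  have h := fluxU_affine M 1 0 v w fl bc.homogeneous i
  rwa [one_smul, one_mul, Boundary.homogeneous_homogeneous] at h

theorem fluxU_smul (a : ℝ) (v : Fin N → ℝ[X]) (fl : Flux) (bc : Boundary) (i : Fin (N + 1)) :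
    fluxU M 0 (a • v) fl bc.homogeneous i = a * fluxU M 0 v fl bc.homogeneous i := by
  have h := fluxU_affine M a 0 v 0 fl bc.homogeneous i
  rwa [add_zero, Boundary.homogeneous_homogeneous, fluxU_zero, add_zero] at h

/-- The values of a function at the nodes are the fluxes of a broken polynomial that interpolates it
at the flux end point of each cell. -/
theorem fluxU_eq_of_interp {t : ℝ} {f : ℝ → ℝ} {v : Fin N → ℝ[X]} {fl : Flux} {bc : Boundary}
    (hv : ∀ j, (v j).eval (fl.endpoint (M.lo j) (M.hi j)) = f (fl.endpoint (M.lo j) (M.hi j)))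
    (hbc : match fl, bc with
      | _, .periodic => f 0 = f (2 * Real.pi)
      | .left, .mixed g₀ _ => f 0 = g₀ t
      | .right, .mixed _ g₁ => f (2 * Real.pi) = g₁ t) (i : Fin (N + 1)) :
    fluxU M t v fl bc i = f (M.node i) := by
  obtain ⟨n, rfl⟩ := M.exists_eq_add_one
  cases fl <;> cases bc <;> simp only [fluxU] <;> simp only [Flux.endpoint] at hv
  · have hs : ∀ g j, M.traceMinus g v (Fin.succ j) = f (M.node j.succ) := fun g j => hv j
    cases i using Fin.cases with
    | zero =>
      rw [M.traceMinus_zero, ← Fin.succ_last, hs, Fin.succ_last, M.last, M.first]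
      exact hbc.symm
    | succ j => exact hs _ j
  · cases i using Fin.cases with
    | zero => rw [M.traceMinus_zero, M.first]; exact hbc.symm
    | succ j => exact hv j
  · have hs : ∀ g j, M.tracePlus g v (Fin.castSucc j) = f (M.node j.castSucc) := fun g j => by
      rw [M.tracePlus_castSucc]; exact hv j
    cases i using Fin.lastCases with
    | last =>
      rw [M.tracePlus_last, ← Fin.castSucc_zero, hs, Fin.castSucc_zero, M.last, M.first]
      exact hbc
    | cast j => exact hs _ j
  · cases i using Fin.lastCases with
    | last => rw [M.tracePlus_last, M.last]; exact hbc.symm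
    | cast j => rw [M.tracePlus_castSucc]; exact hv j

/-- At each node the flux is a one-sided limit or zero; in the periodic case one of the limits is
used twice. -/
theorem sum_sq_fluxU_le (v : Fin N → ℝ[X]) (fl : Flux) (bc : Boundary) :
    ∑ i, fluxU M 0 v fl bc.homogeneous i ^ 2 ≤
      2 * ∑ j, (v j).eval (fl.endpoint (M.lo j) (M.hi j)) ^ 2 := by
  obtain ⟨n, rfl⟩ := M.exists_eq_add_one
  have hS : 0 ≤ ∑ j, (v j).eval (fl.endpoint (M.lo j) (M.hi j)) ^ 2 :=
    Finset.sum_nonneg fun j _ => sq_nonneg _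
  have hle : ∀ j, (v j).eval (fl.endpoint (M.lo j) (M.hi j)) ^ 2 ≤
      ∑ j, (v j).eval (fl.endpoint (M.lo j) (M.hi j)) ^ 2 := fun j =>
    Finset.single_le_sum (f := fun j => (v j).eval (fl.endpoint (M.lo j) (M.hi j)) ^ 2)
      (fun j _ => sq_nonneg _) (Finset.mem_univ j)
  cases fl <;> cases bc <;> simp only [fluxU, Boundary.homogeneous, Flux.endpoint] at *
  · rw [Fin.sum_univ_succ, M.traceMinus_zero, ← Fin.succ_last]
    simp only [M.traceMinus_succ]
    linarith [hle (Fin.last n)]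
  · rw [Fin.sum_univ_succ, M.traceMinus_zero]
    simp only [M.traceMinus_succ]
    linarith
  · rw [Fin.sum_univ_castSucc, M.tracePlus_last, ← Fin.castSucc_zero]
    simp only [M.tracePlus_castSucc]
    linarith [hle 0]
  · rw [Fin.sum_univ_castSucc, M.tracePlus_last]
    simp only [M.tracePlus_castSucc]
    linarith

/-- The discrete derivative of `p` on a cell with fluxes `F`, tested with `w` (up to the sign). -/
def cellForm (F : Fin (N + 1) → ℝ) (p : ℝ[X]) (j : Fin N) (w : ℝ[X]) : ℝ :=
  (∫ x in M.lo j..M.hi j, p.eval x * w.derivative.eval x) - F j.succ * w.eval (M.hi j) +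
    F j.castSucc * w.eval (M.lo j)

/-- The discrete derivative of the broken polynomial `v` for zero boundary data. -/
def fluxForm (fl : Flux) (bc : Boundary) (v : Fin N → ℝ[X]) (j : Fin N) (w : ℝ[X]) : ℝ :=
  cellForm M (fluxU M 0 v fl bc.homogeneous) (v j) j w

theorem cellForm_sub (F F' : Fin (N + 1) → ℝ) (p p' : ℝ[X]) (j : Fin N) (w : ℝ[X]) :
    cellForm M F p j w - cellForm M F' p' j w = cellForm M (fun i => F i - F' i) (p - p') j w := by
  simp only [cellForm, eval_sub, sub_mul]
  rw [intervalIntegral.integral_sub (intervalIntegrable_mul_eval (intervalIntegrable_eval _ _ _) _)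
    (intervalIntegrable_mul_eval (intervalIntegrable_eval _ _ _) _)]
  ring

theorem cellForm_sum {ι : Type*} (s : Finset ι) (F : Fin (N + 1) → ℝ) (p : ℝ[X]) (j : Fin N)
    (c : ι → ℝ) (w : ι → ℝ[X]) :
    cellForm M F p j (∑ i ∈ s, C (c i) * w i) = ∑ i ∈ s, c i * cellForm M F p j (w i) := by
  simp only [cellForm, derivative_sum, derivative_C_mul, eval_finsetSum, eval_mul, eval_C,
    Finset.mul_sum, mul_add, mul_sub]
  rw [intervalIntegral.integral_finsetSum fun i _ =>
    (by fun_prop : Continuous fun x =>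
      p.eval x * (c i * (w i).derivative.eval x)).intervalIntegrable _ _]
  rw [← Finset.sum_sub_distrib, ← Finset.sum_add_distrib]
  refine Finset.sum_congr rfl fun i _ => ?_
  rw [← intervalIntegral.integral_const_mul]
  have : ∀ x, p.eval x * (c i * (w i).derivative.eval x) =
      c i * (p.eval x * (w i).derivative.eval x) := fun x => by ring
  simp only [this]
  ring

theorem fluxForm_add (fl : Flux) (bc : Boundary) (v v' : Fin N → ℝ[X]) (j : Fin N) (w : ℝ[X]) :
    fluxForm M fl bc (v + v') j w = fluxForm M fl bc v j w + fluxForm M fl bc v' j w := by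
  simp only [fluxForm, cellForm, fluxU_add, Pi.add_apply, eval_add, add_mul]
  rw [intervalIntegral.integral_add (intervalIntegrable_mul_eval (intervalIntegrable_eval _ _ _) _)
    (intervalIntegrable_mul_eval (intervalIntegrable_eval _ _ _) _)]
  ring

theorem fluxForm_smul (fl : Flux) (bc : Boundary) (a : ℝ) (v : Fin N → ℝ[X]) (j : Fin N)
    (w : ℝ[X]) : fluxForm M fl bc (a • v) j w = a * fluxForm M fl bc v j w := by
  simp only [fluxForm, cellForm, fluxU_smul, Pi.smul_apply, eval_smul, smul_eq_mul, mul_assoc]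
  rw [intervalIntegral.integral_const_mul]
  ring

theorem sum_fluxForm_left (bc : Boundary) (v w : Fin N → ℝ[X]) :
    ∑ j, (fluxForm M .left bc v j (w j) + fluxForm M .right bc w j (v j)) = 0 := by
  obtain ⟨n, rfl⟩ := M.exists_eq_add_one
  set F := fluxU M 0 v .left bc.homogeneous with hF
  set H := fluxU M 0 w .right bc.homogeneous with hH
  have h1 : ∀ j, F (Fin.succ j) = (v j).eval (M.hi j) := by
    intro j; rw [hF]; cases bc <;> rfl
  have h2 : ∀ j, H (Fin.castSucc j) = (w j).eval (M.lo j) := by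
    intro j; rw [hH]
    cases bc <;> simp only [fluxU, Boundary.homogeneous, M.tracePlus_castSucc]
  have hcell : ∀ j, fluxForm M .left bc v j (w j) + fluxForm M .right bc w j (v j) =
      F j.castSucc * H j.castSucc - F j.succ * H j.succ := by
    intro j
    have hi := integral_eval_derivative_mul (w j) (v j) (M.lo j) (M.hi j)
    have e1 : ∫ x in M.lo j..M.hi j, (v j).eval x * (w j).derivative.eval x =
        ∫ x in M.lo j..M.hi j, (w j).derivative.eval x * (v j).eval x := by
      congr 1; ext x; ring
    simp only [fluxForm, cellForm, ← hF, ← hH]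
    rw [e1, hi, h1, h2]
    ring
  -- periodicity, or one vanishing factor at each end point
  have htel : F 0 * H 0 = F (Fin.last (n + 1)) * H (Fin.last (n + 1)) := by
    cases bc
    · have e1 : F 0 = F (Fin.last (n + 1)) := by
        rw [hF, ← Fin.succ_last]; rfl
      have e2 : H (Fin.last (n + 1)) = H 0 := by
        rw [hH]; simp only [fluxU, Boundary.homogeneous, M.tracePlus_last]
        rw [← Fin.castSucc_zero, M.tracePlus_castSucc, M.tracePlus_castSucc]
      rw [e1, e2]
    · have e1 : F 0 = 0 := rfl
      have e2 : H (Fin.last (n + 1)) = 0 := by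
        rw [hH]; simp only [fluxU, Boundary.homogeneous, M.tracePlus_last]
      rw [e1, e2]; ring
  simp only [hcell, Finset.sum_sub_distrib]
  have s1 := Fin.sum_univ_succ fun i => F i * H i
  have s2 := Fin.sum_univ_castSucc fun i => F i * H i
  linarith

/-- Summation by parts: the alternating fluxes make the two discrete derivatives adjoint, up to
the sign. -/
theorem sum_fluxForm_add (fl : Flux) (bc : Boundary) (v w : Fin N → ℝ[X]) :
    ∑ j, fluxForm M fl bc v j (w j) = -∑ j, fluxForm M fl.swap bc w j (v j) := by
  rw [eq_neg_iff_add_eq_zero, ← Finset.sum_add_distrib]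
  cases fl
  · exact sum_fluxForm_left M bc v w
  · rw [← sum_fluxForm_left M bc w v]
    exact Finset.sum_congr rfl fun j _ => add_comm _ _

end Traces

section Space

variable {N : ℕ} (M : Mesh N) (k : ℕ)

/-- The Legendre polynomials on a cell, normalized in `L²`. -/
def cellBasis (j : Fin N) (i : Fin (k + 1)) : ℝ[X] :=
  C √((2 * (i : ℝ) + 1) / M.width j) * cellLeg (M.lo j) (M.hi j) i

/-- The coordinates of the `L²` projection of a broken polynomial to degree `k`, with respect to
the normalized Legendre polynomials. -/
def coord (p : Fin N → ℝ[X]) : EuclideanSpace ℝ (Fin N × Fin (k + 1)) :=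
  WithLp.toLp 2 fun ji => ∫ x in M.lo ji.1..M.hi ji.1,
    (p ji.1).eval x * (cellBasis M k ji.1 ji.2).eval x

/-- The broken polynomial with given coordinates; `EuclideanSpace` thus is the space `V_h` with the
inner product of `L²(0, 2π)`. -/
def broken (x : EuclideanSpace ℝ (Fin N × Fin (k + 1))) : Fin N → ℝ[X] := fun j =>
  ∑ i, C (x (j, i)) * cellBasis M k j i

theorem natDegree_cellBasis_le (j : Fin N) (i : Fin (k + 1)) :
    (cellBasis M k j i).natDegree ≤ k := by
  refine (natDegree_C_mul_le _ _).trans ?_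
  rw [natDegree_cellLeg (M.lo_lt_hi j)]
  exact Nat.lt_succ_iff.1 i.2

theorem coord_apply (p : Fin N → ℝ[X]) (j : Fin N) (i : Fin (k + 1)) :
    coord M k p (j, i) = ∫ x in M.lo j..M.hi j, (p j).eval x * (cellBasis M k j i).eval x := rfl

theorem broken_coord {p : Fin N → ℝ[X]} (hp : ∀ j, (p j).natDegree ≤ k) :
    broken M k (coord M k p) = p := by
  funext j
  conv_rhs => rw [eq_sum_cellLeg (M.lo_lt_hi j) (hp j)]
  rw [Finset.sum_range fun m => C ((2 * (m : ℝ) + 1) / (M.hi j - M.lo j) *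
    ∫ x in M.lo j..M.hi j, (p j).eval x * (cellLeg (M.lo j) (M.hi j) m).eval x) *
      cellLeg (M.lo j) (M.hi j) m]
  refine Finset.sum_congr rfl fun i _ => ?_
  rw [coord_apply, cellBasis, ← mul_assoc, ← C_mul]
  congr 2
  simp only [eval_mul, eval_C, mul_left_comm _ √_]
  rw [intervalIntegral.integral_const_mul, mul_right_comm, Real.mul_self_sqrt]
  · rfl
  · have := M.width_pos j
    positivity

theorem coord_sub (p q : Fin N → ℝ[X]) : coord M k (p - q) = coord M k p - coord M k q := by
  ext ⟨j, i⟩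
  rw [PiLp.sub_apply]
  simp only [coord_apply, Pi.sub_apply, eval_sub, sub_mul]
  exact intervalIntegral.integral_sub
    (intervalIntegrable_mul_eval (intervalIntegrable_eval _ _ _) _)
    (intervalIntegrable_mul_eval (intervalIntegrable_eval _ _ _) _)

theorem inner_coord (p : Fin N → ℝ[X]) (x : EuclideanSpace ℝ (Fin N × Fin (k + 1))) :
    inner ℝ (coord M k p) x =
      ∑ j, ∫ y in M.lo j..M.hi j, (p j).eval y * (broken M k x j).eval y := by
  rw [PiLp.inner_apply, Fintype.sum_prod_type]
  refine Finset.sum_congr rfl fun j _ => ?_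
  simp only [broken, eval_finsetSum, eval_mul, eval_C, Finset.mul_sum]
  rw [intervalIntegral.integral_finsetSum fun i _ => (by fun_prop : Continuous fun y =>
    (p j).eval y * (x (j, i) * (cellBasis M k j i).eval y)).intervalIntegrable _ _]
  refine Finset.sum_congr rfl fun i _ => ?_
  rw [coord_apply]
  simp only [mul_left_comm _ (x (j, i))]
  rw [intervalIntegral.integral_const_mul]
  simp

theorem sq_norm_coord {p : Fin N → ℝ[X]} (hp : ∀ j, (p j).natDegree ≤ k) :
    ‖coord M k p‖ ^ 2 = ∑ j, ∫ y in M.lo j..M.hi j, (p j).eval y * (p j).eval y := by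
  rw [← real_inner_self_eq_norm_sq, inner_coord, broken_coord M k hp]

theorem broken_add (x y : EuclideanSpace ℝ (Fin N × Fin (k + 1))) :
    broken M k (x + y) = broken M k x + broken M k y := by
  funext j
  simp [broken, add_mul, Finset.sum_add_distrib]

theorem broken_smul (a : ℝ) (x : EuclideanSpace ℝ (Fin N × Fin (k + 1))) :
    broken M k (a • x) = a • broken M k x := by
  funext j
  simp [broken, Finset.smul_sum, smul_eq_C_mul, mul_assoc]

/-- The discrete derivative as an operator on `V_h`. -/
def fluxOp (fl : Flux) (bc : Boundary) :
    EuclideanSpace ℝ (Fin N × Fin (k + 1)) →ₗ[ℝ] EuclideanSpace ℝ (Fin N × Fin (k + 1)) where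
  toFun x := WithLp.toLp 2 fun ji => fluxForm M fl bc (broken M k x) ji.1 (cellBasis M k ji.1 ji.2)
  map_add' x y := by
    ext ji
    simp [broken_add, fluxForm_add]
  map_smul' a x := by
    ext ji
    simp [broken_smul, fluxForm_smul]

theorem fluxOp_apply (fl : Flux) (bc : Boundary) (x : EuclideanSpace ℝ (Fin N × Fin (k + 1)))
    (j : Fin N) (i : Fin (k + 1)) : fluxOp M k fl bc x (j, i) =
      fluxForm M fl bc (broken M k x) j (cellBasis M k j i) := rfl

theorem inner_fluxOp (fl : Flux) (bc : Boundary) (x y : EuclideanSpace ℝ (Fin N × Fin (k + 1))) :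
    inner ℝ (fluxOp M k fl bc x) y =
      ∑ j, fluxForm M fl bc (broken M k x) j (broken M k y j) := by
  rw [PiLp.inner_apply, Fintype.sum_prod_type]
  refine Finset.sum_congr rfl fun j _ => ?_
  rw [fluxForm, show broken M k y j = ∑ i, C (y (j, i)) * cellBasis M k j i from rfl, cellForm_sum]
  refine Finset.sum_congr rfl fun i _ => ?_
  rw [fluxOp_apply, fluxForm]
  simp

/-- The adjoint of the discrete derivative is minus the discrete derivative for the other fluxes. -/
theorem inner_fluxOp_eq (fl : Flux) (bc : Boundary)
    (x y : EuclideanSpace ℝ (Fin N × Fin (k + 1))) :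
    inner ℝ (fluxOp M k fl bc x) y = inner ℝ x ((-fluxOp M k fl.swap bc) y) := by
  rw [LinearMap.neg_apply, inner_neg_right, real_inner_comm _ x, inner_fluxOp, inner_fluxOp,
    sum_fluxForm_add]

end Space

/-! ### The error equations -/

theorem Flux.parity_zero (fl : Flux) : fl.parity 0 = fl := by simp [Flux.parity]

theorem Flux.parity_succ (fl : Flux) (p : ℕ) : fl.parity (p + 1) = (fl.parity p).swap := by
  rcases Nat.mod_two_eq_zero_or_one p with h | h
  · have h' : (p + 1) % 2 = 1 := by omega
    simp [Flux.parity, h, h']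
  · have h' : (p + 1) % 2 = 0 := by omega
    simp [Flux.parity, h, h']

section Interp

variable {N : ℕ} (M : Mesh N) (k : ℕ) (fl : Flux) (D : ℕ → ℝ → ℝ)

/-- The corrected interpolant of `D p`, where `D (p + 1), …, D (p + k)` are the next derivatives:
for `p = 0` it is `u_I`, for `p = 1` it is the corresponding interpolant of `q`, and
for `p = 2` it is the time derivative of `u_I`. -/
def interp (p : ℕ) : Fin N → ℝ[X] := fun j =>
  corrected k (M.lo j) (M.hi j) (fl.parity p) (D p) fun l =>
    radauCoeff k (M.lo j) (M.hi j) (fl.parity (p + l)) (D (p + l))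

/-- The correction of order `k` of `D p`; it is what remains in the error equations. -/
def remainder (p : ℕ) : Fin N → ℝ[X] := fun j =>
  C ((M.width j / 2) ^ k * radauCoeff k (M.lo j) (M.hi j) (fl.parity (p + k)) (D (p + k))) *
    corr k (M.lo j) (M.hi j) k (fl.parity p)

variable {D} {n : ℕ} {α β m : ℝ} {f : ℝ → ℝ}

theorem natDegree_interp_le {p : ℕ} (hp : Continuous (D p)) (j : Fin N) :
    (interp M k fl D p j).natDegree ≤ k :=
  natDegree_corrected_le (M.lo_lt_hi j) _ (hp.intervalIntegrable _ _) _

theorem natDegree_remainder_le (p : ℕ) (j : Fin N) : (remainder M k fl D p j).natDegree ≤ k :=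
  (natDegree_C_mul_le _ _).trans (natDegree_corr_le (M.lo_lt_hi j) _ _)

theorem eval_interp_endpoint {p : ℕ} (hp : Continuous (D p)) (j : Fin N) :
    (interp M k fl D p j).eval ((fl.parity p).endpoint (M.lo j) (M.hi j)) =
      D p ((fl.parity p).endpoint (M.lo j) (M.hi j)) :=
  eval_corrected_endpoint (M.lo_lt_hi j) _ (hp.intervalIntegrable _ _) _

/-- The interpolants of consecutive derivatives satisfy the discrete equation up to the
remainder. -/
theorem integral_interp_succ {k : ℕ} (hk : 1 ≤ k) (h : IsClassicalRep α β n m f D) {p : ℕ}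
    (hp : p + 1 ≤ n) (j : Fin N) {w : ℝ[X]} (hw : w.natDegree ≤ k) :
    ∫ x in M.lo j..M.hi j, (interp M k fl D (p + 1) j).eval x * w.eval x =
      -cellForm M (fun i => D p (M.node i)) (interp M k fl D p j) j w -
        ∫ x in M.lo j..M.hi j, (remainder M k fl D (p + 1) j).eval x * w.eval x := by
  have hc := h.continuous (i := p) (by omega)
  have hc' := h.continuous hp
  have key := integral_corrected_add hk (M.lo_lt_hi j) (fl.parity p) (v := D p) (v' := D (p + 1))
    (e := fun l => radauCoeff k (M.lo j) (M.hi j) (fl.parity (p + l)) (D (p + l)))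
    (hc.intervalIntegrable _ _) (hc'.intervalIntegrable _ _)
    (by simp only [Flux.parity_succ]) hw
  have hibp := intervalIntegral.integral_deriv_mul_eq_sub (a := M.lo j) (b := M.hi j)
    (u := D p) (u' := D (p + 1)) (v := fun x => w.eval x) (v' := fun x => w.derivative.eval x)
    (fun x _ => h.hasDerivAt p (by omega) x) (fun x _ => w.hasDerivAt x)
    (hc'.intervalIntegrable _ _) (intervalIntegrable_eval _ _ _)
  rw [intervalIntegral.integral_add (intervalIntegrable_mul_eval (hc'.intervalIntegrable _ _) _)
    (intervalIntegrable_mul_eval (hc.intervalIntegrable _ _) _)] at hibp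
  have e1 : interp M k fl D (p + 1) j = corrected k (M.lo j) (M.hi j) (fl.parity p).swap (D (p + 1))
      fun l => radauCoeff k (M.lo j) (M.hi j) (fl.parity (p + (l + 1))) (D (p + (l + 1))) := by
    rw [interp, Flux.parity_succ]
    congr 1
    funext l
    rw [show p + 1 + l = p + (l + 1) by ring]
  have e2 : ∫ x in M.lo j..M.hi j, (remainder M k fl D (p + 1) j).eval x * w.eval x =
      ((M.hi j - M.lo j) / 2) ^ k * radauCoeff k (M.lo j) (M.hi j) (fl.parity (p + (k + 1)))
        (D (p + (k + 1))) * ∫ x in M.lo j..M.hi j,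
          (corr k (M.lo j) (M.hi j) k (fl.parity p).swap).eval x * w.eval x := by
    rw [← intervalIntegral.integral_const_mul, remainder, Flux.parity_succ,
      show p + 1 + k = p + (k + 1) by ring]
    congr 1
    funext x
    rw [eval_mul, eval_C, mul_assoc]
    rfl
  rw [e1, e2, cellForm]
  have e3 : interp M k fl D p j = corrected k (M.lo j) (M.hi j) (fl.parity p) (D p) fun l =>
    radauCoeff k (M.lo j) (M.hi j) (fl.parity (p + l)) (D (p + l)) := rfl
  rw [e3]
  have e4 : M.node j.succ = M.hi j := rfl
  have e5 : M.node j.castSucc = M.lo j := rfl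
  rw [e4, e5]
  linarith

theorem remainder_sub {D D' : ℕ → ℝ → ℝ} {p : ℕ} (hD : Continuous (D (p + k)))
    (hD' : Continuous (D' (p + k))) :
    remainder M k fl (fun i x => D i x - D' i x) p =
      remainder M k fl D p - remainder M k fl D' p := by
  funext j
  simp only [remainder, Pi.sub_apply]
  rw [radauCoeff_sub _ (hD.intervalIntegrable _ _) (hD'.intervalIntegrable _ _), ← sub_mul, ← C_sub,
    mul_sub]

theorem sum_integral_cells {g : ℝ → ℝ} (hg : ∀ x y, IntervalIntegrable g volume x y) :
    ∑ j, ∫ x in M.lo j..M.hi j, g x = ∫ x in (0 : ℝ)..2 * Real.pi, g x := by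
  have h : ∀ j, ∫ x in M.lo j..M.hi j, g x =
      (∫ x in (0 : ℝ)..M.node j.succ, g x) - ∫ x in (0 : ℝ)..M.node j.castSucc, g x := fun j =>
    (intervalIntegral.integral_interval_sub_left (hg _ _) (hg _ _)).symm
  simp only [h, Finset.sum_sub_distrib]
  have s1 := Fin.sum_univ_succ fun i => ∫ x in (0 : ℝ)..M.node i, g x
  have s2 := Fin.sum_univ_castSucc fun i => ∫ x in (0 : ℝ)..M.node i, g x
  rw [M.first, intervalIntegral.integral_same] at s1
  rw [M.last] at s2
  linarith

theorem Mesh.width_le_size (j : Fin N) : M.width j ≤ M.size :=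
  le_ciSup (f := fun j => M.width j) (Set.finite_range _).bddAbove j

/-- The remainder of `∂_x^p u` is of order `2 k + 1`: a factor `h^k` comes from its definition and
`h^(k+1)` from the Gauss–Radau coefficient. -/
theorem exists_sq_norm_remainder_le : ∃ C : ℝ, 1 ≤ C ∧ ∀ {n : ℕ} {α β m : ℝ} {f : ℝ → ℝ}
    {D : ℕ → ℝ → ℝ}, IsClassicalRep α β n m f D → ∀ {p : ℕ}, p + 2 * k ≤ n → ∀ {N : ℕ}
    (M : Mesh N) (fl : Flux), ‖coord M k (remainder M k fl D p)‖ ^ 2 ≤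
      C * M.size ^ (4 * k + 2) * ∫ x in (0 : ℝ)..2 * Real.pi, D (p + 2 * k + 1) x ^ 2 := by
  obtain ⟨c, hc1, hc⟩ := exists_corr_bound k k
  obtain ⟨c', hc1', hc'⟩ := exists_sq_radauCoeff_rep_le k
  refine ⟨c' * c ^ 2, one_le_mul_of_one_le_of_one_le hc1' (one_le_pow₀ hc1), ?_⟩
  intro n α β m f D h p hp N M fl
  have hsq : ∀ x y, IntervalIntegrable (fun x => D (p + 2 * k + 1) x ^ 2) volume x y := by
    intro x y
    rcases hp.lt_or_eq with hp | rfl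
    · exact ((h.continuous (by omega)).pow 2).intervalIntegrable _ _
    · exact h.sq_intervalIntegrable _ _
  rw [sq_norm_coord M k (natDegree_remainder_le M k fl p), ← sum_integral_cells M hsq,
    Finset.mul_sum]
  refine Finset.sum_le_sum fun j _ => ?_
  have hw := M.width_pos j
  set I := ∫ x in M.lo j..M.hi j, D (p + 2 * k + 1) x ^ 2 with hI
  have hI0 : 0 ≤ I :=
    intervalIntegral.integral_nonneg (M.lo_lt_hi j).le fun x _ => sq_nonneg _
  set e := radauCoeff k (M.lo j) (M.hi j) (fl.parity (p + k)) (D (p + k)) with he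
  have h1 : e ^ 2 ≤ c' * M.width j ^ (2 * k + 1) * I := by
    have := hc' h (j := p + k) (by omega) _ _ (M.lo_lt_hi j) (fl.parity (p + k))
    rwa [show p + k + k + 1 = p + 2 * k + 1 by ring] at this
  have h2 : ∫ x in M.lo j..M.hi j,
      (remainder M k fl D p j).eval x * (remainder M k fl D p j).eval x =
      ((M.width j / 2) ^ k * e) ^ 2 * ∫ x in M.lo j..M.hi j,
        (corr k (M.lo j) (M.hi j) k (fl.parity p)).eval x *
          (corr k (M.lo j) (M.hi j) k (fl.parity p)).eval x := by
    rw [← intervalIntegral.integral_const_mul]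
    congr 1
    funext x
    rw [remainder, eval_mul, eval_C]
    ring
  have h3 := abs_integral_mul_le (M.lo_lt_hi j) (hc _ _ (M.lo_lt_hi j) (fl.parity p))
    (hc _ _ (M.lo_lt_hi j) (fl.parity p))
  rw [h2]
  calc _ ≤ ((M.width j / 2) ^ k * e) ^ 2 * (c * c * M.width j) := by
        gcongr
        exact (le_abs_self _).trans h3
    _ = (M.width j / 2) ^ (2 * k) * e ^ 2 * (c ^ 2 * M.width j) := by ring
    _ ≤ M.width j ^ (2 * k) * (c' * M.width j ^ (2 * k + 1) * I) * (c ^ 2 * M.width j) := by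
        gcongr
        linarith
    _ = c' * c ^ 2 * M.width j ^ (4 * k + 2) * I := by ring
    _ ≤ c' * c ^ 2 * M.size ^ (4 * k + 2) * I := by
        gcongr
        exact M.width_le_size j

end Interp

section Time

variable {N k n : ℕ} {T m : ℝ} {u : ℝ → ℝ → ℝ} {D : ℝ → ℕ → ℝ → ℝ}

theorem hasDerivWithinAt_coord {p : ℝ → Fin N → ℝ[X]} {M : Mesh N} {S : Set ℝ} {s : ℝ}
    {y : EuclideanSpace ℝ (Fin N × Fin (k + 1))}
    (h : ∀ j i, HasDerivWithinAt (fun r => ∫ x in M.lo j..M.hi j,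
      (p r j).eval x * (cellBasis M k j i).eval x) (y (j, i)) S s) :
    HasDerivWithinAt (fun r => coord M k (p r)) y S s := by
  have h1 : HasDerivWithinAt (fun r => (coord M k (p r)).ofLp) y.ofLp S s :=
    hasDerivWithinAt_pi.2 fun ji => h ji.1 ji.2
  exact (PiLp.continuousLinearEquiv 2 ℝ
    fun _ : Fin N × Fin (k + 1) => ℝ).symm.hasFDerivAt.comp_hasDerivWithinAt s h1

/-- Since `∂_t = ∂_x²`, the time derivative of the remainder of `∂_x^p u` is that of
`∂_x^(p+2) u`. -/
theorem hasDerivWithinAt_coord_remainder (M : Mesh N) (fl : Flux) (hu : IsHeatSolution T u)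
    (hD : ∀ s ∈ Icc 0 T, IsClassicalRep 0 (2 * Real.pi) n m (fun x => u x s) (D s)) (hm : 0 < m)
    {p : ℕ} (hp : p + k + 2 ≤ n) {s : ℝ} (hs : s ∈ Icc 0 T) :
    HasDerivWithinAt (fun r => coord M k (remainder M k fl (D r) p))
      (coord M k (remainder M k fl (D s) (p + 2))) (Icc 0 T) s := by
  refine hasDerivWithinAt_coord fun j i => ?_
  rw [coord_apply]
  simp only [remainder, eval_mul, eval_C, mul_assoc, intervalIntegral.integral_const_mul,
    Flux.parity_add_two, show p + 2 + k = p + k + 2 by ring]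
  exact ((hasDerivWithinAt_radauCoeff k hu hD hm hp (M.zero_le_lo j) (M.lo_lt_hi j) (M.hi_le j) _
    hs).mul_const _).const_mul _

/-- The moments of the projection as a sum with coefficients that are linear in `v`. -/
theorem integral_proj_mul_eq_sum {a b : ℝ} (hab : a < b) (fl : Flux) {v : ℝ → ℝ}
    (hv : IntervalIntegrable v volume a b) (w : ℝ[X]) :
    ∫ x in a..b, (proj k a b fl v).eval x * w.eval x = ∑ l ∈ Finset.range (k + 1),
      projCoeff k a b fl v l * ∫ x in a..b, (cellLeg a b l).eval x * w.eval x := by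
  rw [proj_eq_sum hab fl hv]
  simp only [eval_finsetSum, Finset.sum_mul, eval_mul, eval_C]
  rw [intervalIntegral.integral_finsetSum fun l _ => (by fun_prop : Continuous fun x =>
    projCoeff k a b fl v l * (cellLeg a b l).eval x * w.eval x).intervalIntegrable _ _]
  refine Finset.sum_congr rfl fun l _ => ?_
  rw [← intervalIntegral.integral_const_mul]
  simp only [mul_assoc]

theorem hasDerivWithinAt_coord_interp (M : Mesh N) (fl : Flux) (hu : IsHeatSolution T u)
    (hD : ∀ s ∈ Icc 0 T, IsClassicalRep 0 (2 * Real.pi) n m (fun x => u x s) (D s)) (hm : 0 < m)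
    {p : ℕ} (hp : p + k + 2 ≤ n) {s : ℝ} (hs : s ∈ Icc 0 T) :
    HasDerivWithinAt (fun r => coord M k (interp M k fl (D r) p))
      (coord M k (interp M k fl (D s) (p + 2))) (Icc 0 T) s := by
  refine hasDerivWithinAt_coord fun j i => ?_
  rw [coord_apply]
  have hformula : ∀ p, p ≤ n → ∀ r ∈ Icc 0 T, ∫ x in M.lo j..M.hi j,
      (interp M k fl (D r) p j).eval x * (cellBasis M k j i).eval x =
      (∑ l ∈ Finset.range (k + 1), projCoeff k (M.lo j) (M.hi j) (fl.parity p) (D r p) l *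
        ∫ x in M.lo j..M.hi j, (cellLeg (M.lo j) (M.hi j) l).eval x * (cellBasis M k j i).eval x) -
      ∑ l ∈ Finset.Icc 1 k, ((M.hi j - M.lo j) / 2) ^ l *
        radauCoeff k (M.lo j) (M.hi j) (fl.parity (p + l)) (D r (p + l)) *
          ∫ x in M.lo j..M.hi j, (corr k (M.lo j) (M.hi j) l (fl.parity p)).eval x *
            (cellBasis M k j i).eval x := by
    intro p hp r hr
    rw [interp, integral_corrected_mul, integral_proj_mul_eq_sum (M.lo_lt_hi j) _
      (((hD r hr).continuous hp).intervalIntegrable _ _)]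
  rw [hformula (p + 2) (by omega) s hs]
  refine HasDerivWithinAt.congr ?_ (fun r hr => hformula p (by omega) r hr)
    (hformula p (by omega) s hs)
  have hlo := M.zero_le_lo j
  have hlh := M.lo_lt_hi j
  have hhi := M.hi_le j
  simp only [Flux.parity_add_two]
  refine HasDerivWithinAt.sub (HasDerivWithinAt.fun_sum fun l _ => ?_)
    (HasDerivWithinAt.fun_sum fun l hl => ?_)
  · exact (hasDerivWithinAt_projCoeff k hu hD hm (by omega) hlo hlh hhi _ l hs).mul_const _
  · have hl := (Finset.mem_Icc.1 hl).2
    rw [show p + 2 + l = p + l + 2 by ring, Flux.parity_add_two]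
    exact ((hasDerivWithinAt_radauCoeff k hu hD hm (by omega) hlo hlh hhi _ hs).const_mul
      _).mul_const _

theorem hasDerivWithinAt_integral_of_coeff {p : ℝ → ℝ[X]} (hT : 0 < T)
    (hp : ∀ s ∈ Icc 0 T, (p s).natDegree ≤ k)
    (hd : ∀ i, DifferentiableOn ℝ (fun s => (p s).coeff i) (Icc 0 T)) (a b : ℝ) (w : ℝ[X]) {s : ℝ}
    (hs : s ∈ Icc 0 T) :
    HasDerivWithinAt (fun s => ∫ x in a..b, (p s).eval x * w.eval x)
      (∫ x in a..b, derivWithin (fun s => (p s).eval x) (Icc 0 T) s * w.eval x) (Icc 0 T) s := by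
  have he : ∀ x, ∀ s ∈ Icc 0 T, (p s).eval x = ∑ i ∈ Finset.range (k + 1), (p s).coeff i * x ^ i :=
    fun x s hs => eval_eq_sum_range' (Nat.lt_succ_of_le (hp s hs)) x
  have hd' : ∀ i, HasDerivWithinAt (fun s => (p s).coeff i)
      (derivWithin (fun s => (p s).coeff i) (Icc 0 T) s) (Icc 0 T) s := fun i =>
    ((hd i) s hs).hasDerivWithinAt
  have hx : ∀ x, derivWithin (fun s => (p s).eval x) (Icc 0 T) s =
      ∑ i ∈ Finset.range (k + 1), derivWithin (fun s => (p s).coeff i) (Icc 0 T) s * x ^ i := by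
    intro x
    refine HasDerivWithinAt.derivWithin ?_ (uniqueDiffOn_Icc hT s hs)
    exact (HasDerivWithinAt.fun_sum fun i _ => (hd' i).mul_const _).congr (he x) (he x s hs)
  have hint : ∀ c : ℕ → ℝ, ∫ x in a..b, (∑ i ∈ Finset.range (k + 1), c i * x ^ i) * w.eval x =
      ∑ i ∈ Finset.range (k + 1), c i * ∫ x in a..b, x ^ i * w.eval x := by
    intro c
    simp only [Finset.sum_mul]
    rw [intervalIntegral.integral_finsetSum fun i _ => (by fun_prop : Continuous fun x =>
      c i * x ^ i * w.eval x).intervalIntegrable _ _]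
    refine Finset.sum_congr rfl fun l _ => ?_
    rw [← intervalIntegral.integral_const_mul]
    simp only [mul_assoc]
  have hF : ∀ s ∈ Icc 0 T, ∫ x in a..b, (p s).eval x * w.eval x =
      ∑ i ∈ Finset.range (k + 1), (p s).coeff i * ∫ x in a..b, x ^ i * w.eval x := by
    intro s hs
    rw [← hint]
    simp only [he _ s hs]
  simp only [hx]
  rw [hint]
  exact (HasDerivWithinAt.fun_sum fun i _ => (hd' i).mul_const _).congr hF (hF s hs)

theorem proj_congr {a b : ℝ} (hab : a < b) (fl : Flux) {v v' : ℝ → ℝ}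
    (h : ∀ x ∈ Icc a b, v x = v' x) (hv : IntervalIntegrable v volume a b) :
    proj k a b fl v = proj k a b fl v' := by
  have hv' : IntervalIntegrable v' volume a b := hv.congr fun x hx => h x (by
    rw [uIoc_of_le hab.le] at hx; exact ⟨hx.1.le, hx.2⟩)
  rw [proj_eq_sum hab fl hv, proj_eq_sum hab fl hv']
  refine Finset.sum_congr rfl fun l _ => ?_
  congr 2
  rw [projCoeff, projCoeff, radauCoeff_congr hab fl h]
  congr 2
  refine intervalIntegral.integral_congr fun x hx => ?_
  rw [uIcc_of_le hab.le] at hx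
  simp only [h x hx]

/-- The special initial value is an interpolant of the family `interp`. -/
theorem interpolant_eq_interp (M : Mesh N) (fl : Flux) (hT : 0 < T) (hu : IsHeatSolution T u)
    (hD : ∀ s ∈ Icc 0 T, IsClassicalRep 0 (2 * Real.pi) n m (fun x => u x s) (D s)) (hm : 0 < m)
    (hk : k ≤ n) {s : ℝ} (hs : s ∈ Icc 0 T) (j : Fin N) :
    interpolant k k (M.lo j) (M.hi j) T u s fl = interp M k fl (D s) 0 j := by
  have hlo := M.zero_le_lo j
  have hlh := M.lo_lt_hi j
  have hhi := M.hi_le j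
  rw [interpolant_eq, interp, corrected, corrected, Flux.parity_zero]
  have h0 : ∀ x ∈ Icc (M.lo j) (M.hi j), D s 0 x = u x s := fun x hx =>
    (hD s hs).zero x ⟨hlo.trans hx.1, hx.2.trans hhi⟩
  rw [proj_congr hlh fl h0 (((hD s hs).continuous (Nat.zero_le _)).intervalIntegrable _ _)]
  congr 1
  refine Finset.sum_congr rfl fun l hl => ?_
  have hl := (Finset.mem_Icc.1 hl).2
  rw [corrCoeff_eq k hT hu hD hm hlo hlh hhi fl (hl.trans hk) hs, zero_add]

end Time

section ErrorEquation

variable {N k n : ℕ} {T m : ℝ} {u : ℝ → ℝ → ℝ} {D : ℝ → ℕ → ℝ → ℝ} {M : Mesh N} {fl : Flux}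
  {bc : Boundary} {uh qh : ℝ → Fin N → ℝ[X]}

theorem Mesh.node_mem (M : Mesh N) (i : Fin (N + 1)) : M.node i ∈ Icc 0 (2 * Real.pi) := by
  constructor
  · rw [← M.first]; exact M.strictMono.monotone (Fin.zero_le _)
  · rw [← M.last]; exact M.strictMono.monotone (Fin.le_last _)

/-- The nodal error `u - û_h` is the flux of `u_I - u_h` for zero boundary data, since the
interpolant is exact at the nodes from the side of the flux. -/
theorem errU_eq (hbc : SatisfiesBoundary T u fl bc) {s : ℝ} (hs : s ∈ Icc 0 T)
    (hD : IsClassicalRep 0 (2 * Real.pi) n m (fun x => u x s) (D s)) (i : Fin (N + 1)) :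
    errU M fl bc u uh s i = fluxU M 0 (interp M k fl (D s) 0 - uh s) fl bc.homogeneous i := by
  have h0 : (0 : ℝ) ∈ Icc 0 (2 * Real.pi) := ⟨le_rfl, by positivity⟩
  have h2 : 2 * Real.pi ∈ Icc 0 (2 * Real.pi) := ⟨by positivity, le_rfl⟩
  have e := fluxU_eq_of_interp M (t := s) (f := D s 0) (v := interp M k fl (D s) 0) (fl := fl)
    (bc := bc)
    (fun j => by
      have := eval_interp_endpoint M k fl (hD.continuous (Nat.zero_le _)) j
      rwa [Flux.parity_zero] at this)
    (by
      have e0 := hD.zero _ h0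
      have e2 := hD.zero _ h2
      cases fl <;> cases bc <;> simp only [SatisfiesBoundary] at hbc <;> simp only [e0, e2]
      · exact (hbc s hs).1
      · exact (hbc s hs).1
      · exact (hbc s hs).1
      · exact (hbc s hs).2) i
  rw [← fluxU_sub M s, e, errU, hD.zero _ (M.node_mem i)]

/-- The nodal error `q - q̂_h` is the flux of the interpolation error of `q_h` for zero
boundary data. -/
theorem errQ_eq (hbc : SatisfiesBoundary T u fl bc) {s : ℝ} (hs : s ∈ Icc 0 T) (hn : 1 ≤ n)
    (hD : IsClassicalRep 0 (2 * Real.pi) n m (fun x => u x s) (D s)) (i : Fin (N + 1)) :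
    errQ M fl bc u qh s i = fluxU M 0 (interp M k fl (D s) 1 - qh s) fl.swap bc.homogeneous i := by
  have h0 : (0 : ℝ) ∈ Icc 0 (2 * Real.pi) := ⟨le_rfl, by positivity⟩
  have h2 : 2 * Real.pi ∈ Icc 0 (2 * Real.pi) := ⟨by positivity, le_rfl⟩
  have e := fluxU_eq_of_interp M (t := s) (f := D s 1) (v := interp M k fl (D s) 1)
    (fl := fl.swap) (bc := bc)
    (fun j => by
      have := eval_interp_endpoint M k fl (hD.continuous hn) j
      rwa [Flux.parity_succ, Flux.parity_zero] at this)
    (by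
      have e0 := dx_eq hD hn h0
      have e2 := dx_eq hD hn h2
      cases fl <;> cases bc <;> simp only [SatisfiesBoundary] at hbc <;>
        simp only [Flux.swap, ← e0, ← e2]
      · exact (hbc s hs).2
      · exact (hbc s hs).2
      · exact (hbc s hs).2
      · exact (hbc s hs).1) i
  rw [← fluxU_sub M s, e, errQ, dx_eq hD hn (M.node_mem i), fluxQ_eq]

/-- The error equation for `q`: `η = -(B ξ + r)`, with the discrete derivative `B` and the
remainder `r` of `u_x`. -/
theorem coord_err_q (hk : 1 ≤ k) (hn : 1 ≤ n) (hbc : SatisfiesBoundary T u fl bc)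
    (hL : IsLDGSolution k M T fl bc uh qh) {s : ℝ} (hs : s ∈ Icc 0 T)
    (hD : IsClassicalRep 0 (2 * Real.pi) n m (fun x => u x s) (D s)) :
    coord M k (interp M k fl (D s) 1 - qh s) =
      -(fluxOp M k fl bc (coord M k (interp M k fl (D s) 0 - uh s)) +
        coord M k (remainder M k fl (D s) 1)) := by
  have hdeg : ∀ j, ((interp M k fl (D s) 0 - uh s) j).natDegree ≤ k := fun j =>
    (natDegree_sub_le _ _).trans (max_le
      (natDegree_interp_le M k fl (hD.continuous (Nat.zero_le _)) j)
      (hL.degree_u s hs j))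
  ext ⟨j, i⟩
  rw [PiLp.neg_apply, PiLp.add_apply, fluxOp_apply, broken_coord M k hdeg, coord_sub,
    PiLp.sub_apply, coord_apply, coord_apply, coord_apply,
    integral_interp_succ M fl hk hD (by omega) j (natDegree_cellBasis_le M k j i),
    hL.scheme_q s hs j _ (natDegree_cellBasis_le M k j i)]
  have e := cellForm_sub M (fun i => D s 0 (M.node i)) (fluxU M s (uh s) fl bc)
    (interp M k fl (D s) 0 j) (uh s j) j (cellBasis M k j i)
  have e' : (fun i => D s 0 (M.node i) - fluxU M s (uh s) fl bc i) =
      fluxU M 0 (interp M k fl (D s) 0 - uh s) fl bc.homogeneous := by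
    funext i
    rw [← errU_eq hbc hs hD i, errU, hD.zero _ (M.node_mem i)]
  rw [e'] at e
  rw [fluxForm, Pi.sub_apply, ← e]
  simp only [cellForm]
  ring

/-- The error equation for `u`: `ξ' = -B*(B ξ + r) - σ'`, where the remainder `σ'` of `u_xx = u_t`
is the time derivative of the remainder `σ` of `u`. -/
theorem hasDerivWithinAt_coord_err_u (hk : 1 ≤ k) (hn : k + 2 ≤ n) (hT : 0 < T)
    (hu : IsHeatSolution T u) (hbc : SatisfiesBoundary T u fl bc)
    (hD : ∀ s ∈ Icc 0 T, IsClassicalRep 0 (2 * Real.pi) n m (fun x => u x s) (D s)) (hm : 0 < m)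
    (hL : IsLDGSolution k M T fl bc uh qh) {s : ℝ} (hs : s ∈ Icc 0 T) :
    HasDerivWithinAt (fun s => coord M k (interp M k fl (D s) 0 - uh s))
      (-((-fluxOp M k fl.swap bc) (fluxOp M k fl bc (coord M k (interp M k fl (D s) 0 - uh s)) +
        coord M k (remainder M k fl (D s) 1))) - coord M k (remainder M k fl (D s) 2))
      (Icc 0 T) s := by
  have hq := coord_err_q (n := n) hk (by omega) hbc hL hs (hD s hs)
  rw [eq_neg_iff_add_eq_zero, add_eq_zero_iff_neg_eq] at hq
  rw [← hq, LinearMap.neg_apply, map_neg, neg_neg]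
  simp only [coord_sub]
  have h1 := hasDerivWithinAt_coord_interp M fl hu hD hm (k := k) (p := 0) (by omega) hs
  have h2 : HasDerivWithinAt (fun r => coord M k (uh r)) (WithLp.toLp 2 fun ji =>
      ∫ x in M.lo ji.1..M.hi ji.1, derivWithin (fun s => (uh s ji.1).eval x) (Icc 0 T) s *
        (cellBasis M k ji.1 ji.2).eval x) (Icc 0 T) s :=
    hasDerivWithinAt_coord fun j i => hasDerivWithinAt_integral_of_coeff (k := k) hT
      (fun s hs => hL.degree_u s hs j) (hL.differentiable j) _ _ _ hs
  refine (h1.sub h2).congr_deriv ?_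
  have hdeg : ∀ j, ((interp M k fl (D s) 1 - qh s) j).natDegree ≤ k := fun j =>
    (natDegree_sub_le _ _).trans (max_le (natDegree_interp_le M k fl
      ((hD s hs).continuous (by omega)) j) (hL.degree_q s hs j))
  ext ⟨j, i⟩
  rw [← coord_sub, PiLp.sub_apply, PiLp.sub_apply, PiLp.neg_apply, fluxOp_apply,
    broken_coord M k hdeg, coord_apply, coord_apply,
    integral_interp_succ M fl hk (hD s hs) (by omega) j (natDegree_cellBasis_le M k j i)]
  dsimp only
  rw [hL.scheme_u s hs j _ (natDegree_cellBasis_le M k j i)]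
  have e := cellForm_sub M (fun i => D s 1 (M.node i)) (fluxQ M s (qh s) fl bc)
    (interp M k fl (D s) 1 j) (qh s j) j (cellBasis M k j i)
  have e' : (fun i => D s 1 (M.node i) - fluxQ M s (qh s) fl bc i) =
      fluxU M 0 (interp M k fl (D s) 1 - qh s) fl.swap bc.homogeneous := by
    funext i
    rw [← errQ_eq hbc hs (by omega) (hD s hs) i, errQ, dx_eq (hD s hs) (by omega) (M.node_mem i)]
  rw [e'] at e
  rw [fluxForm, Pi.sub_apply, ← e]
  simp only [cellForm]
  ring

end ErrorEquation

theorem IsHeatSolution.mono {T t : ℝ} {u : ℝ → ℝ → ℝ} (hu : IsHeatSolution T u) (h : t ≤ T) :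
    IsHeatSolution t u where
  continuousOn := hu.continuousOn.mono (prod_mono_right (Icc_subset_Icc_right h))
  contDiffOn s hs := hu.contDiffOn s ⟨hs.1, hs.2.trans h⟩
  heat s hs x hx := (hu.heat s ⟨hs.1, hs.2.trans h⟩ x hx).mono (Icc_subset_Icc_right h)

theorem Mesh.size_pos {N : ℕ} (M : Mesh N) : 0 < M.size := by
  obtain ⟨n, rfl⟩ := M.exists_eq_add_one
  exact (M.width_pos 0).trans_le (M.width_le_size 0)

/-- The supercloseness estimate: the distance in `L²(0, 2π)` between the LDG solution and the
corrected interpolants. -/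
theorem exists_supercloseness (k : ℕ) (hk : 1 ≤ k) : ∃ C : ℝ, 1 ≤ C ∧ ∀ {T m Z : ℝ} {u : ℝ → ℝ → ℝ}
    {D : ℝ → ℕ → ℝ → ℝ} {N : ℕ} {M : Mesh N} {fl : Flux} {bc : Boundary}
    {uh qh : ℝ → Fin N → ℝ[X]}, 0 < T → IsHeatSolution T u → SatisfiesBoundary T u fl bc →
    (∀ s ∈ Icc 0 T, IsClassicalRep 0 (2 * Real.pi) (2 * k + 1) m (fun x => u x s) (D s)) → 0 < m →
    IsLDGSolution k M T fl bc uh qh →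
    (∀ j, uh 0 j = interpolant k k (M.lo j) (M.hi j) T u 0 fl) → ∀ t ∈ Icc 0 T, 0 < Z →
    (∀ s ∈ Icc 0 t, IsClassicalRep 0 (2 * Real.pi) (2 * k + 1) Z (fun x => u x s) (D s)) →
    ‖coord M k (interp M k fl (D t) 0 - uh t)‖ ≤ C * M.size ^ (2 * k + 1) * Z * (1 + t) ∧
    ‖coord M k (interp M k fl (D t) 1 - qh t)‖ ≤ C * M.size ^ (2 * k + 1) * Z * (1 + √t) := by
  obtain ⟨C₁, hC₁, hrem⟩ := exists_sq_norm_remainder_le k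
  obtain ⟨C₂, hC₂, hmod⟩ := exists_time_modulus
  have hC₁₂ : 1 ≤ 8 * C₁ * C₂ := by nlinarith
  -- large enough for `‖r‖ ≤ e` and for the moduli of `r` and `σ` with `e = A h^(2k+1) Z`
  set A := √(8 * C₁ * C₂) with hA
  have hA2 : A ^ 2 = 8 * C₁ * C₂ := Real.sq_sqrt (by positivity)
  have hA1 : 1 ≤ A := Real.one_le_sqrt.2 hC₁₂
  refine ⟨50 * A, by linarith, ?_⟩
  intro T m Z u D N M fl bc uh qh hT hu hbc hD hm hL hinit t ht hZ hDt
  have hsize := M.size_pos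
  have h0 : (0 : ℝ) ∈ Icc 0 T := ⟨le_rfl, hT.le⟩
  set e := A * M.size ^ (2 * k + 1) * Z with he
  have he0 : 0 < e := by positivity
  have he2 : e ^ 2 = 8 * C₁ * C₂ * M.size ^ (4 * k + 2) * Z ^ 2 := by
    rw [he, mul_pow, mul_pow, hA2]; ring
  set ξ := fun s => coord M k (interp M k fl (D s) 0 - uh s) with hξ
  set r := fun s => coord M k (remainder M k fl (D s) 1) with hr
  set σ := fun s => coord M k (remainder M k fl (D s) 0) with hσ
  have hr0 : ∀ s ∈ Icc 0 t, ‖r s‖ ≤ e := by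
    intro s hs
    refine le_of_sq_le_sq ?_ he0.le
    refine (hrem (hDt s hs) (p := 1) (by omega) M fl).trans ?_
    have h := intervalIntegral.norm_integral_le_of_norm_le_const (a := 0) (b := 2 * Real.pi)
      (f := fun x => D s (1 + 2 * k + 1) x ^ 2) (C := Z ^ 2) (fun x _ => by
        rw [Real.norm_eq_abs, abs_pow, add_comm 1]
        exact pow_le_pow_left₀ (abs_nonneg _) ((hDt s hs).abs_top_le x) 2)
    rw [sub_zero, abs_of_pos (by positivity), Real.norm_eq_abs] at h
    have h' := (le_abs_self _).trans h
    calc _ ≤ C₁ * M.size ^ (4 * k + 2) * (Z ^ 2 * (2 * Real.pi)) := by gcongr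
      _ ≤ C₁ * M.size ^ (4 * k + 2) * (Z ^ 2 * (8 * C₂)) := by
          have : 2 * Real.pi ≤ 8 * C₂ := by linarith [Real.pi_lt_four]
          gcongr C₁ * _ * (Z ^ 2 * ?_)
      _ = e ^ 2 := by rw [he2]; ring
  have hξ0 : ξ 0 = 0 := by
    have : interp M k fl (D 0) 0 = uh 0 := funext fun j => by
      rw [hinit j, interpolant_eq_interp M fl hT hu hD hm (by omega) h0]
    simp only [hξ, this, sub_self]
    ext ⟨j, i⟩
    simp [coord_apply]
  have hη : ∀ s ∈ Icc 0 T, ‖coord M k (interp M k fl (D s) 1 - qh s)‖ =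
      ‖fluxOp M k fl bc (ξ s) + r s‖ := fun s hs => by
    rw [coord_err_q hk (by omega) hbc hL hs (hD s hs), norm_neg]
  rw [hη t ht]
  change ‖ξ t‖ ≤ _ ∧ _
  -- at `t = 0` only the remainder contributes
  rcases ht.1.eq_or_lt with rfl | ht0
  · rw [hξ0, norm_zero, map_zero, zero_add]
    refine ⟨by positivity, (hr0 0 ⟨le_rfl, le_rfl⟩).trans ?_⟩
    rw [Real.sqrt_zero, add_zero, mul_one]
    linarith
  have hsub : Icc 0 t ⊆ Icc 0 T := Icc_subset_Icc_right ht.2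
  have htt : t ∈ Icc 0 t := ⟨ht0.le, le_rfl⟩
  set L := 1 + √t with hLd
  have hL1 : 1 ≤ L := by rw [hLd]; linarith [Real.sqrt_nonneg t]
  obtain ⟨k', rfl⟩ := Nat.exists_eq_add_of_le' hk
  have hmod' := fun s (hs : s ∈ Ico 0 t) =>
    hmod (i := 2 * k') (hu.mono ht.2) hDt hZ hs.1 hs.2 le_rfl
  -- the moduli of the derivatives bound squares, hence half of the exponent `1 / 8`
  have hsq : ∀ s ∈ Ico 0 t, (((t - s) / t) ^ (1 / 16 : ℝ)) ^ 2 = ((t - s) / t) ^ (1 / 8 : ℝ) := by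
    intro s hs
    have : 0 ≤ (t - s) / t := div_nonneg (sub_nonneg.2 hs.2.le) ht0.le
    rw [← Real.rpow_natCast, ← Real.rpow_mul this]
    norm_num
  have hdiff : ∀ s ∈ Icc 0 t, ∀ p ≤ 1,
      ‖coord M (k' + 1) (remainder M (k' + 1) fl (D t) p) -
        coord M (k' + 1) (remainder M (k' + 1) fl (D s) p)‖ ^ 2 ≤
      C₁ * M.size ^ (4 * (k' + 1) + 2) * ∫ x in (0 : ℝ)..2 * Real.pi,
        (D t (p + 2 * (k' + 1) + 1) x - D s (p + 2 * (k' + 1) + 1) x) ^ 2 := by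
    intro s hs p hp
    rw [← coord_sub, ← remainder_sub M (k' + 1) fl ((hDt t htt).continuous (by omega))
      ((hDt s hs).continuous (by omega))]
    exact hrem ((hDt t htt).sub (hDt s hs)) (by omega) M fl
  have hrm : ∀ s ∈ Ico 0 t, ‖r t - r s‖ ≤ e * L * ((t - s) / t) ^ (1 / 16 : ℝ) := by
    intro s hs
    have : 0 ≤ (t - s) / t := div_nonneg (sub_nonneg.2 hs.2.le) ht0.le
    refine le_of_sq_le_sq ?_ (by positivity)
    refine (hdiff s ⟨hs.1, hs.2.le⟩ 1 le_rfl).trans ?_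
    rw [show 1 + 2 * (k' + 1) + 1 = 2 * k' + 4 by ring, mul_pow, mul_pow, hsq s hs, he2]
    calc _ ≤ C₁ * M.size ^ (4 * (k' + 1) + 2) *
          (C₂ * Z ^ 2 * L ^ 2 * ((t - s) / t) ^ (1 / 8 : ℝ)) := by gcongr; exact (hmod' s hs).1
      _ ≤ 8 * (C₁ * M.size ^ (4 * (k' + 1) + 2) *
          (C₂ * Z ^ 2 * L ^ 2 * ((t - s) / t) ^ (1 / 8 : ℝ))) :=
          le_mul_of_one_le_left (by positivity) (by norm_num)
      _ = _ := by ring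
  have hσm : ∀ s ∈ Ico 0 t, ‖σ t - σ s‖ ≤ e * L * √(t - s) * ((t - s) / t) ^ (1 / 16 : ℝ) := by
    intro s hs
    have hts : 0 ≤ t - s := sub_nonneg.2 hs.2.le
    have : 0 ≤ (t - s) / t := div_nonneg hts ht0.le
    refine le_of_sq_le_sq ?_ (by positivity)
    refine (hdiff s ⟨hs.1, hs.2.le⟩ 0 zero_le_one).trans ?_
    rw [show 0 + 2 * (k' + 1) + 1 = 2 * k' + 3 by ring, mul_pow, mul_pow, mul_pow, hsq s hs, he2,
      Real.sq_sqrt hts]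
    calc _ ≤ C₁ * M.size ^ (4 * (k' + 1) + 2) *
          (C₂ * Z ^ 2 * L ^ 2 * (t - s) * ((t - s) / t) ^ (1 / 8 : ℝ)) := by
            gcongr; exact (hmod' s hs).2
      _ ≤ 8 * (C₁ * M.size ^ (4 * (k' + 1) + 2) *
          (C₂ * Z ^ 2 * L ^ 2 * (t - s) * ((t - s) / t) ^ (1 / 8 : ℝ))) :=
          le_mul_of_one_le_left (by positivity) (by norm_num)
      _ = _ := by ring
  have hσm' : ∀ s ∈ Ico 0 t, ‖σ t - σ s‖ ≤ e * L * √(t - s) := by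
    intro s hs
    refine (hσm s hs).trans (mul_le_of_le_one_right (by positivity) ?_)
    refine Real.rpow_le_one (div_nonneg (sub_nonneg.2 hs.2.le) ht0.le) ?_ (by norm_num)
    rw [div_le_one ht0]
    linarith [hs.1]
  have hξd := fun s (hs : s ∈ Icc 0 t) =>
    (hasDerivWithinAt_coord_err_u hk (by omega) hT hu hbc hD hm hL (hsub hs)).mono hsub
  have hσd := fun s (hs : s ∈ Icc 0 t) => (hasDerivWithinAt_coord_remainder (k := k' + 1) (p := 0) M
    fl hu hD hm (by omega) (hsub hs)).mono hsub
  have hadj := inner_fluxOp_eq M (k' + 1) fl bc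
  have b1 := norm_le_of_dissipative hadj (ξ := ξ) (r := r) (σ := σ) ht0 he0.le (by linarith) hξ0 hξd
    hσd hr0 hσm'
  have b2 := norm_flux_le_of_dissipative hadj (ξ := ξ) (r := r) (σ := σ) (p := 1 / 16) ht0 he0.le
    (by linarith : 0 ≤ L) (by norm_num) hξ0 hξd hσd (hr0 t htt) hrm hσm
  have hst : √t ^ 2 = t := Real.sq_sqrt ht0.le
  have hst0 := Real.sqrt_nonneg t
  constructor
  · refine b1.trans ?_
    calc e * (2 + 3 * L) * √t = e * (5 * √t + 3 * √t ^ 2) := by rw [hLd]; ring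
      _ ≤ e * (50 * (1 + t)) := by
          gcongr
          nlinarith [sq_nonneg (√t - 1)]
      _ = _ := by rw [he]; ring
  · refine b2.trans ?_
    calc e * (1 + L + 3 * L / (1 / 16)) ≤ e * (50 * (1 + √t)) := by
          gcongr
          rw [hLd]
          linarith
      _ = _ := by rw [he]; ring

/-! ### Nodal errors -/

/-- The number of cells is at least of the order of the inverse mesh size. -/
theorem Mesh.two_pi_le {N : ℕ} (M : Mesh N) : 2 * Real.pi ≤ N * M.size := by
  have h := sum_integral_cells M (g := fun _ => 1) fun x y => by simp
  simp only [intervalIntegral.integral_const, smul_eq_mul, mul_one, sub_zero] at h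
  rw [← h]
  calc ∑ j, (M.hi j - M.lo j) ≤ ∑ _j : Fin N, M.size :=
        Finset.sum_le_sum fun j _ => M.width_le_size j
    _ = N * M.size := by simp

/-- The inverse inequality at the nodes: the sum of the squared fluxes is bounded by the squared
`L²` norm divided by the mesh size. -/
theorem exists_sum_sq_fluxU_le (k : ℕ) : ∃ C : ℝ, 1 ≤ C ∧ ∀ {N : ℕ} {M : Mesh N} {c : ℝ},
    M.QuasiUniform c → ∀ {v : Fin N → ℝ[X]}, (∀ j, (v j).natDegree ≤ k) → ∀ (fl : Flux)
    (bc : Boundary), ∑ i, fluxU M 0 v fl bc.homogeneous i ^ 2 ≤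
      C * |c| * ‖coord M k v‖ ^ 2 / M.size := by
  obtain ⟨C, hC1, hC⟩ := exists_trace_bound k
  refine ⟨2 * C, by linarith, fun {N M c} hc v hv fl bc => ?_⟩
  have hs := M.size_pos
  rw [le_div_iff₀ hs]
  have h1 : ∀ j, (v j).eval (fl.endpoint (M.lo j) (M.hi j)) ^ 2 * M.size ≤
      C * |c| * ∫ y in M.lo j..M.hi j, (v j).eval y * (v j).eval y := by
    intro j
    have h2 := hC _ _ (M.lo_lt_hi j) fl (v j) (hv j)
    have hw := M.width_pos j
    calc _ ≤ (v j).eval (fl.endpoint (M.lo j) (M.hi j)) ^ 2 * (|c| * M.width j) := by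
          gcongr
          exact (hc j).trans (mul_le_mul_of_nonneg_right (le_abs_self c) hw.le)
      _ = |c| * ((v j).eval (fl.endpoint (M.lo j) (M.hi j)) ^ 2 * (M.hi j - M.lo j)) := by
          rw [Mesh.width]; ring
      _ ≤ |c| * (C * ∫ y in M.lo j..M.hi j, (v j).eval y * (v j).eval y) := by gcongr
      _ = _ := by ring
  calc _ ≤ 2 * (∑ j, (v j).eval (fl.endpoint (M.lo j) (M.hi j)) ^ 2) * M.size := by
        gcongr
        exact sum_sq_fluxU_le M v fl bc
    _ = 2 * ∑ j, (v j).eval (fl.endpoint (M.lo j) (M.hi j)) ^ 2 * M.size := by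
        rw [mul_assoc, Finset.sum_mul]
    _ ≤ 2 * ∑ j, C * |c| * ∫ y in M.lo j..M.hi j, (v j).eval y * (v j).eval y := by
        exact mul_le_mul_of_nonneg_left (Finset.sum_le_sum fun j _ => h1 j) zero_le_two
    _ = 2 * C * |c| * ‖coord M k v‖ ^ 2 := by
        rw [sq_norm_coord M k hv, ← Finset.mul_sum]
        ring

/-- Bounds of order `2 k + 1` in `L²(0, 2π)` give the same order for the root mean square at the
nodes, and half an order less for the maximum. -/
theorem exists_nodal_le (k : ℕ) (c : ℝ) : ∃ C : ℝ, 0 < C ∧ ∀ {N : ℕ} {M : Mesh N},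
    M.QuasiUniform c → ∀ {v : Fin N → ℝ[X]}, (∀ j, (v j).natDegree ≤ k) → ∀ (fl : Flux)
    (bc : Boundary) {B : ℝ}, 0 ≤ B → ‖coord M k v‖ ≤ B * M.size ^ (2 * k + 1) →
    nodalMax (fluxU M 0 v fl bc.homogeneous) ≤ C * B * M.size ^ (2 * (k : ℝ) + 1 / 2) ∧
    nodalRMS (fluxU M 0 v fl bc.homogeneous) ≤ C * B * M.size ^ (2 * k + 1) := by
  obtain ⟨C, hC1, hC⟩ := exists_sum_sq_fluxU_le k
  refine ⟨√(C * |c|) + 1, by positivity, fun {N M} hc v hv fl bc B hB hvB => ?_⟩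
  have hs := M.size_pos
  set F := fluxU M 0 v fl bc.homogeneous with hF
  have hsum : ∑ i, F i ^ 2 ≤ C * |c| * (B * M.size ^ (2 * k + 1)) ^ 2 / M.size :=
    (hC hc hv fl bc).trans (by gcongr)
  have hA2 : √(C * |c|) ^ 2 = C * |c| := Real.sq_sqrt (by positivity)
  set A := √(C * |c|) with hA
  have hA0 : 0 ≤ A := Real.sqrt_nonneg _
  constructor
  · refine ciSup_le fun i => abs_le_of_sq_le_sq ?_ (by positivity)
    have hpow : (M.size ^ (2 * (k : ℝ) + 1 / 2)) ^ 2 = (M.size ^ (2 * k + 1)) ^ 2 / M.size := by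
      rw [← Real.rpow_natCast (M.size ^ (2 * (k : ℝ) + 1 / 2)), ← Real.rpow_mul hs.le,
        eq_div_iff hs.ne', ← pow_mul, ← Real.rpow_natCast, ← Real.rpow_add_one hs.ne']
      congr 1
      push_cast
      ring
    calc F i ^ 2 ≤ ∑ i, F i ^ 2 :=
          Finset.single_le_sum (f := fun i => F i ^ 2) (fun i _ => sq_nonneg _) (Finset.mem_univ i)
      _ ≤ A ^ 2 * (B * M.size ^ (2 * k + 1)) ^ 2 / M.size := by rw [hA2]; exact hsum
      _ = A ^ 2 * B ^ 2 * (M.size ^ (2 * (k : ℝ) + 1 / 2)) ^ 2 := by rw [hpow]; ring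
      _ ≤ (A + 1) ^ 2 * B ^ 2 * (M.size ^ (2 * (k : ℝ) + 1 / 2)) ^ 2 := by gcongr; linarith
      _ = _ := by ring
  · refine Real.sqrt_le_iff.2 ⟨by positivity, ?_⟩
    have h1 : 1 ≤ ((N : ℝ) + 1) * M.size := by
      linarith [M.two_pi_le, Real.pi_gt_three]
    calc 1 / ((N : ℝ) + 1) * ∑ i, F i ^ 2
        ≤ M.size * (A ^ 2 * (B * M.size ^ (2 * k + 1)) ^ 2 / M.size) := by
          rw [hA2]
          have : 1 / ((N : ℝ) + 1) ≤ M.size := by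
            rw [div_le_iff₀ (by positivity)]; linarith
          have h0 : 0 ≤ ∑ i, F i ^ 2 := Finset.sum_nonneg fun i _ => sq_nonneg _
          gcongr
      _ = A ^ 2 * B ^ 2 * (M.size ^ (2 * k + 1)) ^ 2 := by field_simp
      _ ≤ (A + 1) ^ 2 * B ^ 2 * (M.size ^ (2 * k + 1)) ^ 2 := by gcongr; linarith
      _ = _ := by ring

theorem le_mul_of_forall_pos_le_mul_add {a b x : ℝ} (h : ∀ δ > 0, a ≤ b * (x + δ)) : a ≤ b * x := by
  have hc : Filter.Tendsto (fun δ => b * (x + δ)) (nhdsWithin 0 (Ioi 0)) (nhds (b * (x + 0))) :=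
    (by fun_prop : Continuous fun δ => b * (x + δ)).continuousAt.tendsto.mono_left
      nhdsWithin_le_nhds
  rw [add_zero] at hc
  exact ge_of_tendsto hc (eventually_nhdsWithin_of_forall h)

/-- Classical representations of `u(·, s)` with the bound `supNorm (n + 1) u t + δ` for all
`s ≤ t`. The representation of `u(·, s)` depends on `δ`, but not on `t`. -/
theorem exists_family_isClassicalRep {T : ℝ} {u : ℝ → ℝ → ℝ} (hu : IsHeatSolution T u) (n : ℕ)
    (hfin : supNorm (n + 1) u T < ⊤) {δ : ℝ} (hδ : 0 < δ) : ∃ D : ℝ → ℕ → ℝ → ℝ,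
    ∀ t ∈ Icc 0 T, ∀ s ∈ Icc 0 t, IsClassicalRep 0 (2 * Real.pi) n
      ((supNorm (n + 1) u t).toReal + δ) (fun x => u x s) (D s) := by
  have hle : ∀ t, ∀ s ∈ Icc 0 t, sobolevNorm 0 (2 * Real.pi) (n + 1) (fun x => u x s) ≤
      supNorm (n + 1) u t := fun t s hs =>
    le_iSup₂ (f := fun s _ => sobolevNorm 0 (2 * Real.pi) (n + 1) fun x => u x s) s hs
  have hex : ∀ s ∈ Icc 0 T, ∃ D, IsClassicalRep 0 (2 * Real.pi) n
      ((sobolevNorm 0 (2 * Real.pi) (n + 1) fun x => u x s).toReal + δ) (fun x => u x s) D := by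
    intro s hs
    refine exists_isClassicalRep (by positivity) (by positivity) n ?_ ?_
    · exact hu.continuousOn.comp (f := fun x => (x, s)) (by fun_prop) fun x hx => ⟨hx, hs⟩
    · have hlt := (hle T s hs).trans_lt hfin
      rw [ENNReal.lt_ofReal_iff_toReal_lt hlt.ne]
      linarith
  choose! D hD using hex
  refine ⟨D, fun t ht s hs => (hD s ⟨hs.1, hs.2.trans ht.2⟩).mono ?_⟩
  have hmono : supNorm (n + 1) u t ≤ supNorm (n + 1) u T :=
    iSup₂_le fun s hs => hle T s ⟨hs.1, hs.2.trans ht.2⟩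
  gcongr
  · exact (hmono.trans_lt hfin).ne
  · exact hle t s hs

end LDG

end

theorem theorem4p2 (k : ℕ) (hk : 1 ≤ k) (c : ℝ) :
    ∃ K : ℝ, 0 < K ∧
      ∀ (T : ℝ) (_ : 0 < T) (fl : LDG.Flux) (bc : LDG.Boundary) (u : ℝ → ℝ → ℝ)
        (_ : LDG.IsHeatSolution T u) (_ : LDG.SatisfiesBoundary T u fl bc)
        (_ : LDG.supNorm (2 * k + 2) u T < ⊤)
        (N : ℕ) (M : LDG.Mesh N) (_ : M.QuasiUniform c)
        (uh qh : ℝ → Fin N → Polynomial ℝ) (_ : LDG.IsLDGSolution k M T fl bc uh qh)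
        (_ : ∀ j, uh 0 j = LDG.interpolant k k (M.lo j) (M.hi j) T u 0 fl),
        ∀ t ∈ Set.Icc 0 T,
          LDG.nodalMax (LDG.errU M fl bc u uh t) ≤
              K * (1 + t) * M.size ^ (2 * (k : ℝ) + 1 / 2) *
                (LDG.supNorm (2 * k + 2) u t).toReal ∧
          LDG.nodalMax (LDG.errQ M fl bc u qh t) ≤
              K * (1 + Real.sqrt t) * M.size ^ (2 * (k : ℝ) + 1 / 2) *
                (LDG.supNorm (2 * k + 2) u t).toReal ∧
          LDG.nodalRMS (LDG.errU M fl bc u uh t) ≤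
              K * (1 + t) * M.size ^ (2 * k + 1) *
                (LDG.supNorm (2 * k + 2) u t).toReal ∧
          LDG.nodalRMS (LDG.errQ M fl bc u qh t) ≤
              K * (1 + Real.sqrt t) * M.size ^ (2 * k + 1) *
                (LDG.supNorm (2 * k + 2) u t).toReal := by
  obtain ⟨C, hC1, hC⟩ := LDG.exists_supercloseness k hk
  obtain ⟨C', hC'0, hC'⟩ := LDG.exists_nodal_le k c
  refine ⟨C' * C, by positivity, ?_⟩
  intro T hT fl bc u hu hbc hfin N M hc uh qh hL hinit t ht
  have hTT : T ∈ Set.Icc 0 T := ⟨hT.le, le_rfl⟩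
  have h0t := ht.1
  -- the margin `δ` is lost in the passage to classical representations
  have key : ∀ δ > 0,
      (LDG.nodalMax (LDG.errU M fl bc u uh t) ≤
        C' * C * (1 + t) * M.size ^ (2 * (k : ℝ) + 1 / 2) *
          ((LDG.supNorm (2 * k + 2) u t).toReal + δ) ∧
      LDG.nodalRMS (LDG.errU M fl bc u uh t) ≤ C' * C * (1 + t) * M.size ^ (2 * k + 1) *
          ((LDG.supNorm (2 * k + 2) u t).toReal + δ)) ∧
      (LDG.nodalMax (LDG.errQ M fl bc u qh t) ≤
        C' * C * (1 + √t) * M.size ^ (2 * (k : ℝ) + 1 / 2) *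
          ((LDG.supNorm (2 * k + 2) u t).toReal + δ) ∧
      LDG.nodalRMS (LDG.errQ M fl bc u qh t) ≤ C' * C * (1 + √t) * M.size ^ (2 * k + 1) *
          ((LDG.supNorm (2 * k + 2) u t).toReal + δ)) := by
    intro δ hδ
    obtain ⟨D, hD⟩ := LDG.exists_family_isClassicalRep hu (2 * k + 1) hfin hδ
    rw [show 2 * k + 1 + 1 = 2 * k + 2 from rfl] at hD
    set Z := (LDG.supNorm (2 * k + 2) u t).toReal + δ with hZ
    have hZ0 : 0 < Z := by positivity
    have hDt := hD t ht t ⟨ht.1, le_rfl⟩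
    obtain ⟨b1, b2⟩ := hC hT hu hbc (hD T hTT) (by positivity) hL hinit t ht hZ0 (hD t ht)
    have eU : LDG.errU M fl bc u uh t =
        LDG.fluxU M 0 (LDG.interp M k fl (D t) 0 - uh t) fl bc.homogeneous :=
      funext fun i => LDG.errU_eq hbc ht hDt i
    have eQ : LDG.errQ M fl bc u qh t =
        LDG.fluxU M 0 (LDG.interp M k fl (D t) 1 - qh t) fl.swap bc.homogeneous :=
      funext fun i => LDG.errQ_eq hbc ht (by omega) hDt i
    obtain ⟨c1, c2⟩ := hC' hc (v := LDG.interp M k fl (D t) 0 - uh t)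
      (fun j => (Polynomial.natDegree_sub_le _ _).trans (max_le (LDG.natDegree_interp_le M k fl
        (hDt.continuous (by omega)) j) (hL.degree_u t ht j))) fl bc
      (B := C * Z * (1 + t)) (by positivity) (b1.trans (le_of_eq (by ring)))
    obtain ⟨d1, d2⟩ := hC' hc (v := LDG.interp M k fl (D t) 1 - qh t)
      (fun j => (Polynomial.natDegree_sub_le _ _).trans (max_le (LDG.natDegree_interp_le M k fl
        (hDt.continuous (by omega)) j) (hL.degree_q t ht j))) fl.swap bc
      (B := C * Z * (1 + √t)) (by positivity) (b2.trans (le_of_eq (by ring)))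
    rw [eU, eQ]
    exact ⟨⟨c1.trans (le_of_eq (by ring)), c2.trans (le_of_eq (by ring))⟩,
      ⟨d1.trans (le_of_eq (by ring)), d2.trans (le_of_eq (by ring))⟩⟩
  refine ⟨?_, ?_, ?_, ?_⟩ <;> refine LDG.le_mul_of_forall_pos_le_mul_add fun δ hδ => ?_
  · exact (key δ hδ).1.1
  · exact (key δ hδ).2.1
  · exact (key δ hδ).1.2
  · exact (key δ hδ).2.2
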